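/- Fix $\gamma>0$ and let $T_\gamma$ be either of the Fourier multipliers $\ln^{-\gamma}(e-\Delta)$ or $\ln^{-\gamma}(e+|\nabla|)$ on $\mathbb{R}^2$. Consider the logarithmically regularized 2D Euler equations $$\partial_t\omega+u\cdot\nabla\omega=0,\qquad u=\nabla^\perp\Delta^{-1}T_\gamma\omega,\qquad \omega|_{t=0}=\omega_0,\tag{LE}$$ with $\nabla^\perp=(-\partial_2,\partial_1)$. There is a constant $C=C(\gamma)>0$ with the following property. Let $g\in C_c^\infty(\mathbb{R}^2)$ satisfy: (i) $g$ is odd in $x_1$ and odd in $x_2$; (ii) $g(x_1,x_2)\ge 0$ whenever $x_1\ge0$ and $x_2\ge 0$; (iii) $$G:=\int_{x_1>0,\,x_2>0} g(x)\,\frac{x_1x_2}{|x|^4}\,\ln^{-\gamma}\Big(e+\frac1{|x|}\Big)\,e^{-|x|^4}\,dx>0 .$$ Let $\omega\in C^\infty(\mathbb{R}^2\times[0,\infty))$ be a smooth solution of (LE) for $t\ge 0$ with $\omega_0=g$ (bounded in $L^1\cap L^\infty$ on bounded time intervals, and such that for every $t\ge0$ the Fourier integral defining $u(\cdot,t)$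 converges absolutely), and let $\phi$ be its characteristic line, $\partial_t\phi(x,t)=u(\phi(x,t),t)$, $\phi(x,0)=x$. Then $\phi(\cdot,t)$ is differentiable with $\|D\phi(\cdot,t)\|_\infty:=\sup_x|D\phi(x,t)|<\infty$ for every $t\ge0$, where $|\cdot|$ is the Euclidean operator norm, and $$\int_0^t e^{-\|D\phi(\cdot,\tau)\|_\infty^4}\,d\tau\le\frac1{CG}\ln(1+CGt)\qquad\text{for all }t\ge0 .$$ In particular, the maximum below is attained and $$\max_{0\le\tau\le t}\|D\phi(\cdot,\tau)\|_\infty\ \ge\ \ln^{1/4}\!\left(\frac{CGt}{\ln(1+CGt)}\right)\qquad\text{for all }t>0 .$$ -/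

import Mathlib

open scoped FourierTransform ContDiff

namespace LogEuler

/-- The Euclidean plane. -/
abbrev Plane : Type := EuclideanSpace ℝ (Fin 2)

/-- The two regularizing operators `T_γ`:
`laplacian` stands for `ln^{-γ}(e - Δ)` and `gradient` for `ln^{-γ}(e + |∇|)`. -/
inductive Regularization : Type
  | laplacian : Regularization
  | gradient : Regularization

/-- The Fourier multiplier of `T_γ` at a frequency of modulus `r`. -/
noncomputable def Regularization.symbol (R : Regularization) (γ r : ℝ) : ℝ :=
  match R with
  | .laplacian => Real.log (Real.exp 1 + r ^ 2) ^ (-γ)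
  | .gradient => Real.log (Real.exp 1 + r) ^ (-γ)

/-- Rotation by a right angle, `(k₁, k₂)^⊥ = (-k₂, k₁)`. -/
noncomputable def perp (k : Plane) : Plane := !₂[-(k 1), k 0]

/-- The symbol of the `j`-th component of `∇^⊥ Δ⁻¹ T_γ`, namely
`-i (k^⊥)_j |k|⁻² T_γ(|k|)`, for the convention in which `∂_j` has symbol `i k_j`. -/
noncomputable def velocitySymbol (R : Regularization) (γ : ℝ) (j : Fin 2) (k : Plane) : ℂ :=
  -Complex.I * ((perp k j / ‖k‖ ^ 2 * R.symbol γ ‖k‖ : ℝ) : ℂ)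

/-- The Fourier transform of the `j`-th component of `∇^⊥ Δ⁻¹ T_γ w`. Mathlib's Fourier transform
has the character `exp (-2 π i ⟨x, ξ⟩)`, so the frequency variable is `k = 2 π ξ`. -/
noncomputable def velocityHat (R : Regularization) (γ : ℝ) (w : Plane → ℝ) (j : Fin 2)
    (ξ : Plane) : ℂ :=
  velocitySymbol R γ j ((2 * Real.pi) • ξ) * 𝓕 (fun y : Plane => (w y : ℂ)) ξ

/-- The velocity field `∇^⊥ Δ⁻¹ T_γ w`. (For real `w` the inverse Fourier transform is real.) -/
noncomputable def velocity (R : Regularization) (γ : ℝ) (w : Plane → ℝ) (x : Plane) : Plane :=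
  !₂[(𝓕⁻ (velocityHat R γ w 0) x).re, (𝓕⁻ (velocityHat R γ w 1) x).re]

/-- `w` is a smooth solution, on `[0, ∞) × ℝ²`, of
`∂_t w + u · ∇w = 0`, `u = ∇^⊥ Δ⁻¹ T_γ w`, `w(0) = g`.
It is bounded in `L¹ ∩ L^∞` on bounded time intervals, and the Fourier integral which defines its
velocity converges absolutely at every time. -/
structure IsSmoothSolution (R : Regularization) (γ : ℝ) (g : Plane → ℝ) (w : ℝ → Plane → ℝ) :
    Prop where
  smooth : ContDiffOn ℝ ∞ (fun p : ℝ × Plane => w p.1 p.2) (Set.Ici 0 ×ˢ Set.univ)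
  initial : ∀ x, w 0 x = g x
  integrable : ∀ t, 0 ≤ t → MeasureTheory.Integrable (w t)
  bounded : ∀ S : ℝ, ∃ M : ℝ, ∀ t ∈ Set.Icc 0 S, (∫ x, |w t x|) ≤ M ∧ ∀ x, |w t x| ≤ M
  velocity_integrable : ∀ t, 0 ≤ t → ∀ j, MeasureTheory.Integrable (velocityHat R γ (w t) j)
  transport : ∀ t, 0 ≤ t → ∀ x,
    HasDerivWithinAt (fun s => w s x) (-(fderiv ℝ (w t) x (velocity R γ (w t) x))) (Set.Ici 0) t

/-- `φ` is the characteristic line of `w`: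
`∂_t φ(x, t) = (∇^⊥ Δ⁻¹ T_γ w)(φ(x, t), t)` for `t ≥ 0`, and `φ(x, 0) = x`. -/
structure IsCharacteristicFlow (R : Regularization) (γ : ℝ) (w : ℝ → Plane → ℝ)
    (φ : ℝ → Plane → Plane) : Prop where
  initial : ∀ x, φ 0 x = x
  ode : ∀ t, 0 ≤ t → ∀ x,
    HasDerivWithinAt (fun s => φ s x) (velocity R γ (w t) (φ t x)) (Set.Ici 0) t

/-- `‖Df‖_∞`, the supremum over the plane of the operator norm of the derivative. -/
noncomputable def deformationNorm (f : Plane → Plane) : ℝ := ⨆ x, ‖fderiv ℝ f x‖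

/-- The weighted integral
`G = ∫_{x₁ > 0, x₂ > 0} g(x) x₁ x₂ |x|⁻⁴ ln^{-γ}(e + 1/|x|) e^{-|x|⁴} dx`. -/
noncomputable def weightedIntegral (γ : ℝ) (g : Plane → ℝ) : ℝ :=
  ∫ x in {x : Plane | 0 < x 0 ∧ 0 < x 1},
    g x * (x 0 * x 1 / ‖x‖ ^ 4) * Real.log (Real.exp 1 + 1 / ‖x‖) ^ (-γ) * Real.exp (-‖x‖ ^ 4)

end LogEuler

/-!
The heart of the matter is a hyperbolic point at the origin. By oddness the vorticity keeps its
sign pattern, the axes are invariant, and on the positive first axis the velocity points away from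
the origin. Write `D(t)` for the deformation norm. If `D(t)` stays moderate, the quadrant's
vorticity has not moved far, so the strain at the origin is bounded below by a multiple of
`G e^{-D⁴}`. A particle started at `(a, 0)` then recedes at the rate
`p' ≥ c G e^{-D⁴} p`, whereas `p ≤ a D`. As `a → 0` this gives `log D(t) ≥ c G F(t)` with
`F(t) = ∫₀ᵗ e^{-D⁴}` (`IsSmoothSolution.integral_le_log_deformationNorm`). Since `D⁴ ≥ log D`, the
function `F` satisfies `F' ≤ e^{-cGF}`, that is, `e^{cGF(t)} ≤ 1 + cGt`
(`integral_exp_neg_le_log`), and the bound for the maximum follows from `t e^{-max D⁴} ≤ F(t)`.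

The lower bound for the strain needs a kernel for both multipliers at once. Each symbol is a
mixture of heat semigroups, `T_γ = ∫ e^{sΔ} dμ(s)` for a probability measure `μ` on `(0, ∞)`
(`exists_isHeatMixture`): `ln^{-γ}(e + q)` is completely monotone in `q`, and `e^{-r}` is a mixture
of Gaussians. Hence the velocity is a convolution with `H(|z|²) z^⊥`, where `H` is an average of the
explicit kernels `(1 - e^{-|z|²/4s}) / (2π|z|²)` (`IsHeatMixture.velocity_eq`), and `H` decreases at
a quantitative rate (`IsHeatMixture.radialKernel_sub`). Folding the integral along the second axis
makes the integrand nonnegative; it is then restricted to the first quadrant and transported to the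
initial time by the flow, where `x_i ≤ D φ_i(x)` and `|φ(x)| ≤ D |x|` bound it from below
(`IsSmoothSolution.velocity_flow_ge`).

The remaining work is regularity. The kernel bound `|H(|z|²) z^⊥| ≤ 1/|z|` makes the velocity
bounded, so the solution keeps compact support; differentiating the vorticity instead of the
kernel, the velocity is continuously differentiable with bounded trace-free gradient. The flow is
therefore a bijection, differentiable in space with determinant one, and its inverse has the same
Lipschitz constant `D` (`IsFlow.norm_sub_le_mul_norm_image_sub`). The symmetry and the sign of the
solution are obtained from a maximum principle along backward characteristics.
-/

namespace LogEuler

open MeasureTheory Set Filter Topology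
open scoped FourierTransform ContDiff ENNReal NNReal RealInnerProductSpace

section

/-! ### Subordination: the symbols as mixtures of Gaussians -/

theorem lintegral_gamma {a b : ℝ} (ha : 0 < a) (hb : 0 < b) :
    ∫⁻ t in Ioi (0 : ℝ), ENNReal.ofReal (t ^ (a - 1) * Real.exp (-(b * t)) / Real.Gamma a)
      = ENNReal.ofReal ((1 / b) ^ a) := by
  have h1 := Real.integral_rpow_mul_exp_neg_mul_Ioi ha hb
  have hG := Real.Gamma_pos_of_pos ha
  have h2 : ∫ t in Ioi (0 : ℝ), t ^ (a - 1) * Real.exp (-(b * t)) / Real.Gamma a = (1 / b) ^ a := by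
    rw [integral_div, h1, mul_div_assoc, div_self hG.ne', mul_one]
  rw [← h2, ofReal_integral_eq_lintegral_ofReal]
  · by_contra hc
    rw [integral_undef hc] at h2
    have : 0 < (1 / b) ^ a := by positivity
    exact this.ne h2
  · filter_upwards [ae_restrict_mem measurableSet_Ioi] with t ht
    have : (0 : ℝ) < t := ht
    positivity

theorem measurable_rpow_mul_exp_div_Gamma (b : ℝ) :
    Measurable (fun p : ℝ × ℝ => (Ioi (0 : ℝ)).indicator (fun s => 1 / Real.Gamma s) p.1
      * (p.2 ^ (p.1 - 1) * Real.exp (-(b * p.2)))) := by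
  have h : Measurable ((Ioi (0 : ℝ)).indicator (fun s => 1 / Real.Gamma s)) := by
    classical
    rw [← piecewise_eq_indicator]
    refine ContinuousOn.measurable_piecewise ?_ continuousOn_const measurableSet_Ioi
    intro s hs
    have hs : (0 : ℝ) < s := hs
    refine (ContinuousAt.div continuousAt_const ?_
      (Real.Gamma_pos_of_pos hs).ne').continuousWithinAt
    refine (Real.differentiableAt_Gamma fun m => ?_).continuousAt
    have : (0 : ℝ) ≤ m := m.cast_nonneg
    linarith
  exact (h.comp (measurable_fst : Measurable (Prod.fst : ℝ × ℝ → ℝ))).mul (by fun_prop)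

/-- `ln^{-γ}(e + q)` is a mixture of the exponentials `e^{-tq}`: two Gamma integrals give
`ln^{-γ}(e + q) = Γ(γ)⁻¹ ∫ s^{γ-1} (e + q)^{-s} ds` and
`(e + q)^{-s} = Γ(s)⁻¹ ∫ t^{s-1} e^{-et} e^{-tq} dt`, and `μ` is the law of the inner variable
`t`. -/
theorem exists_measure_log_rpow {γ : ℝ} (hγ : 0 < γ) :
    ∃ μ : Measure ℝ, μ (Iic 0) = 0 ∧ ∀ q : ℝ, 0 ≤ q →
      ∫⁻ t, ENNReal.ofReal (Real.exp (-(t * q))) ∂μ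
        = ENNReal.ofReal (Real.log (Real.exp 1 + q) ^ (-γ)) := by
  let d : ℝ × ℝ → ℝ≥0∞ := fun p => ENNReal.ofReal (p.1 ^ (γ - 1) / Real.Gamma γ) *
    ENNReal.ofReal ((Ioi (0 : ℝ)).indicator (fun s => 1 / Real.Gamma s) p.1
      * (p.2 ^ (p.1 - 1) * Real.exp (-(Real.exp 1 * p.2))))
  have hd : Measurable d := by
    have := measurable_rpow_mul_exp_div_Gamma (Real.exp 1)
    fun_prop
  let P : Measure (ℝ × ℝ) := (volume.restrict (Ioi (0 : ℝ))).prod (volume.restrict (Ioi (0 : ℝ)))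
  refine ⟨(P.withDensity d).map Prod.snd, ?_, fun q hq => ?_⟩
  · rw [Measure.map_apply measurable_snd measurableSet_Iic]
    refine withDensity_absolutelyContinuous _ _ ?_
    have : (Prod.snd ⁻¹' Iic (0 : ℝ) : Set (ℝ × ℝ)) = univ ×ˢ Iic 0 := by ext; simp
    rw [this, Measure.prod_prod, Measure.restrict_apply measurableSet_Iic,
      show Iic (0 : ℝ) ∩ Ioi 0 = ∅ from Iic_inter_Ioi.trans (by simp)]
    simp
  · have hm : Measurable fun t : ℝ => ENNReal.ofReal (Real.exp (-(t * q))) := by fun_prop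
    rw [lintegral_map hm measurable_snd]
    change ∫⁻ a, ((fun t : ℝ => ENNReal.ofReal (Real.exp (-(t * q)))) ∘ Prod.snd) a
      ∂(P.withDensity d) = _
    rw [lintegral_withDensity_eq_lintegral_mul _ hd (hm.comp measurable_snd)]
    rw [lintegral_prod _ (hd.mul (hm.comp measurable_snd)).aemeasurable]
    have he : 0 < Real.exp 1 + q := by positivity
    have hl : 0 < Real.log (Real.exp 1 + q) := by
      apply Real.log_pos
      have := Real.add_one_lt_exp (one_ne_zero)
      linarith
    have key : ∀ s ∈ Ioi (0 : ℝ), (∫⁻ t in Ioi (0 : ℝ),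
        (d * ((fun t : ℝ => ENNReal.ofReal (Real.exp (-(t * q)))) ∘ Prod.snd :
          ℝ × ℝ → ℝ≥0∞)) (s, t)) =
        ENNReal.ofReal (s ^ (γ - 1) * Real.exp (-(Real.log (Real.exp 1 + q) * s)) /
          Real.Gamma γ) := by
      intro s hs
      have hs' : (0 : ℝ) < s := hs
      have h0 : ∀ t : ℝ, (d * ((fun t : ℝ => ENNReal.ofReal (Real.exp (-(t * q)))) ∘ Prod.snd :
            ℝ × ℝ → ℝ≥0∞)) (s, t)
          = ENNReal.ofReal (s ^ (γ - 1) / Real.Gamma γ) * ENNReal.ofReal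
            (t ^ (s - 1) * Real.exp (-((Real.exp 1 + q) * t)) / Real.Gamma s) := by
        intro t
        simp only [Pi.mul_apply, d, Function.comp_apply, indicator_of_mem hs]
        rw [mul_assoc, ← ENNReal.ofReal_mul' (Real.exp_pos _).le]
        congr 2
        rw [show -((Real.exp 1 + q) * t) = -(Real.exp 1 * t) + -(t * q) by ring, Real.exp_add]
        ring
      simp only [h0]
      rw [lintegral_const_mul' _ _ ENNReal.ofReal_ne_top, lintegral_gamma hs' he,
        ← ENNReal.ofReal_mul' (by positivity)]
      congr 1
      rw [one_div, Real.inv_rpow he.le, Real.rpow_def_of_pos he, ← Real.exp_neg]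
      ring
    rw [setLIntegral_congr_fun measurableSet_Ioi key, lintegral_gamma hγ hl, one_div,
      Real.inv_rpow hl.le, Real.rpow_neg hl.le]

/-- The Cauchy–Schlömilch transformation: `s ↦ s - c / s` maps `(0, ∞)` onto `ℝ`, and the
involution `s ↦ c / s` changes its sign, so that averaging over this involution turns the Jacobian
`1 + c / s ^ 2` into the constant `2`. -/
theorem lintegral_sub_div {c : ℝ} (hc : 0 < c) {f : ℝ → ℝ≥0∞} (hf : Measurable f)
    (heven : ∀ x, f (-x) = f x) :
    2 * ∫⁻ s in Ioi (0 : ℝ), f (s - c / s) = ∫⁻ x, f x := by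
  have himg : (fun s : ℝ => s - c / s) '' Ioi 0 = univ := by
    refine eq_univ_of_forall fun y => ?_
    have h1 : 0 < y + √(y ^ 2 + 4 * c) := by
      have : |y| < √(y ^ 2 + 4 * c) := Real.lt_sqrt_of_sq_lt (by rw [sq_abs]; linarith)
      have := neg_abs_le y
      linarith
    refine ⟨(y + √(y ^ 2 + 4 * c)) / 2, by simp only [mem_Ioi]; positivity, ?_⟩
    have h2 : √(y ^ 2 + 4 * c) ^ 2 = y ^ 2 + 4 * c := Real.sq_sqrt (by positivity)
    simp only
    field_simp
    nlinarith
  have hmono : StrictMonoOn (fun s : ℝ => s - c / s) (Ioi 0) := by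
    intro s hs t ht hst
    have hs : 0 < s := hs
    have : c / t < c / s := div_lt_div_of_pos_left hc hs hst
    simp only
    linarith
  have h1 := lintegral_image_eq_lintegral_abs_deriv_mul (f := fun s : ℝ => s - c / s)
    (f' := fun s => 1 + c / s ^ 2) measurableSet_Ioi (s := Ioi 0) (fun s hs => by
      have hs : s ≠ 0 := ne_of_gt hs
      have := (hasDerivAt_id s).sub ((hasDerivAt_inv hs).const_mul c)
      refine (this.congr_deriv ?_).hasDerivWithinAt
      field_simp
      ring) hmono.injOn f
  have h2 := lintegral_image_eq_lintegral_abs_deriv_mul (f := fun s : ℝ => c / s)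
    (f' := fun s => - (c / s ^ 2)) measurableSet_Ioi (s := Ioi 0) (fun s hs => by
      have hs : s ≠ 0 := ne_of_gt hs
      have := ((hasDerivAt_inv hs).const_mul c)
      refine (this.congr_deriv ?_).hasDerivWithinAt
      field_simp) (fun s hs t ht h => by
        have hs : s ≠ 0 := ne_of_gt hs
        have ht : t ≠ 0 := ne_of_gt ht
        simp only at h
        field_simp at h
        exact h.symm) (fun u => f (u - c / u))
  have himg2 : (fun s : ℝ => c / s) '' Ioi 0 = Ioi 0 := by
    ext y
    constructor
    · rintro ⟨s, hs, rfl⟩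
      exact div_pos hc hs
    · intro hy
      exact ⟨c / y, div_pos hc hy, div_div_cancel₀ hc.ne'⟩
  rw [himg, setLIntegral_univ] at h1
  rw [himg2] at h2
  rw [h1, two_mul]
  nth_rewrite 2 [h2]
  rw [← lintegral_add_left (by fun_prop)]
  refine setLIntegral_congr_fun measurableSet_Ioi fun s hs => ?_
  have hs : 0 < s := hs
  have e : c / s - c / (c / s) = -(s - c / s) := by field_simp; ring
  rw [e, heven, abs_neg, abs_of_pos (by positivity), abs_of_pos (by positivity),
    ENNReal.ofReal_add (by positivity) (by positivity), ENNReal.ofReal_one, add_mul, one_mul]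

/-- `e^{-r}` is a mixture of the Gaussians `e^{-v r ^ 2}`: completing the square,
`e^{-s²} e^{-r²/(4s²)} = e^{-r} e^{-(s - r/(2s))²}`, and the Cauchy–Schlömilch transformation
computes the integral over `s`. Thus `v = 1 / (4 s ^ 2)` with `s` half-normal. -/
theorem exists_measure_exp_neg :
    ∃ κ : Measure ℝ, SFinite κ ∧ κ (Iic 0) = 0 ∧ ∀ r : ℝ, 0 ≤ r →
      ∫⁻ v, ENNReal.ofReal (Real.exp (-(v * r ^ 2))) ∂κ = ENNReal.ofReal (Real.exp (-r)) := by
  let ρ : Measure ℝ := (volume.restrict (Ioi (0 : ℝ))).withDensity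
    (fun s => ENNReal.ofReal (2 / √Real.pi * Real.exp (-s ^ 2)))
  have hm : Measurable fun s : ℝ => 1 / (4 * s ^ 2) := by fun_prop
  have hpi : 0 < √Real.pi := by positivity
  have hgauss : ∫⁻ x : ℝ, ENNReal.ofReal (Real.exp (-x ^ 2)) = ENNReal.ofReal √Real.pi := by
    have := integral_gaussian 1
    simp only [neg_mul, one_mul, div_one] at this
    rw [← this, ofReal_integral_eq_lintegral_ofReal]
    · simpa using integrable_exp_neg_mul_sq one_pos
    · exact ae_of_all _ fun x => (Real.exp_pos _).le
  have hI : ∀ r : ℝ, 0 ≤ r → 2 * ∫⁻ s in Ioi (0 : ℝ),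
      ENNReal.ofReal (Real.exp (-(s - r / 2 / s) ^ 2)) = ENNReal.ofReal √Real.pi := by
    intro r hr
    rcases hr.eq_or_lt with rfl | hr
    · simp only [zero_div, sub_zero]
      rw [← hgauss, ← lintegral_add_compl (fun x : ℝ => ENNReal.ofReal (Real.exp (-x ^ 2)))
        (measurableSet_Ioi (a := (0 : ℝ))) (μ := volume), compl_Ioi, two_mul]
      congr 1
      rw [← restrict_Iio_eq_restrict_Iic]
      have := (Measure.measurePreserving_neg (volume : Measure ℝ)).setLIntegral_comp_preimage
        (measurableSet_Iio (a := (0 : ℝ))) (f := fun s => ENNReal.ofReal (Real.exp (-s ^ 2)))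
        (by fun_prop)
      simpa using this
    · rw [lintegral_sub_div (f := fun x => ENNReal.ofReal (Real.exp (-x ^ 2))) (by positivity)
        (by fun_prop) (by intro x; simp), hgauss]
  refine ⟨ρ.map fun s => 1 / (4 * s ^ 2), inferInstance, ?_, fun r hr => ?_⟩
  · rw [Measure.map_apply hm measurableSet_Iic]
    refine withDensity_absolutelyContinuous _ _ ?_
    rw [Measure.restrict_apply (hm measurableSet_Iic)]
    convert measure_empty (μ := (volume : Measure ℝ))
    ext s
    simp only [mem_inter_iff, mem_preimage, mem_Iic, mem_Ioi, mem_empty_iff_false, iff_false,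
      not_and, not_lt]
    intro h
    by_contra! hs
    have : 0 < 1 / (4 * s ^ 2) := by positivity
    linarith
  · rw [lintegral_map (by fun_prop) hm, lintegral_withDensity_eq_lintegral_mul _ (by fun_prop)
      (by fun_prop)]
    have key : ∀ s ∈ Ioi (0 : ℝ), ((fun s => ENNReal.ofReal (2 / √Real.pi * Real.exp (-s ^ 2))) *
        fun s => ENNReal.ofReal (Real.exp (-(1 / (4 * s ^ 2) * r ^ 2)))) s =
        ENNReal.ofReal (Real.exp (-r) / √Real.pi) *
          (2 * ENNReal.ofReal (Real.exp (-(s - r / 2 / s) ^ 2))) := by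
      intro s hs
      have hs : 0 < s := hs
      have h2 : (2 : ℝ≥0∞) = ENNReal.ofReal 2 := by simp
      simp only [Pi.mul_apply]
      rw [h2, ← ENNReal.ofReal_mul (by positivity), ← ENNReal.ofReal_mul (by positivity),
        ← ENNReal.ofReal_mul (by positivity)]
      congr 1
      have e : Real.exp (-s ^ 2) * Real.exp (-(1 / (4 * s ^ 2) * r ^ 2)) =
          Real.exp (-r) * Real.exp (-(s - r / 2 / s) ^ 2) := by
        rw [← Real.exp_add, ← Real.exp_add]
        congr 1
        field_simp
        ring
      rw [mul_assoc, e]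
      ring
    rw [setLIntegral_congr_fun measurableSet_Ioi key, lintegral_const_mul _ (by fun_prop),
      lintegral_const_mul _ (by fun_prop), hI r hr, ← ENNReal.ofReal_mul (by positivity),
      div_mul_cancel₀ _ hpi.ne']

/-- `μ` is a probability law of positive heat times `t` with `T_γ = ∫ e^{tΔ} dμ(t)`, expressed on
the symbols. -/
structure IsHeatMixture (R : Regularization) (γ : ℝ) (μ : Measure ℝ) : Prop where
  prob : IsProbabilityMeasure μ
  pos : ∀ᵐ t ∂μ, 0 < t
  symbol_eq : ∀ r, 0 ≤ r → ∫ t, Real.exp (-(t * r ^ 2)) ∂μ = R.symbol γ r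

theorem symbol_zero (R : Regularization) (γ : ℝ) : R.symbol γ 0 = 1 := by
  cases R <;> simp [Regularization.symbol]

theorem symbol_nonneg (R : Regularization) (γ : ℝ) {r : ℝ} (hr : 0 ≤ r) : 0 ≤ R.symbol γ r := by
  have h : 1 ≤ Real.exp 1 := Real.one_le_exp zero_le_one
  cases R
  · exact Real.rpow_nonneg (Real.log_nonneg (by nlinarith)) _
  · exact Real.rpow_nonneg (Real.log_nonneg (by linarith)) _

theorem IsHeatMixture.of_lintegral {R : Regularization} {γ : ℝ} {μ : Measure ℝ}
    (h0 : μ (Iic 0) = 0)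
    (h : ∀ r, 0 ≤ r → ∫⁻ t, ENNReal.ofReal (Real.exp (-(t * r ^ 2))) ∂μ
      = ENNReal.ofReal (R.symbol γ r)) : IsHeatMixture R γ μ where
  prob := ⟨by simpa [symbol_zero] using h 0 le_rfl⟩
  pos := by
    rw [ae_iff]
    simpa [Iic_def] using h0
  symbol_eq r hr := by
    rw [integral_eq_lintegral_of_nonneg_ae (ae_of_all _ fun t => (Real.exp_pos _).le) (by fun_prop),
      h r hr, ENNReal.toReal_ofReal (symbol_nonneg R γ hr)]

/-- For `ln^{-γ}(e - Δ)` this is the mixture of exponentials at `q = r ^ 2`. For `ln^{-γ}(e + |∇|)`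
each exponential `e^{-tr}` is itself a mixture of Gaussians. -/
theorem exists_isHeatMixture (R : Regularization) {γ : ℝ} (hγ : 0 < γ) :
    ∃ μ : Measure ℝ, IsHeatMixture R γ μ := by
  obtain ⟨μ, hμ0, hμ⟩ := exists_measure_log_rpow hγ
  cases R
  · exact ⟨μ, .of_lintegral hμ0 fun r hr => hμ _ (sq_nonneg r)⟩
  · obtain ⟨κ, hκs, hκ0, hκ⟩ := exists_measure_exp_neg
    have hm : Measurable fun p : ℝ × ℝ => p.1 ^ 2 * p.2 := by fun_prop
    have hμp : IsProbabilityMeasure μ := ⟨by simpa using hμ 0 le_rfl⟩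
    refine ⟨(μ.prod κ).map fun p => p.1 ^ 2 * p.2, .of_lintegral ?_ fun r hr => ?_⟩
    · rw [Measure.map_apply hm measurableSet_Iic]
      refine measure_mono_null (t := (Iic 0 ×ˢ univ) ∪ (univ ×ˢ Iic 0)) ?_ ?_
      · rintro ⟨s, v⟩ h
        simp only [mem_preimage, mem_Iic] at h
        simp only [mem_union, mem_prod, mem_Iic, mem_univ, and_true, true_and]
        by_contra! hc
        have := mul_pos (pow_pos hc.1 2) hc.2
        linarith
      · refine measure_union_null ?_ ?_
        · rw [Measure.prod_prod, hμ0, zero_mul]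
        · rw [Measure.prod_prod, hκ0, mul_zero]
    · rw [lintegral_map (by fun_prop) hm, lintegral_prod _ (by fun_prop)]
      have hpos : ∀ᵐ t ∂μ, 0 < t := by
        rw [ae_iff]
        simpa [Iic_def] using hμ0
      rw [show Regularization.gradient.symbol γ r = Real.log (Real.exp 1 + r) ^ (-γ) from rfl,
        ← hμ r hr]
      refine lintegral_congr_ae ?_
      filter_upwards [hpos] with t ht
      rw [← hκ _ (by positivity)]
      refine lintegral_congr fun v => ?_
      ring_nf

end

section

/-! ### The Biot–Savart kernel of a heat mixture -/

theorem perp_zero_coord (z : Plane) : perp z 0 = -(z 1) := by simp [perp]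

theorem perp_one_coord (z : Plane) : perp z 1 = z 0 := by simp [perp]

theorem norm_sq_eq (z : Plane) : ‖z‖ ^ 2 = z 0 ^ 2 + z 1 ^ 2 := by
  simp [EuclideanSpace.norm_sq_eq, Fin.sum_univ_two]

theorem norm_perp (z : Plane) : ‖perp z‖ = ‖z‖ := by
  have h : ‖perp z‖ ^ 2 = ‖z‖ ^ 2 := by
    rw [norm_sq_eq, norm_sq_eq, perp_zero_coord, perp_one_coord]; ring
  exact (pow_left_inj₀ (norm_nonneg _) (norm_nonneg _) two_ne_zero).1 h

theorem abs_coord_le_norm (z : Plane) (i : Fin 2) : |z i| ≤ ‖z‖ := by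
  simpa using PiLp.norm_apply_le z i

theorem continuous_perp : Continuous perp := by
  unfold perp
  refine (PiLp.continuous_toLp 2 _).comp (continuous_pi fun i => ?_)
  fin_cases i <;> simp <;> fun_prop

/-- The radial factor `H(s)`, `s = |z|²`, of the Biot–Savart kernel of a heat mixture: the average
over the heat time `t` of the radial factor of `∇^⊥ Δ⁻¹` applied to the heat kernel at time `t`.
The division gives `H(0) = 0`; this value never matters. -/
noncomputable def radialKernel (μ : Measure ℝ) (s : ℝ) : ℝ :=
  ∫ t, (1 - Real.exp (-(s / (4 * t)))) / (2 * Real.pi * s) ∂μ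

/-- The convolution kernel of `∇^⊥ Δ⁻¹ T` for a heat mixture `T`. -/
noncomputable def biotSavart (μ : Measure ℝ) (z : Plane) : Plane :=
  radialKernel μ (‖z‖ ^ 2) • perp z

theorem radialIntegrand_mem {s t : ℝ} (hs : 0 ≤ s) (ht : 0 < t) :
    0 ≤ (1 - Real.exp (-(s / (4 * t)))) / (2 * Real.pi * s) ∧
      (1 - Real.exp (-(s / (4 * t)))) / (2 * Real.pi * s) ≤ 1 / (2 * Real.pi * s) := by
  have h1 : Real.exp (-(s / (4 * t))) ≤ 1 := Real.exp_le_one_iff.2 (by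
    have : 0 ≤ s / (4 * t) := by positivity
    linarith)
  have h2 := Real.exp_pos (-(s / (4 * t)))
  exact ⟨div_nonneg (by linarith) (by positivity), by gcongr; linarith⟩

variable {R : Regularization} {γ : ℝ} {μ : Measure ℝ}

theorem IsHeatMixture.integrable_radial (h : IsHeatMixture R γ μ) {s : ℝ} (hs : 0 ≤ s) :
    Integrable (fun t => (1 - Real.exp (-(s / (4 * t)))) / (2 * Real.pi * s)) μ := by
  have := h.prob
  refine (integrable_const (1 / (2 * Real.pi * s))).mono'
    (Measurable.aestronglyMeasurable (by fun_prop)) ?_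
  filter_upwards [h.pos] with t ht
  have := radialIntegrand_mem hs ht
  rw [Real.norm_eq_abs, abs_of_nonneg this.1]
  exact this.2

theorem IsHeatMixture.radialKernel_nonneg (h : IsHeatMixture R γ μ) {s : ℝ} (hs : 0 ≤ s) :
    0 ≤ radialKernel μ s := by
  refine integral_nonneg_of_ae ?_
  filter_upwards [h.pos] with t ht using (radialIntegrand_mem hs ht).1

theorem IsHeatMixture.radialKernel_le (h : IsHeatMixture R γ μ) {s : ℝ} (hs : 0 ≤ s) :
    radialKernel μ s ≤ 1 / (2 * Real.pi * s) := by
  have := h.prob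
  have := integral_mono_ae (h.integrable_radial hs) (integrable_const (1 / (2 * Real.pi * s))) (by
    filter_upwards [h.pos] with t ht using (radialIntegrand_mem hs ht).2)
  simpa [radialKernel] using this

theorem IsHeatMixture.norm_biotSavart_le (h : IsHeatMixture R γ μ) (z : Plane) :
    ‖biotSavart μ z‖ ≤ ‖z‖⁻¹ := by
  rw [biotSavart, norm_smul, norm_perp, Real.norm_eq_abs,
    abs_of_nonneg (h.radialKernel_nonneg (sq_nonneg _))]
  rcases eq_or_ne z 0 with rfl | hz
  · simp
  have hz : 0 < ‖z‖ := norm_pos_iff.2 hz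
  calc radialKernel μ (‖z‖ ^ 2) * ‖z‖ ≤ 1 / (2 * Real.pi * ‖z‖ ^ 2) * ‖z‖ := by
        gcongr; exact h.radialKernel_le (sq_nonneg _)
    _ = 1 / (2 * Real.pi) * ‖z‖⁻¹ := by field_simp
    _ ≤ 1 * ‖z‖⁻¹ := by
        gcongr
        rw [div_le_one (by positivity)]
        linarith [Real.pi_gt_three]
    _ = ‖z‖⁻¹ := one_mul _

theorem measurable_radialKernel [SFinite μ] : Measurable (radialKernel μ) := by
  have : StronglyMeasurable fun p : ℝ × ℝ =>
      (1 - Real.exp (-(p.1 / (4 * p.2)))) / (2 * Real.pi * p.1) :=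
    Measurable.stronglyMeasurable (by fun_prop)
  exact this.integral_prod_right'.measurable

theorem measurable_biotSavart [SFinite μ] : Measurable (biotSavart μ) := by
  have h1 := (measurable_radialKernel (μ := μ)).comp
    (measurable_norm.pow_const 2 : Measurable fun z : Plane => ‖z‖ ^ 2)
  exact h1.smul continuous_perp.measurable

/-- The quantitative monotonicity of the radial factor at a fixed heat time `t`. It is the Laplace
transform `s ↦ (2π)⁻¹ ∫₀^b e^{-sβ} dβ` with `b = 1 / (4t)`; only `β ≤ 1 / ρ²` is kept, where
`e^{-s₁β} - e^{-s₂β} ≥ (s₂ - s₁) β / 3`. When `b` is the smaller of the two, the loss `b²ρ⁴` is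
absorbed by `e^{-t/ρ²}`. -/
theorem radialIntegrand_sub_ge {s₁ s₂ ρ t : ℝ} (h1 : 0 < s₁) (h12 : s₁ ≤ s₂) (hρ : 0 < ρ)
    (h2 : s₂ ≤ ρ ^ 2) (ht : 0 < t) :
    (s₂ - s₁) / (384 * Real.pi * ρ ^ 4) * Real.exp (-(t * (1 / ρ) ^ 2)) ≤
      (1 - Real.exp (-(s₁ / (4 * t)))) / (2 * Real.pi * s₁) -
        (1 - Real.exp (-(s₂ / (4 * t)))) / (2 * Real.pi * s₂) := by
  have h2' : 0 < s₂ := h1.trans_le h12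
  set b : ℝ := 1 / (4 * t) with hb
  have hb0 : 0 < b := by positivity
  -- both radial factors as Laplace transforms of the indicator of `[0, b]`
  have hI : ∀ {s : ℝ}, 0 < s → ∀ c : ℝ, ∫ β in (0 : ℝ)..c, Real.exp (-(s * β)) =
      (1 - Real.exp (-(s * c))) / s := by
    intro s hs c
    have hd : ∀ β ∈ uIcc 0 c,
        HasDerivAt (fun β => -(Real.exp (-(s * β)) / s)) (Real.exp (-(s * β))) β := by
      intro β _
      have := (((hasDerivAt_id β).const_mul s).neg.exp.div_const s).neg
      refine this.congr_deriv ?_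
      simp only [Pi.neg_apply, id]
      field_simp
    rw [intervalIntegral.integral_eq_sub_of_hasDerivAt hd
      (Continuous.intervalIntegrable (by fun_prop) _ _)]
    simp
    ring
  have e1 : ∀ {s : ℝ}, 0 < s → (1 - Real.exp (-(s / (4 * t)))) / (2 * Real.pi * s) =
      1 / (2 * Real.pi) * ∫ β in (0 : ℝ)..b, Real.exp (-(s * β)) := by
    intro s hs
    rw [hI hs, hb]
    have : s * (1 / (4 * t)) = s / (4 * t) := by ring
    rw [this]
    field_simp
  rw [e1 h1, e1 h2', ← mul_sub, ← intervalIntegral.integral_sub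
    (Continuous.intervalIntegrable (by fun_prop) _ _)
    (Continuous.intervalIntegrable (by fun_prop) _ _)]
  set m : ℝ := min b (1 / ρ ^ 2) with hm
  have hm0 : 0 < m := lt_min hb0 (by positivity)
  have hmb : m ≤ b := min_le_left _ _
  have hmρ : m * ρ ^ 2 ≤ 1 := by
    have := min_le_right b (1 / ρ ^ 2)
    rwa [← hm, le_div_iff₀ (by positivity)] at this
  have hpos : ∀ β, 0 ≤ β → 0 ≤ Real.exp (-(s₁ * β)) - Real.exp (-(s₂ * β)) := by
    intro β hβ
    rw [sub_nonneg, Real.exp_le_exp]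
    nlinarith
  have hlow : (s₂ - s₁) * m ^ 2 / 6 ≤
      ∫ β in (0 : ℝ)..b, (Real.exp (-(s₁ * β)) - Real.exp (-(s₂ * β))) := by
    calc (s₂ - s₁) * m ^ 2 / 6 = ∫ β in (0 : ℝ)..m, (s₂ - s₁) / 3 * β := by
          rw [intervalIntegral.integral_const_mul, integral_id]; ring
      _ ≤ ∫ β in (0 : ℝ)..m, (Real.exp (-(s₁ * β)) - Real.exp (-(s₂ * β))) := by
          refine intervalIntegral.integral_mono_on hm0.le
            (Continuous.intervalIntegrable (by fun_prop) _ _)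
            (Continuous.intervalIntegrable (by fun_prop) _ _) fun β hβ => ?_
          have hs2β : s₂ * β ≤ 1 := by
            calc s₂ * β ≤ ρ ^ 2 * m := mul_le_mul h2 hβ.2 hβ.1 (by positivity)
              _ ≤ 1 := by linarith
          have e2 : Real.exp (-(s₁ * β)) =
              Real.exp (-(s₂ * β)) * Real.exp ((s₂ - s₁) * β) := by
            rw [← Real.exp_add]; ring_nf
          have e3 : 1 / 3 ≤ Real.exp (-(s₂ * β)) := by
            have h3 : Real.exp (-1) ≤ Real.exp (-(s₂ * β)) := Real.exp_le_exp.2 (by linarith)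
            have h4 : 1 / 3 ≤ Real.exp (-1) := by
              rw [Real.exp_neg, ← one_div]
              exact one_div_le_one_div_of_le (Real.exp_pos _)
                (by linarith [Real.exp_one_lt_d9])
            linarith
          have e4 := Real.add_one_le_exp ((s₂ - s₁) * β)
          have e5 : 0 ≤ (s₂ - s₁) * β := mul_nonneg (by linarith) hβ.1
          rw [e2]
          nlinarith
      _ ≤ _ := by
          rw [← intervalIntegral.integral_add_adjacent_intervals (b := m)
            (Continuous.intervalIntegrable (by fun_prop) _ _)
            (Continuous.intervalIntegrable (by fun_prop) _ _) (c := b)]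
          have : 0 ≤ ∫ β in m..b, (Real.exp (-(s₁ * β)) - Real.exp (-(s₂ * β))) :=
            intervalIntegral.integral_nonneg hmb fun β hβ => hpos β (hm0.le.trans hβ.1)
          linarith
  -- `x² / 2 ≤ eˣ` with `x = t / ρ²` handles the case `m = b`
  have hm2 : Real.exp (-(t * (1 / ρ) ^ 2)) / (32 * ρ ^ 4) ≤ m ^ 2 := by
    rcases le_total b (1 / ρ ^ 2) with hc | hc
    · rw [hm, min_eq_left hc]
      have hx : 0 < t * (1 / ρ) ^ 2 := by positivity
      have h3 := Real.quadratic_le_exp_of_nonneg hx.le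
      rw [Real.exp_neg, div_le_iff₀ (by positivity), inv_le_comm₀ (Real.exp_pos _) (by positivity)]
      calc (b ^ 2 * (32 * ρ ^ 4))⁻¹ = (t * (1 / ρ) ^ 2) ^ 2 / 2 := by
            rw [hb]; field_simp; norm_num
        _ ≤ _ := by linarith
    · rw [hm, min_eq_right hc]
      have : Real.exp (-(t * (1 / ρ) ^ 2)) ≤ 1 := Real.exp_le_one_iff.2 (by
        have : 0 < t * (1 / ρ) ^ 2 := by positivity
        linarith)
      rw [div_pow 1 (ρ ^ 2), one_pow, ← pow_mul]
      refine div_le_div₀ zero_le_one this (by positivity) ?_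
      have := pow_pos hρ 4
      norm_num
      linarith
  calc (s₂ - s₁) / (384 * Real.pi * ρ ^ 4) * Real.exp (-(t * (1 / ρ) ^ 2))
      = 1 / (2 * Real.pi) * ((s₂ - s₁) * (Real.exp (-(t * (1 / ρ) ^ 2)) / (32 * ρ ^ 4)) / 6) := by
        field_simp; ring
    _ ≤ 1 / (2 * Real.pi) * ((s₂ - s₁) * m ^ 2 / 6) := by
        have : 0 ≤ s₂ - s₁ := by linarith
        gcongr
    _ ≤ _ := by gcongr

/-- The decrease of the radial factor between two points of the ball of radius `ρ` is at least that
of the kernel of `∇^⊥ Δ⁻¹`, up to a constant, damped by the symbol at the frequency `1 / ρ`. -/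
theorem IsHeatMixture.radialKernel_sub (h : IsHeatMixture R γ μ) {s₁ s₂ ρ : ℝ} (h1 : 0 < s₁)
    (h12 : s₁ ≤ s₂) (hρ : 0 < ρ) (h2 : s₂ ≤ ρ ^ 2) :
    (s₂ - s₁) / (384 * Real.pi * ρ ^ 4) * R.symbol γ (1 / ρ) ≤
      radialKernel μ s₁ - radialKernel μ s₂ := by
  have := h.prob
  rw [← h.symbol_eq _ (by positivity), ← integral_const_mul, radialKernel, radialKernel,
    ← integral_sub (h.integrable_radial h1.le) (h.integrable_radial (h1.le.trans h12))]
  refine integral_mono_ae (Integrable.const_mul ?_ _)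
    ((h.integrable_radial h1.le).sub (h.integrable_radial (h1.le.trans h12))) ?_
  · refine (integrable_const (1 : ℝ)).mono' (by fun_prop) ?_
    filter_upwards [h.pos] with t ht
    rw [Real.norm_eq_abs, abs_of_pos (Real.exp_pos _)]
    exact Real.exp_le_one_iff.2 (by
      have : 0 < t * (1 / ρ) ^ 2 := by positivity
      linarith)
  · filter_upwards [h.pos] with t ht using radialIntegrand_sub_ge h1 h12 hρ h2 ht

theorem IsHeatMixture.radialKernel_antitone (h : IsHeatMixture R γ μ) {s₁ s₂ : ℝ} (h1 : 0 < s₁)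
    (h12 : s₁ ≤ s₂) : radialKernel μ s₂ ≤ radialKernel μ s₁ := by
  have h2 : 0 < s₂ := h1.trans_le h12
  have := h.radialKernel_sub h1 h12 (ρ := √s₂) (by positivity) (Real.sq_sqrt h2.le).ge
  have h3 : 0 ≤ (s₂ - s₁) / (384 * Real.pi * √s₂ ^ 4) * R.symbol γ (1 / √s₂) :=
    mul_nonneg (div_nonneg (by linarith) (by positivity)) (symbol_nonneg R γ (by positivity))
  linarith

/-- A lower bound for both symbols by the logarithm in the weighted integral. The factor `2 ^ (-γ)`
covers the Laplacian, through `ln(e + k²) ≤ 2 ln(e + k)`. -/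
theorem symbol_one_div_ge (R : Regularization) {γ r ρ : ℝ} (hγ : 0 < γ) (hr : 0 < r)
    (hrρ : r ≤ ρ) :
    (2 : ℝ) ^ (-γ) * Real.log (Real.exp 1 + 1 / r) ^ (-γ) ≤ R.symbol γ (1 / ρ) := by
  have hρ : 0 < ρ := hr.trans_le hrρ
  have he : 1 < Real.exp 1 := by simp
  have hl : 0 < Real.log (Real.exp 1 + 1 / ρ) := Real.log_pos (by
    have : 0 < 1 / ρ := by positivity
    linarith)
  have hle : Real.log (Real.exp 1 + 1 / ρ) ≤ Real.log (Real.exp 1 + 1 / r) :=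
    Real.log_le_log (by positivity) (by gcongr)
  have key : ∀ x : ℝ, 0 < x → x ≤ 2 * Real.log (Real.exp 1 + 1 / ρ) →
      (2 : ℝ) ^ (-γ) * Real.log (Real.exp 1 + 1 / r) ^ (-γ) ≤ x ^ (-γ) := by
    intro x hx hx2
    rw [← Real.mul_rpow (by norm_num) (hl.le.trans hle)]
    exact Real.rpow_le_rpow_of_nonpos hx (by linarith) (by linarith)
  cases R
  · refine key _ (Real.log_pos (by nlinarith [sq_nonneg (1 / ρ)])) ?_
    have : 2 * Real.log (Real.exp 1 + 1 / ρ) = Real.log ((Real.exp 1 + 1 / ρ) ^ 2) := by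
      rw [Real.log_pow]; norm_num
    rw [this]
    refine Real.log_le_log (by positivity) ?_
    have : 0 < 1 / ρ := by positivity
    nlinarith
  · exact key _ hl (by linarith)

end

section

variable {R : Regularization} {γ : ℝ} {μ : Measure ℝ}

/-! ### Potentials with kernel `1 / |z|` -/

theorem integrableOn_inv_norm_ball (r : ℝ) :
    IntegrableOn (fun z : Plane => ‖z‖⁻¹) (Metric.ball 0 r) := by
  rw [integrableOn_fun_norm_addHaar volume (f := fun r => r⁻¹)]
  have : IntegrableOn (fun _ : ℝ => (1 : ℝ)) (Ioo 0 r) := integrableOn_const (by simp)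
  refine this.congr_fun (fun y hy => ?_) measurableSet_Ioo
  have : y ≠ 0 := hy.1.ne'
  simp [this]

theorem integrable_inv_norm_mul_exp {s : ℝ} (hs : 0 < s) :
    Integrable (fun z : Plane => ‖z‖⁻¹ * Real.exp (-(s * ‖z‖ ^ 2))) := by
  rw [integrable_fun_norm_addHaar volume (f := fun r => r⁻¹ * Real.exp (-(s * r ^ 2)))]
  have := (integrable_exp_neg_mul_sq hs).integrableOn (s := Ioi (0 : ℝ))
  refine this.congr_fun (fun y hy => ?_) measurableSet_Ioi
  have : y ≠ 0 := ne_of_gt hy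
  simp [this]

/-- The mass of the kernel `1 / |z|` in the unit disc. -/
noncomputable def singularMass : ℝ := ∫ z in Metric.ball (0 : Plane) 1, ‖z‖⁻¹

theorem singularMass_nonneg : 0 ≤ singularMass :=
  integral_nonneg fun _ => by positivity

theorem integrable_singular (x : Plane) :
    Integrable (fun y : Plane => (Metric.ball (0 : Plane) 1).indicator (fun z => ‖z‖⁻¹) (x - y)) ∧
    ∫ y : Plane, (Metric.ball (0 : Plane) 1).indicator (fun z => ‖z‖⁻¹) (x - y) = singularMass := by
  have h := (integrableOn_inv_norm_ball 1).integrable_indicator measurableSet_ball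
  refine ⟨h.comp_sub_left x, ?_⟩
  rw [integral_sub_left_eq_self (fun z => (Metric.ball (0 : Plane) 1).indicator
    (fun z => ‖z‖⁻¹) z) volume x, integral_indicator measurableSet_ball, singularMass]

theorem singular_bound {E : Type*} [NormedAddCommGroup E] {f : Plane → E} {M : ℝ}
    (hM : ∀ y, ‖f y‖ ≤ M) (x y : Plane) :
    ‖x - y‖⁻¹ * ‖f y‖ ≤
      M * (Metric.ball (0 : Plane) 1).indicator (fun z => ‖z‖⁻¹) (x - y) + ‖f y‖ := by
  by_cases h : x - y ∈ Metric.ball (0 : Plane) 1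
  · rw [indicator_of_mem h]
    have := mul_le_mul_of_nonneg_left (hM y) (inv_nonneg.2 (norm_nonneg (x - y)))
    linarith [norm_nonneg (f y)]
  · rw [indicator_of_notMem h, mul_zero, zero_add]
    rw [mem_ball_zero_iff, not_lt] at h
    exact mul_le_of_le_one_left (norm_nonneg _) (inv_le_one_of_one_le₀ h)

theorem integrable_inv_norm_sub_mul {E : Type*} [NormedAddCommGroup E] {f : Plane → E} {M : ℝ}
    (hf : Integrable f) (hM : ∀ y, ‖f y‖ ≤ M) (x : Plane) :
    Integrable fun y => ‖x - y‖⁻¹ * ‖f y‖ := by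
  refine (((integrable_singular x).1.const_mul M).add hf.norm).mono'
    ((Measurable.aestronglyMeasurable (by fun_prop)).mul hf.1.norm) (ae_of_all _ fun y => ?_)
  rw [Real.norm_eq_abs, abs_of_nonneg (by positivity)]
  exact singular_bound hM x y

theorem integral_inv_norm_sub_mul_le {E : Type*} [NormedAddCommGroup E] {f : Plane → E} {M : ℝ}
    (hf : Integrable f) (hM : ∀ y, ‖f y‖ ≤ M) (x : Plane) :
    ∫ y, ‖x - y‖⁻¹ * ‖f y‖ ≤ M * singularMass + ∫ y, ‖f y‖ := by
  rw [← (integrable_singular x).2, ← integral_const_mul, ← integral_add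
    ((integrable_singular x).1.const_mul M) hf.norm]
  exact integral_mono (integrable_inv_norm_sub_mul hf hM x)
    (((integrable_singular x).1.const_mul M).add hf.norm) (singular_bound hM x)

/-! ### The Biot–Savart law on the Fourier side -/

theorem integrable_exp_neg_sq {τ : ℝ} (hτ : 0 < τ) :
    Integrable (fun ξ : Plane => Real.exp (-(τ * ‖ξ‖ ^ 2))) := by
  rw [integrable_fun_norm_addHaar volume (f := fun r => Real.exp (-(τ * r ^ 2)))]
  have := (integrable_mul_exp_neg_mul_sq hτ).integrableOn (s := Ioi (0 : ℝ))
  refine this.congr_fun (fun y hy => ?_) measurableSet_Ioi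
  simp

theorem integrable_norm_mul_exp_neg_sq {τ : ℝ} (hτ : 0 < τ) :
    Integrable (fun ξ : Plane => ‖ξ‖ * Real.exp (-(τ * ‖ξ‖ ^ 2))) := by
  rw [integrable_fun_norm_addHaar volume (f := fun r => r * Real.exp (-(τ * r ^ 2)))]
  have := (integrable_rpow_mul_exp_neg_mul_sq hτ (s := 2) (by norm_num)).integrableOn
    (s := Ioi (0 : ℝ))
  refine this.congr_fun (fun y hy => ?_) measurableSet_Ioi
  simp
  ring

theorem norm_two_pi_smul (ξ : Plane) : ‖(2 * Real.pi) • ξ‖ = 2 * Real.pi * ‖ξ‖ := by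
  rw [norm_smul, Real.norm_eq_abs, abs_of_pos (by positivity)]

/-- The inverse Fourier transform of `-i ⟨k, v⟩ e^{-τ|k|²}`, `k = 2πξ`: minus the derivative in the
direction `v` of the heat kernel at time `τ`. -/
theorem integral_inner_mul_gaussian {τ : ℝ} (hτ : 0 < τ) (z v : Plane) :
    ∫ ξ : Plane, Complex.exp ((2 * Real.pi * ⟪ξ, z⟫ : ℝ) * Complex.I) *
        (-Complex.I * ((⟪(2 * Real.pi) • ξ, v⟫ *
          Real.exp (-(τ * ‖(2 * Real.pi) • ξ‖ ^ 2)) : ℝ) : ℂ)) =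
      ((⟪z, v⟫ / (8 * Real.pi * τ ^ 2) * Real.exp (-(‖z‖ ^ 2 / (4 * τ))) : ℝ) : ℂ) := by
  set b : ℝ := τ * (2 * Real.pi) ^ 2 with hb
  have hb0 : 0 < b := by positivity
  have e0 : ∀ ξ : Plane, τ * ‖(2 * Real.pi) • ξ‖ ^ 2 = b * ‖ξ‖ ^ 2 := by
    intro ξ; rw [norm_two_pi_smul, hb]; ring
  set f : Plane → ℂ := fun ξ => Complex.exp (-(b : ℂ) * ‖ξ‖ ^ 2) with hf
  have hfr : ∀ ξ, f ξ = (Real.exp (-(b * ‖ξ‖ ^ 2)) : ℝ) := by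
    intro ξ; simp [hf]
  have hnorm : ∀ ξ, ‖f ξ‖ = Real.exp (-(b * ‖ξ‖ ^ 2)) := by
    intro ξ; rw [hfr, Complex.norm_real, Real.norm_eq_abs, abs_of_pos (Real.exp_pos _)]
  have hint : Integrable f := by
    have := (integrable_exp_neg_sq hb0).ofReal (𝕜 := ℂ)
    exact this.congr (ae_of_all _ fun ξ => (hfr ξ).symm)
  have hint2 : Integrable (fun ξ => ‖ξ‖ * ‖f ξ‖) := by
    simpa only [hnorm] using integrable_norm_mul_exp_neg_sq hb0
  have hder := Real.hasFDerivAt_fourier hint hint2 (-z)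
  have hF : 𝓕 f = fun w : Plane =>
      ((Real.pi / b * Real.exp (-(Real.pi ^ 2 * ‖w‖ ^ 2 / b)) : ℝ) : ℂ) := by
    ext w
    rw [hf, fourier_gaussian_innerProductSpace (by simpa using hb0)]
    simp
    left
    ring_nf
  have hline : HasDerivAt (fun s : ℝ => -z + s • v) v 0 := by
    simpa using ((hasDerivAt_id (0 : ℝ)).smul_const v).const_add (-z)
  have h1 := hder.comp_hasDerivAt_of_eq (0 : ℝ) hline (by simp)
  have h2 : HasDerivAt (𝓕 f ∘ fun s : ℝ => -z + s • v)
      ((⟪z, v⟫ / (8 * Real.pi * τ ^ 2) * Real.exp (-(‖z‖ ^ 2 / (4 * τ))) : ℝ) : ℂ) 0 := by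
    have e1 : (𝓕 f ∘ fun s : ℝ => -z + s • v) = fun s : ℝ => ((Real.pi / b * Real.exp
        (-(Real.pi ^ 2 * (‖z‖ ^ 2 - 2 * s * ⟪z, v⟫ + s ^ 2 * ‖v‖ ^ 2) / b)) : ℝ) : ℂ) := by
      ext s
      rw [hF]
      simp only [Function.comp_apply]
      have : ‖-z + s • v‖ ^ 2 = ‖z‖ ^ 2 - 2 * s * ⟪z, v⟫ + s ^ 2 * ‖v‖ ^ 2 := by
        rw [norm_add_sq_real, norm_neg, inner_neg_left, inner_smul_right, norm_smul, mul_pow,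
          Real.norm_eq_abs, sq_abs]
        ring
      rw [this]
    rw [e1]
    refine HasDerivAt.ofReal_comp ?_
    have h3 : HasDerivAt (fun s : ℝ => -(Real.pi ^ 2 * (‖z‖ ^ 2 - 2 * s * ⟪z, v⟫
        + s ^ 2 * ‖v‖ ^ 2) / b)) (-(Real.pi ^ 2 * (-(2 * ⟪z, v⟫)) / b)) 0 := by
      have h4 := (((((hasDerivAt_id (0 : ℝ)).const_mul 2).mul_const ⟪z, v⟫).const_sub
        (‖z‖ ^ 2)).add (((hasDerivAt_id (0 : ℝ)).pow 2).mul_const (‖v‖ ^ 2)))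
      have h5 := ((h4.const_mul (Real.pi ^ 2)).div_const b).neg
      refine h5.congr_deriv ?_
      simp
    refine (h3.exp.const_mul (Real.pi / b)).congr_deriv ?_
    have e2 : Real.pi ^ 2 * ‖z‖ ^ 2 / b = ‖z‖ ^ 2 / (4 * τ) := by
      rw [hb]; field_simp; ring
    simp only [mul_zero, zero_mul, sub_zero, ne_eq, OfNat.ofNat_ne_zero, not_false_eq_true,
      zero_pow, add_zero, e2]
    rw [hb]
    field_simp
    ring
  have h3 := h1.unique h2
  rw [← h3, Real.fourier_eq', ContinuousLinearMap.integral_apply]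
  · refine integral_congr_ae (ae_of_all _ fun ξ => ?_)
    simp only [e0, smul_apply, VectorFourier.fourierSMulRight_apply, hfr, inner_neg_right,
      inner_smul_left]
    have : (innerSL ℝ ξ) v = ⟪ξ, v⟫ := rfl
    simp [this]
    ring
  · refine (hint2.const_mul (2 * Real.pi * ‖innerSL ℝ (E := Plane)‖)).mono' ?_
      (ae_of_all _ fun ξ => ?_)
    · refine (Continuous.aestronglyMeasurable (f := fun ξ : Plane =>
        Complex.exp (((-2 * Real.pi * ⟪ξ, -z⟫ : ℝ) : ℂ) * Complex.I)) (by fun_prop)).smul ?_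
      exact hint.1.fourierSMulRight
    · rw [norm_smul, Complex.norm_exp_ofReal_mul_I, one_mul]
      exact (VectorFourier.norm_fourierSMulRight_le _ _ _).trans (by rw [mul_assoc])

theorem integral_exp_neg_mul_Ioi {a : ℝ} (ha : 0 < a) (s : ℝ) :
    IntegrableOn (fun τ => Real.exp (-(τ * a))) (Ioi s) ∧
      ∫ τ in Ioi s, Real.exp (-(τ * a)) = Real.exp (-(s * a)) / a := by
  have h1 := integrableOn_exp_mul_Ioi (neg_neg_of_pos ha) s
  have h2 := integral_exp_mul_Ioi (neg_neg_of_pos ha) s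
  have e : ∀ τ, -a * τ = -(τ * a) := fun τ => by ring
  simp only [e] at h1 h2
  refine ⟨h1, h2.trans ?_⟩
  rw [neg_div_neg_eq]

/-- Integrating the heat kernel over times `τ > s` produces the radial factor of the Biot–Savart
kernel of a Gaussian. -/
theorem integral_biotSavart_gaussian_Ioi {s : ℝ} (hs : 0 < s) {q : ℝ} (hq : 0 < q) :
    ∫ τ in Ioi s, 1 / (8 * Real.pi * τ ^ 2) * Real.exp (-(q / (4 * τ))) =
      (1 - Real.exp (-(q / (4 * s)))) / (2 * Real.pi * q) := by
  have hd : ∀ τ ∈ Ici s, HasDerivAt (fun τ => Real.exp (-(q / (4 * τ))) / (2 * Real.pi * q))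
      (1 / (8 * Real.pi * τ ^ 2) * Real.exp (-(q / (4 * τ)))) τ := by
    intro τ hτ
    have hτ : τ ≠ 0 := (hs.trans_le hτ).ne'
    have h1 : HasDerivAt (fun τ : ℝ => -(q / (4 * τ))) (q / (4 * τ ^ 2)) τ := by
      have := ((hasDerivAt_inv hτ).const_mul (-(q / 4)))
      refine (this.congr_deriv ?_).congr_of_eventuallyEq (Eventually.of_forall fun x => ?_)
      · field_simp
      · simp only; field_simp
    refine (h1.exp.div_const _).congr_deriv ?_
    field_simp
    norm_num
  have ht : Tendsto (fun τ => Real.exp (-(q / (4 * τ))) / (2 * Real.pi * q)) atTop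
      (𝓝 (Real.exp (-0) / (2 * Real.pi * q))) := by
    refine ((Real.continuous_exp.tendsto _).comp (Tendsto.neg ?_)).div_const _
    exact tendsto_const_nhds.div_atTop (tendsto_id.const_mul_atTop (by norm_num))
  rw [integral_Ioi_of_hasDerivAt_of_nonneg' hd (fun τ hτ => by
    have : 0 < τ := hs.trans hτ
    positivity) ht]
  simp
  ring

theorem norm_inner_div_le (k v : Plane) : |⟪k, v⟫ / ‖k‖ ^ 2| ≤ ‖v‖ * ‖k‖⁻¹ := by
  rcases eq_or_ne k 0 with rfl | hk
  · simp
  have hk : 0 < ‖k‖ := norm_pos_iff.2 hk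
  rw [abs_div, abs_of_pos (pow_pos hk 2), div_le_iff₀ (pow_pos hk 2)]
  calc |⟪k, v⟫| ≤ ‖k‖ * ‖v‖ := abs_real_inner_le_norm k v
    _ = ‖v‖ * ‖k‖⁻¹ * ‖k‖ ^ 2 := by field_simp

theorem integrable_inner_div_mul_exp {s : ℝ} (hs : 0 < s) (v : Plane) :
    Integrable fun ξ : Plane => ⟪(2 * Real.pi) • ξ, v⟫ / ‖(2 * Real.pi) • ξ‖ ^ 2 *
      Real.exp (-(s * ‖(2 * Real.pi) • ξ‖ ^ 2)) := by
  have h := ((integrable_inv_norm_mul_exp hs).comp_smul (R := 2 * Real.pi)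
    (by positivity)).const_mul ‖v‖
  refine h.mono' (Measurable.aestronglyMeasurable (by fun_prop)) (ae_of_all _ fun ξ => ?_)
  rw [norm_mul, Real.norm_eq_abs, Real.norm_eq_abs, abs_of_pos (Real.exp_pos _), ← mul_assoc]
  gcongr
  exact norm_inner_div_le _ _

/-- The Biot–Savart law for a Gaussian vorticity, from
`|k|⁻² e^{-s|k|²} = ∫ e^{-τ|k|²} dτ` over `τ > s`. -/
theorem integral_biotSavart_gaussian {s : ℝ} (hs : 0 < s) (z v : Plane) :
    ∫ ξ : Plane, Complex.exp ((2 * Real.pi * ⟪ξ, z⟫ : ℝ) * Complex.I) *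
        (-Complex.I * ((⟪(2 * Real.pi) • ξ, v⟫ / ‖(2 * Real.pi) • ξ‖ ^ 2 *
          Real.exp (-(s * ‖(2 * Real.pi) • ξ‖ ^ 2)) : ℝ) : ℂ)) =
      ((⟪z, v⟫ * ((1 - Real.exp (-(‖z‖ ^ 2 / (4 * s)))) / (2 * Real.pi * ‖z‖ ^ 2)) : ℝ) : ℂ) := by
  let F : Plane → ℝ → ℂ := fun ξ τ => Complex.exp ((2 * Real.pi * ⟪ξ, z⟫ : ℝ) * Complex.I) *
        (-Complex.I * ((⟪(2 * Real.pi) • ξ, v⟫ *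
          Real.exp (-(τ * ‖(2 * Real.pi) • ξ‖ ^ 2)) : ℝ) : ℂ))
  have hFm : Measurable (Function.uncurry F) := by
    have : Continuous (Function.uncurry F) := by
      simp only [F, Function.uncurry_def]; fun_prop
    exact this.measurable
  have hreal : ∀ ξ : Plane, IntegrableOn (fun τ => ⟪(2 * Real.pi) • ξ, v⟫ *
      Real.exp (-(τ * ‖(2 * Real.pi) • ξ‖ ^ 2))) (Ioi s) ∧
      ∫ τ in Ioi s, ⟪(2 * Real.pi) • ξ, v⟫ * Real.exp (-(τ * ‖(2 * Real.pi) • ξ‖ ^ 2)) =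
        ⟪(2 * Real.pi) • ξ, v⟫ / ‖(2 * Real.pi) • ξ‖ ^ 2 *
          Real.exp (-(s * ‖(2 * Real.pi) • ξ‖ ^ 2)) := by
    intro ξ
    rcases eq_or_ne ((2 * Real.pi) • ξ) 0 with hk | hk
    · rw [hk]; simp
    have hk : 0 < ‖(2 * Real.pi) • ξ‖ := norm_pos_iff.2 hk
    obtain ⟨h1, h2⟩ := integral_exp_neg_mul_Ioi (pow_pos hk 2) s
    refine ⟨h1.const_mul _, ?_⟩
    rw [integral_const_mul, h2]
    ring
  have hFnorm : ∀ ξ τ, ‖F ξ τ‖ = ‖⟪(2 * Real.pi) • ξ, v⟫ *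
      Real.exp (-(τ * ‖(2 * Real.pi) • ξ‖ ^ 2))‖ := by
    intro ξ τ
    simp only [F]
    rw [norm_mul, Complex.norm_exp_ofReal_mul_I, one_mul, norm_mul, norm_neg, Complex.norm_I,
      one_mul, Complex.norm_real]
  have hFint : Integrable (Function.uncurry F) (volume.prod (volume.restrict (Ioi s))) := by
    rw [integrable_prod_iff hFm.aestronglyMeasurable]
    refine ⟨ae_of_all _ fun ξ => ?_, ?_⟩
    · refine (hreal ξ).1.norm.mono' ?_ (ae_of_all _ fun τ => (hFnorm ξ τ).le)
      exact (hFm.comp measurable_prodMk_left).aestronglyMeasurable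
    · refine (integrable_inner_div_mul_exp hs v).norm.congr (ae_of_all _ fun ξ => ?_)
      simp only [Function.uncurry, hFnorm]
      rw [← (hreal ξ).2]
      simp only [norm_mul, Real.norm_eq_abs, Real.abs_exp]
      rw [integral_const_mul, integral_const_mul, abs_mul]
      rw [abs_of_nonneg (integral_nonneg fun τ => (Real.exp_pos _).le)]
  have hL : ∀ ξ : Plane, Complex.exp ((2 * Real.pi * ⟪ξ, z⟫ : ℝ) * Complex.I) *
        (-Complex.I * ((⟪(2 * Real.pi) • ξ, v⟫ / ‖(2 * Real.pi) • ξ‖ ^ 2 *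
          Real.exp (-(s * ‖(2 * Real.pi) • ξ‖ ^ 2)) : ℝ) : ℂ)) = ∫ τ in Ioi s, F ξ τ := by
    intro ξ
    rw [← (hreal ξ).2]
    simp only [F]
    rw [← integral_complex_ofReal, ← integral_const_mul, ← integral_const_mul]
  simp_rw [hL]
  rw [integral_integral_swap hFint]
  have hR : ∀ τ ∈ Ioi s, ∫ ξ, F ξ τ = ((⟪z, v⟫ / (8 * Real.pi * τ ^ 2) *
      Real.exp (-(‖z‖ ^ 2 / (4 * τ))) : ℝ) : ℂ) := fun τ hτ =>
    integral_inner_mul_gaussian (hs.trans hτ) z v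
  rw [setIntegral_congr_fun measurableSet_Ioi hR, integral_complex_ofReal]
  congr 1
  rcases eq_or_ne z 0 with rfl | hz
  · simp
  rw [← integral_biotSavart_gaussian_Ioi hs (pow_pos (norm_pos_iff.2 hz) 2), ← integral_const_mul]
  refine integral_congr_ae (ae_of_all _ fun τ => ?_)
  simp only
  ring

end

section

variable {R : Regularization} {γ : ℝ} {μ : Measure ℝ}

/-! ### The velocity as a convolution -/

theorem exists_perp_eq_inner (j : Fin 2) : ∃ v : Plane, ∀ k : Plane, perp k j = ⟪k, v⟫ := by
  fin_cases j
  · refine ⟨!₂[0, -1], fun k => ?_⟩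
    simp [perp, PiLp.inner_apply, Fin.sum_univ_two]
  · refine ⟨!₂[1, 0], fun k => ?_⟩
    simp [perp, PiLp.inner_apply, Fin.sum_univ_two]

/-- The Biot–Savart law after an extra heat flow of time `ε`, which makes every integral absolutely
convergent, so that Fubini's theorem applies. -/
theorem IsHeatMixture.integral_exp_mul_velocityHat (h : IsHeatMixture R γ μ) {w : Plane → ℝ}
    (hw : Integrable w) (j : Fin 2) {v : Plane} (hv : ∀ k : Plane, perp k j = ⟪k, v⟫)
    {ε : ℝ} (hε : 0 < ε) (x : Plane) :
    ∫ ξ : Plane, (Real.exp (-(ε * ‖(2 * Real.pi) • ξ‖ ^ 2)) : ℂ) *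
        (Complex.exp ((2 * Real.pi * ⟪ξ, x⟫ : ℝ) * Complex.I) * velocityHat R γ w j ξ) =
      ∫ p : Plane × ℝ, ((⟪x - p.1, v⟫ * ((1 - Real.exp (-(‖x - p.1‖ ^ 2 / (4 * (p.2 + ε))))) /
        (2 * Real.pi * ‖x - p.1‖ ^ 2)) * w p.1 : ℝ) : ℂ) ∂(volume.prod μ) := by
  have := h.prob
  let F : Plane → Plane × ℝ → ℂ := fun ξ p =>
    Complex.exp ((2 * Real.pi * ⟪ξ, x - p.1⟫ : ℝ) * Complex.I) *
      (-Complex.I * ((⟪(2 * Real.pi) • ξ, v⟫ / ‖(2 * Real.pi) • ξ‖ ^ 2 *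
        Real.exp (-((p.2 + ε) * ‖(2 * Real.pi) • ξ‖ ^ 2)) : ℝ) : ℂ)) * (w p.1 : ℂ)
  have hpos : ∀ᵐ p ∂((volume : Measure Plane).prod μ), 0 < p.2 :=
    (Measure.quasiMeasurePreserving_snd (μ := (volume : Measure Plane)) (ν := μ)).ae h.pos
  have hpos2 : ∀ᵐ q ∂((volume : Measure Plane).prod ((volume : Measure Plane).prod μ)),
      0 < q.2.2 :=
    (Measure.quasiMeasurePreserving_snd (μ := (volume : Measure Plane))
      (ν := (volume : Measure Plane).prod μ)).ae hpos
  have hFint : Integrable (Function.uncurry F) (volume.prod (volume.prod μ)) := by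
    have hb := (integrable_inner_div_mul_exp hε v).norm.mul_prod
      (hw.norm.mul_prod (integrable_const (1 : ℝ)) (μ := volume) (ν := μ))
    refine hb.mono' ?_ ?_
    · have h1 : AEStronglyMeasurable (fun q : Plane × Plane × ℝ => (w q.2.1 : ℂ))
          (volume.prod (volume.prod μ)) := by
        have h2 : AEStronglyMeasurable (fun p : Plane × ℝ => (w p.1 : ℂ)) (volume.prod μ) :=
          (Complex.continuous_ofReal.comp_aestronglyMeasurable hw.1).comp_fst
        exact h2.comp_snd
      exact (Measurable.aestronglyMeasurable (by fun_prop)).mul h1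
    · filter_upwards [hpos2] with q hq
      simp only [F, Function.uncurry]
      rw [norm_mul, norm_mul, Complex.norm_exp_ofReal_mul_I, one_mul, norm_mul, norm_neg,
        Complex.norm_I, one_mul, Complex.norm_real, Complex.norm_real, norm_mul, norm_mul, mul_one,
        Real.norm_of_nonneg (Real.exp_pos _).le, Real.norm_of_nonneg (Real.exp_pos _).le]
      gcongr
      linarith
  have hL : ∀ ξ : Plane, (Real.exp (-(ε * ‖(2 * Real.pi) • ξ‖ ^ 2)) : ℂ) *
      (Complex.exp ((2 * Real.pi * ⟪ξ, x⟫ : ℝ) * Complex.I) * velocityHat R γ w j ξ) =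
        ∫ p, F ξ p ∂(volume.prod μ) := by
    intro ξ
    have e1 : ∀ p : Plane × ℝ, F ξ p =
        (Real.exp (-(ε * ‖(2 * Real.pi) • ξ‖ ^ 2)) : ℂ) *
        (Complex.exp ((2 * Real.pi * ⟪ξ, x⟫ : ℝ) * Complex.I) *
          (-Complex.I * ((⟪(2 * Real.pi) • ξ, v⟫ / ‖(2 * Real.pi) • ξ‖ ^ 2 : ℝ) : ℂ))) *
        ((Complex.exp (((-2 * Real.pi * ⟪p.1, ξ⟫ : ℝ) : ℂ) * Complex.I) • (w p.1 : ℂ)) *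
          ((Real.exp (-(p.2 * ‖(2 * Real.pi) • ξ‖ ^ 2)) : ℝ) : ℂ)) := by
      intro p
      have e2 : Complex.exp ((2 * Real.pi * ⟪ξ, x - p.1⟫ : ℝ) * Complex.I) =
          Complex.exp ((2 * Real.pi * ⟪ξ, x⟫ : ℝ) * Complex.I) *
          Complex.exp (((-2 * Real.pi * ⟪p.1, ξ⟫ : ℝ) : ℂ) * Complex.I) := by
        rw [← Complex.exp_add, inner_sub_right, real_inner_comm p.1 ξ]
        congr 1
        push_cast
        ring
      have e3 : Real.exp (-((p.2 + ε) * ‖(2 * Real.pi) • ξ‖ ^ 2)) =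
          Real.exp (-(ε * ‖(2 * Real.pi) • ξ‖ ^ 2)) *
          Real.exp (-(p.2 * ‖(2 * Real.pi) • ξ‖ ^ 2)) := by
        rw [← Real.exp_add]; ring_nf
      simp only [F]
      rw [e2, e3, Complex.ofReal_mul (⟪(2 * Real.pi) • ξ, v⟫ / ‖(2 * Real.pi) • ξ‖ ^ 2),
        Complex.ofReal_mul (Real.exp _), smul_eq_mul]
      ring
    simp_rw [e1]
    rw [integral_const_mul, integral_prod_mul
      (fun y : Plane => Complex.exp (((-2 * Real.pi * ⟪y, ξ⟫ : ℝ) : ℂ) * Complex.I) • (w y : ℂ))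
      (fun t : ℝ => ((Real.exp (-(t * ‖(2 * Real.pi) • ξ‖ ^ 2)) : ℝ) : ℂ)),
      integral_complex_ofReal,
      h.symbol_eq _ (norm_nonneg _), velocityHat, velocitySymbol, hv, Real.fourier_eq',
      Complex.ofReal_mul (⟪(2 * Real.pi) • ξ, v⟫ / ‖(2 * Real.pi) • ξ‖ ^ 2)]
    ring
  simp_rw [hL]
  rw [integral_integral_swap hFint]
  refine integral_congr_ae ?_
  filter_upwards [hpos] with p hp
  simp only [F]
  rw [integral_mul_const, integral_biotSavart_gaussian (by linarith), ← Complex.ofReal_mul]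

/-- The Biot–Savart law: the Fourier multiplier `∇^⊥ Δ⁻¹ T_γ` is convolution with
`biotSavart μ`. -/
theorem IsHeatMixture.fourierInv_velocityHat (h : IsHeatMixture R γ μ) {w : Plane → ℝ}
    (hw : Integrable w) {M : ℝ} (hM : ∀ y, |w y| ≤ M) (j : Fin 2)
    (hv : Integrable (velocityHat R γ w j)) (x : Plane) :
    𝓕⁻ (velocityHat R γ w j) x = ((∫ y, w y * biotSavart μ (x - y) j : ℝ) : ℂ) := by
  have := h.prob
  obtain ⟨v, hv'⟩ := exists_perp_eq_inner j
  have hpos : ∀ᵐ p ∂((volume : Measure Plane).prod μ), 0 < p.2 :=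
    (Measure.quasiMeasurePreserving_snd (μ := (volume : Measure Plane)) (ν := μ)).ae h.pos
  let ε : ℕ → ℝ := fun n => 1 / ((n : ℝ) + 1)
  have hε : ∀ n, 0 < ε n := fun n => by positivity
  have hε0 : Tendsto ε atTop (𝓝 0) := tendsto_one_div_add_atTop_nhds_zero_nat
  -- the regularized Fourier integrals converge to the velocity
  have hlim1 : Tendsto (fun n => ∫ ξ : Plane,
      (Real.exp (-(ε n * ‖(2 * Real.pi) • ξ‖ ^ 2)) : ℂ) *
        (Complex.exp ((2 * Real.pi * ⟪ξ, x⟫ : ℝ) * Complex.I) * velocityHat R γ w j ξ)) atTop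
      (𝓝 (𝓕⁻ (velocityHat R γ w j) x)) := by
    rw [Real.fourierInv_eq']
    refine tendsto_integral_of_dominated_convergence (fun ξ => ‖velocityHat R γ w j ξ‖)
      (fun n => ?_) hv.norm (fun n => ae_of_all _ fun ξ => ?_) (ae_of_all _ fun ξ => ?_)
    · exact (Continuous.aestronglyMeasurable (by fun_prop)).mul
        ((Continuous.aestronglyMeasurable (by fun_prop)).mul hv.1)
    · rw [norm_mul, norm_mul, Complex.norm_exp_ofReal_mul_I, one_mul, Complex.norm_real,
        Real.norm_of_nonneg (Real.exp_pos _).le]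
      refine mul_le_of_le_one_left (norm_nonneg _) (Real.exp_le_one_iff.2 ?_)
      have := (hε n).le
      have : 0 ≤ ε n * ‖(2 * Real.pi) • ξ‖ ^ 2 := by positivity
      linarith
    · have h1 : Tendsto (fun n => (Real.exp (-(ε n * ‖(2 * Real.pi) • ξ‖ ^ 2)) : ℂ)) atTop
          (𝓝 ((Real.exp (-(0 * ‖(2 * Real.pi) • ξ‖ ^ 2)) : ℝ) : ℂ)) :=
        (Complex.continuous_ofReal.tendsto _).comp
          ((Real.continuous_exp.tendsto _).comp (hε0.mul_const _).neg)
      simpa using h1.mul_const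
        (Complex.exp ((2 * Real.pi * ⟪ξ, x⟫ : ℝ) * Complex.I) * velocityHat R γ w j ξ)
  -- and so do the regularized convolutions
  let G : ℝ → Plane × ℝ → ℝ := fun e p =>
    ⟪x - p.1, v⟫ * ((1 - Real.exp (-(‖x - p.1‖ ^ 2 / (4 * (p.2 + e))))) /
        (2 * Real.pi * ‖x - p.1‖ ^ 2)) * w p.1
  have hGm : ∀ e, AEStronglyMeasurable (G e) (volume.prod μ) := fun e =>
    (Measurable.aestronglyMeasurable (by fun_prop)).mul hw.1.comp_fst
  have hbound : Integrable (fun p : Plane × ℝ => ‖v‖ * (‖x - p.1‖⁻¹ * ‖w p.1‖))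
      (volume.prod μ) :=
    ((integrable_inv_norm_sub_mul hw hM x).const_mul ‖v‖).comp_fst μ
  have hGle : ∀ e, 0 ≤ e → ∀ᵐ p ∂((volume : Measure Plane).prod μ),
      ‖G e p‖ ≤ ‖v‖ * (‖x - p.1‖⁻¹ * ‖w p.1‖) := by
    intro e he
    filter_upwards [hpos] with p hp
    simp only [G]
    have h1 := radialIntegrand_mem (sq_nonneg ‖x - p.1‖) (by linarith : 0 < p.2 + e)
    have h2 := norm_inner_div_le (x - p.1) v
    rw [norm_mul, ← mul_assoc]
    refine mul_le_mul_of_nonneg_right ?_ (norm_nonneg _)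
    rw [norm_mul, Real.norm_of_nonneg h1.1]
    calc ‖⟪x - p.1, v⟫‖ * _ ≤ ‖⟪x - p.1, v⟫‖ * (1 / (2 * Real.pi * ‖x - p.1‖ ^ 2)) := by
          exact mul_le_mul_of_nonneg_left h1.2 (norm_nonneg _)
      _ = 1 / (2 * Real.pi) * |⟪x - p.1, v⟫ / ‖x - p.1‖ ^ 2| := by
          rw [abs_div, abs_of_nonneg (sq_nonneg ‖x - p.1‖), Real.norm_eq_abs]
          field_simp
      _ ≤ 1 * |⟪x - p.1, v⟫ / ‖x - p.1‖ ^ 2| := by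
          gcongr
          rw [div_le_one (by positivity)]
          linarith [Real.pi_gt_three]
      _ ≤ _ := by rw [one_mul]; exact h2
  have hlim2 : Tendsto (fun n => ∫ p, G (ε n) p ∂((volume : Measure Plane).prod μ)) atTop
      (𝓝 (∫ p, G 0 p ∂((volume : Measure Plane).prod μ))) := by
    refine tendsto_integral_of_dominated_convergence _ (fun n => hGm _) hbound
      (fun n => hGle _ (hε n).le) ?_
    filter_upwards [hpos] with p hp
    refine Tendsto.mul_const _ (Tendsto.const_mul _ (Tendsto.div_const
      (Tendsto.const_sub _ ((Real.continuous_exp.tendsto _).comp (Tendsto.neg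
        (Tendsto.div tendsto_const_nhds ?_ ?_)))) _))
    · exact (hε0.const_add _).const_mul _
    · simp only [add_zero]; positivity
  have hlim3 := ((Complex.continuous_ofReal.tendsto _).comp hlim2)
  have heq : ∀ n, ∫ ξ : Plane, (Real.exp (-(ε n * ‖(2 * Real.pi) • ξ‖ ^ 2)) : ℂ) *
        (Complex.exp ((2 * Real.pi * ⟪ξ, x⟫ : ℝ) * Complex.I) * velocityHat R γ w j ξ) =
      ((∫ p, G (ε n) p ∂((volume : Measure Plane).prod μ) : ℝ) : ℂ) := by
    intro n
    rw [h.integral_exp_mul_velocityHat hw j hv' (hε n) x, integral_complex_ofReal]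
  simp_rw [heq] at hlim1
  rw [tendsto_nhds_unique hlim1 hlim3]
  congr 1
  have hG0 : Integrable (G 0) ((volume : Measure Plane).prod μ) :=
    hbound.mono' (hGm 0) (hGle 0 le_rfl)
  rw [integral_prod _ hG0]
  refine integral_congr_ae (ae_of_all _ fun y => ?_)
  simp only [G, add_zero]
  rw [integral_mul_const, integral_const_mul, mul_comm]
  congr 1
  rw [biotSavart, PiLp.smul_apply, hv', smul_eq_mul, radialKernel, mul_comm]

/-- The velocity generated by `w`, as a convolution with the Biot–Savart kernel. -/
noncomputable def convVelocity (μ : Measure ℝ) (w : Plane → ℝ) (x : Plane) : Plane :=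
  ∫ y, w y • biotSavart μ (x - y)

theorem IsHeatMixture.integrable_smul_biotSavart (h : IsHeatMixture R γ μ) {w : Plane → ℝ}
    (hw : Integrable w) {M : ℝ} (hM : ∀ y, |w y| ≤ M) (x : Plane) :
    Integrable fun y => w y • biotSavart μ (x - y) := by
  have := h.prob
  refine (integrable_inv_norm_sub_mul hw hM x).mono' (hw.1.smul
    (measurable_biotSavart.comp (measurable_const.sub measurable_id)).aestronglyMeasurable)
    (ae_of_all _ fun y => ?_)
  rw [norm_smul, mul_comm]
  gcongr
  exact h.norm_biotSavart_le _

theorem IsHeatMixture.velocity_eq (h : IsHeatMixture R γ μ) {w : Plane → ℝ}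
    (hw : Integrable w) {M : ℝ} (hM : ∀ y, |w y| ≤ M)
    (hv : ∀ j, Integrable (velocityHat R γ w j)) (x : Plane) :
    velocity R γ w x = convVelocity μ w x := by
  have hc : ∀ j, convVelocity μ w x j = ∫ y, w y * biotSavart μ (x - y) j := by
    intro j
    have := (EuclideanSpace.proj (𝕜 := ℝ) j : Plane →L[ℝ] ℝ).integral_comp_comm
      (h.integrable_smul_biotSavart hw hM x)
    simpa [convVelocity] using this.symm
  ext j
  rw [hc]
  fin_cases j <;> simp [velocity, h.fourierInv_velocityHat hw hM _ (hv _)]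

theorem IsHeatMixture.norm_convVelocity_le (h : IsHeatMixture R γ μ) {w : Plane → ℝ}
    (hw : Integrable w) {M : ℝ} (hM : ∀ y, |w y| ≤ M) (x : Plane) :
    ‖convVelocity μ w x‖ ≤ M * singularMass + ∫ y, |w y| := by
  refine le_trans ?_ (integral_inv_norm_sub_mul_le hw hM x)
  refine norm_integral_le_of_norm_le (integrable_inv_norm_sub_mul hw hM x) (ae_of_all _ fun y => ?_)
  rw [norm_smul, mul_comm]
  gcongr
  exact h.norm_biotSavart_le _

end

section

variable {R : Regularization} {γ : ℝ} {μ : Measure ℝ}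

/-! ### Differentiability of the velocity -/

/-- `perp` as a continuous linear map. -/
noncomputable def perpCLM : Plane →L[ℝ] Plane :=
  LinearMap.toContinuousLinearMap
    { toFun := perp
      map_add' := fun x y => by ext i; fin_cases i <;> simp [perp]; ring
      map_smul' := fun c x => by ext i; fin_cases i <;> simp [perp] }

@[simp] theorem perpCLM_apply (z : Plane) : perpCLM z = perp z := rfl

theorem perp_perp (z : Plane) : perp (perp z) = -z := by
  ext i; fin_cases i <;> simp [perp]

/-- Rotation by the angle `θ`. -/
noncomputable def rotation (θ : ℝ) : Plane ≃ₗᵢ[ℝ] Plane :=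
  LinearIsometry.toLinearIsometryEquiv
    { toLinearMap :=
        (Real.cos θ • ContinuousLinearMap.id ℝ Plane + Real.sin θ • perpCLM).toLinearMap
      norm_map' := fun z => by
        have h : ‖Real.cos θ • z + Real.sin θ • perp z‖ ^ 2 = ‖z‖ ^ 2 := by
          rw [norm_sq_eq, norm_sq_eq]
          simp only [PiLp.add_apply, PiLp.smul_apply, smul_eq_mul, perp_zero_coord, perp_one_coord]
          linear_combination (z 0 ^ 2 + z 1 ^ 2) * Real.cos_sq_add_sin_sq θ
        exact (pow_left_inj₀ (norm_nonneg _) (norm_nonneg _) two_ne_zero).1 h } rfl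

theorem rotation_apply (θ : ℝ) (z : Plane) :
    rotation θ z = Real.cos θ • z + Real.sin θ • perp z := rfl

theorem hasDerivAt_rotation (θ : ℝ) (z : Plane) :
    HasDerivAt (fun θ => rotation θ z) (perp (rotation θ z)) θ := by
  simp only [rotation_apply]
  refine (((Real.hasDerivAt_cos θ).smul_const z).add
    ((Real.hasDerivAt_sin θ).smul_const (perp z))).congr_deriv ?_
  rw [← perpCLM_apply (_ + _), map_add, map_smul, map_smul, perpCLM_apply, perpCLM_apply,
    perp_perp]
  module

/-- Angular derivatives integrate to zero against bounded radial weights, because the integral of a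
radial weight against `f` rotated by `θ` does not depend on `θ`. -/
theorem integral_radial_mul_fderiv_perp {h : ℝ → ℝ} (hm : Measurable h) {C : ℝ}
    (hC : ∀ r, |h r| ≤ C) {f : Plane → ℝ} (hf : ContDiff ℝ 1 f) (hs : HasCompactSupport f) :
    ∫ z : Plane, h ‖z‖ * fderiv ℝ f z (perp z) = 0 := by
  have hC0 : 0 ≤ C := (abs_nonneg _).trans (hC 0)
  have hf' : Continuous (fderiv ℝ f) := hf.continuous_fderiv one_ne_zero
  obtain ⟨M, hM⟩ := hf'.bounded_above_of_compact_support (hs.fderiv ℝ)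
  obtain ⟨r, hr⟩ := hs.isCompact.isBounded.subset_closedBall (0 : Plane)
  have hM0 : 0 ≤ M := (norm_nonneg _).trans (hM 0)
  have hmn : Measurable fun z : Plane => h ‖z‖ := hm.comp measurable_norm
  have hder : ∀ z, r < ‖z‖ → fderiv ℝ f z = 0 := by
    intro z hz
    by_contra hne
    have h1 := hr (tsupport_fderiv_subset ℝ (subset_tsupport _ hne))
    rw [mem_closedBall_zero_iff] at h1
    linarith
  let F : ℝ → Plane → ℝ := fun θ z => h ‖z‖ * f (rotation θ z)
  let F' : ℝ → Plane → ℝ := fun θ z =>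
    h ‖z‖ * fderiv ℝ f (rotation θ z) (perp (rotation θ z))
  have hconst : ∀ θ, ∫ z, F θ z = ∫ z, h ‖z‖ * f z := by
    intro θ
    rw [← (rotation θ).measurePreserving.integral_comp
      (rotation θ).toHomeomorph.measurableEmbedding (fun z => h ‖z‖ * f z)]
    simp [F]
  have h0 : ∀ z, rotation 0 z = z := fun z => by simp [rotation_apply]
  have key := hasDerivAt_integral_of_dominated_loc_of_deriv_le (μ := (volume : Measure Plane))
    (F := F) (F' := F') (x₀ := 0) (s := univ)
    (bound := (Metric.closedBall (0 : Plane) r).indicator fun _ => C * (M * r)) univ_mem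
    (Eventually.of_forall fun θ => (hmn.mul
      (hf.continuous.measurable.comp (rotation θ).continuous.measurable)).aestronglyMeasurable)
    ?_ ?_ (ae_of_all _ fun z θ _ => ?_) ?_ (ae_of_all _ fun z θ _ => ?_)
  · have h1 := key.2
    simp_rw [hconst] at h1
    have h2 := h1.unique (hasDerivAt_const _ _)
    rw [← h2]
    simp only [F', h0]
  · have h1 : Integrable f := hf.continuous.integrable_of_hasCompactSupport hs
    refine (h1.norm.const_mul C).mono' (hmn.mul
      (hf.continuous.measurable.comp (rotation 0).continuous.measurable)).aestronglyMeasurable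
      (ae_of_all _ fun z => ?_)
    simp only [F, h0, norm_mul]
    gcongr
    exact hC _
  · simp only [F', h0]
    exact (hmn.mul (hf'.clm_apply continuous_perp).measurable).aestronglyMeasurable
  · simp only [F']
    by_cases hz : ‖z‖ ≤ r
    · rw [indicator_of_mem (by simpa using hz), norm_mul]
      refine mul_le_mul (hC _) ((ContinuousLinearMap.le_opNorm _ _).trans ?_) (norm_nonneg _) hC0
      rw [norm_perp, LinearIsometryEquiv.norm_map]
      exact mul_le_mul (hM _) hz (norm_nonneg _) hM0
    · rw [hder _ (by rw [LinearIsometryEquiv.norm_map]; linarith)]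
      simp only [zero_apply, mul_zero, norm_zero]
      exact indicator_nonneg (fun y hy => by
        have : 0 ≤ r := (norm_nonneg y).trans (by simpa using hy)
        positivity) z
  · exact (integrable_indicator_iff Metric.isClosed_closedBall.measurableSet).2
      (integrableOn_const (isCompact_closedBall _ _).measure_lt_top.ne)
  · have h1 := (hf.differentiable one_ne_zero (rotation θ z)).hasFDerivAt.comp_hasDerivAt θ
      (hasDerivAt_rotation θ z)
    exact h1.const_mul (h ‖z‖)

theorem IsHeatMixture.locallyIntegrable_biotSavart (h : IsHeatMixture R γ μ) :
    LocallyIntegrable (biotSavart μ) := by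
  have := h.prob
  rw [locallyIntegrable_iff]
  intro k hk
  obtain ⟨r, hr⟩ := hk.isBounded.subset_ball (0 : Plane)
  refine IntegrableOn.mono_set ?_ hr
  exact (integrableOn_inv_norm_ball r).mono' measurable_biotSavart.aestronglyMeasurable
    (ae_of_all _ h.norm_biotSavart_le)

/-- The Biot–Savart kernel is divergence free in the sense of distributions. -/
theorem IsHeatMixture.integral_fderiv_biotSavart (h : IsHeatMixture R γ μ) {f : Plane → ℝ}
    (hf : ContDiff ℝ 1 f) (hs : HasCompactSupport f) :
    ∫ z, fderiv ℝ f z (biotSavart μ z) = 0 := by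
  have := h.prob
  -- the radial factor is cut off near the origin to make it bounded
  let c : ℕ → ℝ := fun n => 1 / ((n : ℝ) + 1)
  have hc : ∀ n, 0 < c n := fun n => by positivity
  let H : ℕ → ℝ → ℝ := fun n => (Ici (c n)).indicator fun r => radialKernel μ (r ^ 2)
  have hHm : ∀ n, Measurable (H n) := fun n =>
    ((measurable_radialKernel (μ := μ)).comp (measurable_id.pow_const 2)).indicator
      measurableSet_Ici
  have hHb : ∀ n r, |H n r| ≤ 1 / c n ^ 2 := by
    intro n r
    simp only [H]
    by_cases hr : r ∈ Ici (c n)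
    · have hr' : c n ≤ r := hr
      rw [indicator_of_mem hr, abs_of_nonneg (h.radialKernel_nonneg (sq_nonneg _))]
      refine (h.radialKernel_le (sq_nonneg _)).trans ?_
      have h1 := hc n
      gcongr
      have h2 : c n ^ 2 ≤ r ^ 2 := by gcongr
      nlinarith [Real.pi_gt_three, sq_nonneg (c n)]
    · rw [indicator_of_notMem hr, abs_zero]
      positivity
  have hf' : Continuous (fderiv ℝ f) := hf.continuous_fderiv one_ne_zero
  have hlim : Tendsto (fun n => ∫ z : Plane, H n ‖z‖ * fderiv ℝ f z (perp z)) atTop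
      (𝓝 (∫ z, fderiv ℝ f z (biotSavart μ z))) := by
    obtain ⟨M, hM⟩ := hf'.bounded_above_of_compact_support (hs.fderiv ℝ)
    have hb : Integrable fun z => ‖(0 : Plane) - z‖⁻¹ * ‖fderiv ℝ f z‖ :=
      integrable_inv_norm_sub_mul (hf'.integrable_of_hasCompactSupport (hs.fderiv ℝ)) hM 0
    refine tendsto_integral_of_dominated_convergence _ (fun n => ?_) hb
      (fun n => ae_of_all _ fun z => ?_) (ae_of_all _ fun z => ?_)
    · exact (((hHm n).comp measurable_norm).mul
        (hf'.clm_apply continuous_perp).measurable).aestronglyMeasurable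
    · have h1 : H n ‖z‖ * fderiv ℝ f z (perp z) = (Ici (c n)).indicator (fun _ => (1 : ℝ)) ‖z‖ *
          fderiv ℝ f z (biotSavart μ z) := by
        simp only [H, biotSavart, map_smul, smul_eq_mul]
        by_cases hr : ‖z‖ ∈ Ici (c n)
        · rw [indicator_of_mem hr, indicator_of_mem hr, one_mul]
        · rw [indicator_of_notMem hr, indicator_of_notMem hr, zero_mul, zero_mul]
      rw [h1, norm_mul, zero_sub, norm_neg]
      have h2 : ‖(Ici (c n)).indicator (fun _ => (1 : ℝ)) ‖z‖‖ ≤ 1 :=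
        (norm_indicator_le_norm_self _ _).trans (by simp)
      refine (mul_le_of_le_one_left (norm_nonneg _) h2).trans ?_
      refine (ContinuousLinearMap.le_opNorm _ _).trans ?_
      rw [mul_comm]
      gcongr
      exact h.norm_biotSavart_le z
    · rcases eq_or_ne z 0 with rfl | hz
      · simp [biotSavart, ← perpCLM_apply]
      refine tendsto_const_nhds.congr' ?_
      have h1 : ∀ᶠ n in atTop, c n < ‖z‖ :=
        (tendsto_one_div_add_atTop_nhds_zero_nat (𝕜 := ℝ)).eventually_lt_const (norm_pos_iff.2 hz)
      filter_upwards [h1] with n hn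
      simp only [H]
      rw [indicator_of_mem (mem_Ici.2 hn.le), biotSavart, map_smul, smul_eq_mul]
  have hz : ∀ n, ∫ z : Plane, H n ‖z‖ * fderiv ℝ f z (perp z) = 0 := fun n =>
    integral_radial_mul_fderiv_perp (hHm n) (hHb n) hf hs
  simp_rw [hz] at hlim
  exact (tendsto_nhds_unique hlim tendsto_const_nhds)

/-- Multiplication of a vector by a scalar, with the vector as first argument. -/
noncomputable def smulFlip : Plane →L[ℝ] ℝ →L[ℝ] Plane := (ContinuousLinearMap.lsmul ℝ ℝ).flip

theorem smulFlip_apply (z : Plane) (a : ℝ) : smulFlip z a = a • z := rfl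

theorem convVelocity_eq_convolution (w : Plane → ℝ) :
    convVelocity μ w = convolution (biotSavart μ) w smulFlip volume := by
  ext1 x
  rw [convolution_def, convVelocity,
    ← integral_sub_left_eq_self (fun y => w y • biotSavart μ (x - y)) volume x]
  simp [smulFlip_apply]

/-- The gradient of the velocity generated by `w`; the derivative falls on `w`, since the gradient
of the kernel is not locally integrable. -/
noncomputable def velocityGrad (μ : Measure ℝ) (w : Plane → ℝ) (x : Plane) : Plane →L[ℝ] Plane :=
  convolution (biotSavart μ) (fderiv ℝ w) (smulFlip.precompR Plane) volume x

variable {w : Plane → ℝ}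

theorem IsHeatMixture.hasFDerivAt_convVelocity (h : IsHeatMixture R γ μ)
    (hw : ContDiff ℝ 1 w) (hs : HasCompactSupport w) (x : Plane) :
    HasFDerivAt (convVelocity μ w) (velocityGrad μ w x) x := by
  rw [convVelocity_eq_convolution]
  exact hs.hasFDerivAt_convolution_right _ h.locallyIntegrable_biotSavart hw x

theorem IsHeatMixture.velocityGrad_apply (h : IsHeatMixture R γ μ)
    (hw : ContDiff ℝ 1 w) (hs : HasCompactSupport w) (x v : Plane) :
    velocityGrad μ w x v = convVelocity μ (fun y => fderiv ℝ w y v) x := by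
  rw [convVelocity_eq_convolution, velocityGrad]
  exact convolution_precompR_apply _ h.locallyIntegrable_biotSavart (hs.fderiv ℝ)
    (hw.continuous_fderiv one_ne_zero) x v

theorem IsHeatMixture.norm_velocityGrad_le (h : IsHeatMixture R γ μ)
    (hw : ContDiff ℝ 1 w) (hs : HasCompactSupport w) {M : ℝ} (hM : ∀ y, ‖fderiv ℝ w y‖ ≤ M)
    (x : Plane) :
    ‖velocityGrad μ w x‖ ≤ M * singularMass + ∫ y, ‖fderiv ℝ w y‖ := by
  have hM0 : 0 ≤ M := (norm_nonneg _).trans (hM 0)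
  have hf' : Continuous (fderiv ℝ w) := hw.continuous_fderiv one_ne_zero
  have hi : Integrable (fderiv ℝ w) := hf'.integrable_of_hasCompactSupport (hs.fderiv ℝ)
  refine ContinuousLinearMap.opNorm_le_bound _ (add_nonneg (mul_nonneg hM0 singularMass_nonneg)
    (integral_nonneg fun _ => norm_nonneg _)) fun v => ?_
  have hle : ∀ y, |fderiv ℝ w y v| ≤ ‖fderiv ℝ w y‖ * ‖v‖ := fun y =>
    (fderiv ℝ w y).le_opNorm v
  have hi2 : Integrable fun y => fderiv ℝ w y v :=
    (ContinuousLinearMap.apply ℝ ℝ v).integrable_comp hi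
  rw [h.velocityGrad_apply hw hs]
  refine (h.norm_convVelocity_le hi2 (M := M * ‖v‖) (fun y => (hle y).trans (by gcongr; exact hM y))
    x).trans ?_
  have : ∫ y, |fderiv ℝ w y v| ≤ (∫ y, ‖fderiv ℝ w y‖) * ‖v‖ := by
    rw [← integral_mul_const]
    exact integral_mono hi2.abs (hi.norm.mul_const _) hle
  linarith

/-- The trace of an endomorphism of the plane. -/
noncomputable def planeTrace (A : Plane →L[ℝ] Plane) : ℝ :=
  A (EuclideanSpace.single 0 1) 0 + A (EuclideanSpace.single 1 1) 1

theorem plane_eq_sum (z : Plane) :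
    z = z 0 • EuclideanSpace.single 0 (1 : ℝ) + z 1 • EuclideanSpace.single 1 (1 : ℝ) := by
  ext i; fin_cases i <;> simp

theorem IsHeatMixture.planeTrace_velocityGrad (h : IsHeatMixture R γ μ)
    (hw : ContDiff ℝ 1 w) (hs : HasCompactSupport w) (x : Plane) :
    planeTrace (velocityGrad μ w x) = 0 := by
  have hf' : Continuous (fderiv ℝ w) := hw.continuous_fderiv one_ne_zero
  obtain ⟨M, hM⟩ := hf'.bounded_above_of_compact_support (hs.fderiv ℝ)
  have hi : Integrable (fderiv ℝ w) := hf'.integrable_of_hasCompactSupport (hs.fderiv ℝ)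
  have hi2 : ∀ v, Integrable fun y => fderiv ℝ w y v := fun v =>
    (ContinuousLinearMap.apply ℝ ℝ v).integrable_comp hi
  have hb : ∀ v y, |fderiv ℝ w y v| ≤ M * ‖v‖ := fun v y =>
    ((fderiv ℝ w y).le_opNorm v).trans (by gcongr; exact hM y)
  have hint : ∀ v, Integrable fun y => fderiv ℝ w y v • biotSavart μ (x - y) := fun v =>
    h.integrable_smul_biotSavart (hi2 v) (hb v) x
  have hcoord : ∀ v (i : Fin 2), velocityGrad μ w x v i =
      ∫ y, fderiv ℝ w y v * biotSavart μ (x - y) i := by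
    intro v i
    rw [h.velocityGrad_apply hw hs]
    have := (EuclideanSpace.proj (𝕜 := ℝ) i : Plane →L[ℝ] ℝ).integral_comp_comm (hint v)
    simpa [convVelocity] using this.symm
  have hcint : ∀ v (i : Fin 2), Integrable fun y => fderiv ℝ w y v * biotSavart μ (x - y) i := by
    intro v i
    have := (EuclideanSpace.proj (𝕜 := ℝ) i : Plane →L[ℝ] ℝ).integrable_comp (hint v)
    simpa using this
  rw [planeTrace, hcoord, hcoord, ← integral_add (hcint _ _) (hcint _ _)]
  have e1 : ∀ y, fderiv ℝ w y (EuclideanSpace.single 0 1) * biotSavart μ (x - y) 0 +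
      fderiv ℝ w y (EuclideanSpace.single 1 1) * biotSavart μ (x - y) 1 =
      fderiv ℝ w y (biotSavart μ (x - y)) := by
    intro y
    conv_rhs => rw [plane_eq_sum (biotSavart μ (x - y))]
    rw [map_add, map_smul, map_smul, smul_eq_mul, smul_eq_mul]
    ring
  simp_rw [e1]
  -- pass to the variable `z = x - y`
  let f : Plane → ℝ := fun z => w (x - z)
  have hf : ContDiff ℝ 1 f := hw.comp (contDiff_const.sub contDiff_id)
  have hfs : HasCompactSupport f := by
    have : f = w ∘ (Homeomorph.subLeft x) := rfl
    rw [this]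
    exact hs.comp_homeomorph _
  have hfd : ∀ z, fderiv ℝ f z (biotSavart μ z) = -fderiv ℝ w (x - z) (biotSavart μ z) := by
    intro z
    have h1 : HasFDerivAt f ((fderiv ℝ w (x - z)).comp (-(ContinuousLinearMap.id ℝ Plane))) z :=
      (hw.differentiable one_ne_zero (x - z)).hasFDerivAt.comp z
        ((hasFDerivAt_id z).const_sub x)
    rw [h1.fderiv]
    simp
  have h2 := h.integral_fderiv_biotSavart hf hfs
  simp_rw [hfd] at h2
  rw [integral_neg, neg_eq_zero] at h2
  rw [← integral_sub_left_eq_self (fun y => fderiv ℝ w y (biotSavart μ (x - y))) volume x]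
  simpa using h2

end

section

variable {R : Regularization} {γ : ℝ} {μ : Measure ℝ}

/-! ### The maximum principle along backward directions -/

/-- A function on a compact set of space-time is at most `c` if at each maximum point with value
above `c` there is a backward direction staying in the set along which it strictly decreases. -/
theorem maximum_principle {A : Set (ℝ × Plane)} (hA : IsCompact A) {f : ℝ × Plane → ℝ}
    (hf : ContinuousOn f A) {c : ℝ}
    (h : ∀ p ∈ A, IsMaxOn f A p → c < f p → ∃ b : ℝ × Plane, (∀ᶠ h in 𝓝[>] (0 : ℝ), p - h • b ∈ A) ∧
      ∃ f' : ℝ, 0 < f' ∧ HasDerivAt (fun h : ℝ => f (p - h • b)) f' 0) :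
    ∀ p ∈ A, f p ≤ c := by
  intro p hp
  obtain ⟨q, hq, hmax⟩ := hA.exists_isMaxOn ⟨p, hp⟩ hf
  refine (hmax hp).trans ?_
  by_contra! hc
  obtain ⟨b, hb, f', hf', hd⟩ := h q hq hmax hc
  have h1 := hd.hasDerivWithinAt (s := Ioi 0)
  rw [hasDerivWithinAt_iff_tendsto_slope' (by simp)] at h1
  have h2 : ∀ᶠ h in 𝓝[>] (0 : ℝ), slope (fun h : ℝ => f (q - h • b)) 0 h ≤ 0 := by
    filter_upwards [hb, self_mem_nhdsWithin] with t ht ht0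
    have ht0 : 0 < t := ht0
    have : f (q - t • b) ≤ f q := hmax ht
    rw [slope_def_field]
    refine div_nonpos_of_nonpos_of_nonneg ?_ (by simpa using ht0.le)
    simpa using this
  have := le_of_tendsto h1 h2
  linarith

/-! ### Basic properties of smooth solutions -/

variable {g : Plane → ℝ} {w : ℝ → Plane → ℝ}

namespace IsSmoothSolution

theorem continuousOn (hw : IsSmoothSolution R γ g w) :
    ContinuousOn (fun p : ℝ × Plane => w p.1 p.2) (Ici 0 ×ˢ univ) := hw.smooth.continuousOn

theorem contDiff (hw : IsSmoothSolution R γ g w) {t : ℝ} (ht : 0 ≤ t) :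
    ContDiff ℝ 1 (w t) := by
  have h1 : ContDiffOn ℝ 1 (fun p : ℝ × Plane => w p.1 p.2) (Ici 0 ×ˢ univ) :=
    hw.smooth.of_le (by norm_cast)
  exact contDiffOn_univ.1 (h1.comp (f := fun x : Plane => (t, x))
    (contDiff_const.prodMk contDiff_id).contDiffOn fun x _ => ⟨ht, mem_univ _⟩)

theorem hasFDerivWithinAt_fderivWithin (hw : IsSmoothSolution R γ g w) {t : ℝ} (ht : 0 ≤ t)
    (x : Plane) :
    HasFDerivWithinAt (fun p : ℝ × Plane => w p.1 p.2)
      (fderivWithin ℝ (fun p : ℝ × Plane => w p.1 p.2) (Ici 0 ×ˢ univ) (t, x))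
      (Ici 0 ×ˢ univ) (t, x) :=
  (hw.smooth.differentiableOn (by simp) (t, x) ⟨ht, mem_univ _⟩).hasFDerivWithinAt

theorem fderiv_eq (hw : IsSmoothSolution R γ g w) {t : ℝ} (ht : 0 ≤ t) (x : Plane) :
    fderiv ℝ (w t) x = (fderivWithin ℝ (fun p : ℝ × Plane => w p.1 p.2) (Ici 0 ×ˢ univ)
      (t, x)).comp (ContinuousLinearMap.inr ℝ ℝ Plane) := by
  have h1 := (hw.hasFDerivWithinAt_fderivWithin ht x).comp x (f := fun y : Plane => (t, y))
    ((hasFDerivAt_prodMk_right t x).hasFDerivWithinAt (s := univ))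
    fun y _ => ⟨ht, mem_univ _⟩
  exact (hasFDerivWithinAt_univ.1 h1).fderiv

theorem continuousOn_fderiv (hw : IsSmoothSolution R γ g w) :
    ContinuousOn (fun p : ℝ × Plane => fderiv ℝ (w p.1) p.2) (Ici 0 ×ˢ univ) := by
  have h1 := hw.smooth.continuousOn_fderivWithin ((uniqueDiffOn_Ici (0 : ℝ)).prod uniqueDiffOn_univ)
    (by simp)
  refine (h1.clm_comp (continuousOn_const (c := ContinuousLinearMap.inr ℝ ℝ Plane))).congr
    fun p hp => ?_
  exact hw.fderiv_eq hp.1 p.2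

/-- The space-time derivative of a solution. -/
theorem hasFDerivWithinAt (hw : IsSmoothSolution R γ g w) {t : ℝ} (ht : 0 ≤ t) (x : Plane) :
    HasFDerivWithinAt (fun p : ℝ × Plane => w p.1 p.2)
      ((fderiv ℝ (w t) x).comp (ContinuousLinearMap.snd ℝ ℝ Plane) -
        fderiv ℝ (w t) x (velocity R γ (w t) x) • ContinuousLinearMap.fst ℝ ℝ Plane)
      (Ici 0 ×ˢ univ) (t, x) := by
  have h0 := hw.hasFDerivWithinAt_fderivWithin ht x
  have h1 := h0.comp_hasDerivWithinAt (f := fun s : ℝ => (s, x)) (s := Ici 0) t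
    ((hasDerivAt_id t).prodMk (hasDerivAt_const t x)).hasDerivWithinAt
    fun s hs => ⟨hs, mem_univ _⟩
  have h2 := (uniqueDiffOn_Ici (0 : ℝ) t ht).eq_deriv _ h1 (hw.transport t ht x)
  refine h0.congr_fderiv ?_
  rw [hw.fderiv_eq ht x] at h2 ⊢
  refine ContinuousLinearMap.ext fun p => ?_
  have h3 : p = p.1 • ((1 : ℝ), (0 : Plane)) + ((0 : ℝ), p.2) := by
    ext <;> simp
  conv_lhs => rw [h3, map_add, map_smul]
  rw [h2]
  simp
  ring

/-- The derivative of a solution along the backward direction `-(1, b)`; it vanishes along the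
velocity itself. -/
theorem hasDerivAt_backward (hw : IsSmoothSolution R γ g w) {t : ℝ} (ht : 0 < t) (x b : Plane) :
    HasDerivAt (fun h : ℝ => w (t - h) (x - h • b))
      (fderiv ℝ (w t) x (velocity R γ (w t) x - b)) 0 := by
  have h0 := (hw.hasFDerivWithinAt ht.le x).hasFDerivAt
    (prod_mem_nhds (Ici_mem_nhds ht) univ_mem)
  have h1 : HasDerivAt (fun h : ℝ => (t - h, x - h • b)) (-1, -b) 0 := by
    refine HasDerivAt.prodMk ?_ ?_
    · simpa using (hasDerivAt_id (0 : ℝ)).const_sub t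
    · simpa using ((hasDerivAt_id (0 : ℝ)).smul_const b).const_sub x
  have h2 := h0.comp_hasDerivAt_of_eq (0 : ℝ) h1 (by simp)
  refine h2.congr_deriv ?_
  simp
  ring

theorem velocity_eq (hw : IsSmoothSolution R γ g w) (h : IsHeatMixture R γ μ) {t : ℝ}
    (ht : 0 ≤ t) (x : Plane) : velocity R γ (w t) x = convVelocity μ (w t) x := by
  obtain ⟨M, hM⟩ := hw.bounded t
  exact h.velocity_eq (hw.integrable t ht) (hM t ⟨ht, le_rfl⟩).2 (hw.velocity_integrable t ht) x

theorem exists_velocity_bound (hw : IsSmoothSolution R γ g w) (h : IsHeatMixture R γ μ) (T : ℝ) :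
    ∃ U : ℝ, 0 ≤ U ∧ ∀ t ∈ Icc 0 T, ∀ x, ‖velocity R γ (w t) x‖ ≤ U := by
  obtain ⟨M, hM⟩ := hw.bounded T
  refine ⟨|M * singularMass + M|, abs_nonneg _, fun t ht x => ?_⟩
  rw [hw.velocity_eq h ht.1]
  refine (h.norm_convVelocity_le (hw.integrable t ht.1) (hM t ht).2 x).trans ?_
  refine le_trans ?_ (le_abs_self _)
  gcongr
  exact (hM t ht).1

/-- Finite speed of propagation: the maximum principle on a backward cone wider than the velocity
bound `U`, for the functions `σ w - ε t`. The scalar `σ` is arbitrary, to cover both signs of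
`w`. -/
theorem exists_support_bound (hw : IsSmoothSolution R γ g w) (h : IsHeatMixture R γ μ)
    (hg : HasCompactSupport g) (T : ℝ) :
    ∃ ρ : ℝ, 0 < ρ ∧ ∀ t ∈ Icc 0 T, ∀ x, ρ < ‖x‖ → w t x = 0 := by
  obtain ⟨U, hU0, hU⟩ := hw.exists_velocity_bound h T
  obtain ⟨r, hr⟩ := hg.isCompact.isBounded.subset_closedBall (0 : Plane)
  have hgr : ∀ x, r < ‖x‖ → g x = 0 := by
    intro x hx
    by_contra hne
    have h1 := hr (subset_tsupport _ hne)
    rw [mem_closedBall_zero_iff] at h1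
    linarith
  refine ⟨max r 0 + (U + 1) * max T 0 + 1, by positivity, fun t ht y hy => ?_⟩
  have hT : t ≤ max T 0 := ht.2.trans (le_max_left _ _)
  let A : Set (ℝ × Plane) := {p | p.1 ∈ Icc 0 t ∧ ‖p.2 - y‖ ≤ (U + 1) * (t - p.1)}
  have hA : IsCompact A := by
    refine ((isCompact_Icc (a := 0) (b := t)).prod
      (isCompact_closedBall y ((U + 1) * t))).of_isClosed_subset ?_ ?_
    · exact (isClosed_Icc.preimage continuous_fst).inter
        (isClosed_le (f := fun p : ℝ × Plane => ‖p.2 - y‖) (g := fun p => (U + 1) * (t - p.1))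
          (by fun_prop) (by fun_prop))
    · rintro ⟨s, x⟩ ⟨hs, hx⟩
      refine ⟨hs, ?_⟩
      rw [mem_closedBall_iff_norm]
      refine hx.trans ?_
      have := hs.1
      gcongr
      simpa using hs.1
  have hsub : A ⊆ Ici 0 ×ˢ univ := fun p hp => ⟨hp.1.1, mem_univ _⟩
  have key : ∀ (σ : ℝ), ∀ ε > 0, σ * w t y - ε * t ≤ 0 := by
    intro σ ε hε
    refine maximum_principle hA (f := fun p => σ * w p.1 p.2 - ε * p.1)
      ((continuousOn_const.mul (hw.continuousOn.mono hsub)).sub (by fun_prop)) ?_ (t, y)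
      ⟨⟨ht.1, le_rfl⟩, by simp⟩
    rintro ⟨s, x⟩ ⟨hs, hx⟩ - hpos
    have hs' : 0 ≤ s := hs.1
    have hst : s ≤ t := hs.2
    rcases hs'.eq_or_lt with h0 | hs0
    · exfalso
      subst h0
      have h1 : w 0 x = 0 := by
        rw [hw.initial]
        refine hgr x ?_
        have h2 : ‖y‖ ≤ ‖x‖ + ‖x - y‖ := by
          have := norm_sub_le x (x - y)
          simpa using this
        have h3 : (U + 1) * (t - 0) ≤ (U + 1) * max T 0 := by rw [sub_zero]; gcongr
        have h4 := le_max_left r 0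
        simp only at hx
        linarith
      simp [h1] at hpos
    · refine ⟨(1, velocity R γ (w s) x), ?_, ε, hε, ?_⟩
      · filter_upwards [Ioo_mem_nhdsGT hs0] with τ hτ
        refine ⟨⟨?_, ?_⟩, ?_⟩
        · simp; linarith [hτ.2]
        · simp; linarith [hτ.1]
        · have h1 := hU s ⟨hs', hst.trans ht.2⟩ x
          have h2 : ‖τ • velocity R γ (w s) x‖ ≤ τ * U := by
            rw [norm_smul, Real.norm_of_nonneg hτ.1.le]
            have := hτ.1.le
            gcongr
          have h3 := norm_sub_le (x - y) (τ • velocity R γ (w s) x)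
          have h4 : x - τ • velocity R γ (w s) x - y = x - y - τ • velocity R γ (w s) x := by abel
          have h5 := hτ.1
          simp only [Prod.smul_mk, smul_eq_mul, mul_one, Prod.mk_sub_mk] at hx ⊢
          rw [h4]
          nlinarith
      · have h1 := ((hw.hasDerivAt_backward hs0 x (velocity R γ (w s) x)).const_mul σ).sub
          (((hasDerivAt_id (0 : ℝ)).const_sub s).const_mul ε)
        refine (h1.congr_deriv (by simp)).congr_of_eventuallyEq (Eventually.of_forall fun τ => ?_)
        simp
  have hle : ∀ σ : ℝ, σ * w t y ≤ 0 := by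
    intro σ
    refine le_of_forall_pos_le_add fun δ hδ => ?_
    have h1 := key σ (δ / (t + 1)) (div_pos hδ (by linarith [ht.1]))
    have h2 : δ / (t + 1) * t ≤ δ := by
      rw [div_mul_eq_mul_div, div_le_iff₀ (by linarith [ht.1])]
      nlinarith [ht.1]
    linarith
  have h1 := hle 1
  have h2 := hle (-1)
  linarith

end IsSmoothSolution

end

section

variable {R : Regularization} {γ : ℝ} {μ : Measure ℝ}

/-! ### Reflections -/

theorem continuous_coord (i : Fin 2) : Continuous fun x : Plane => x i := by fun_prop

/-- The reflection which changes the sign of the `i`-th coordinate. -/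
noncomputable def coordReflection (i : Fin 2) : Plane ≃ₗᵢ[ℝ] Plane :=
  LinearIsometryEquiv.piLpCongrRight 2 fun j =>
    if j = i then LinearIsometryEquiv.neg ℝ else LinearIsometryEquiv.refl ℝ ℝ

theorem coordReflection_apply (i : Fin 2) (z : Plane) (j : Fin 2) :
    coordReflection i z j = if j = i then -z j else z j := by
  simp only [coordReflection, LinearIsometryEquiv.piLpCongrRight_apply]
  split_ifs <;> simp

@[simp] theorem coordReflection_coordReflection (i : Fin 2) (z : Plane) :
    coordReflection i (coordReflection i z) = z := by
  ext j
  simp only [coordReflection_apply]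
  split_ifs <;> simp

theorem perp_coordReflection (i : Fin 2) (z : Plane) :
    perp (coordReflection i z) = -coordReflection i (perp z) := by
  ext j
  fin_cases i <;> fin_cases j <;> simp [perp, coordReflection_apply]

theorem biotSavart_coordReflection (i : Fin 2) (z : Plane) :
    biotSavart μ (coordReflection i z) = -coordReflection i (biotSavart μ z) := by
  rw [biotSavart, biotSavart, LinearIsometryEquiv.norm_map, perp_coordReflection, map_smul,
    smul_neg]

theorem convVelocity_comp_coordReflection (w : Plane → ℝ) (i : Fin 2) (x : Plane) :
    convVelocity μ (fun y => w (coordReflection i y)) x =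
      -coordReflection i (convVelocity μ w (coordReflection i x)) := by
  have h1 : ∀ y, w y • biotSavart μ (x - coordReflection i y) =
      -(coordReflection i (w y • biotSavart μ (coordReflection i x - y))) := by
    intro y
    have : x - coordReflection i y = coordReflection i (coordReflection i x - y) := by
      rw [map_sub, coordReflection_coordReflection]
    rw [this, biotSavart_coordReflection, map_smul, smul_neg]
  rw [convVelocity, ← (coordReflection i).measurePreserving.integral_comp
    (coordReflection i).toHomeomorph.measurableEmbedding]
  simp only [coordReflection_coordReflection, h1]
  rw [integral_neg, convVelocity]
  congr 1
  exact (coordReflection i).toContinuousLinearEquiv.integral_comp_comm _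

theorem integral_norm_le_of_support {E : Type*} [NormedAddCommGroup E] {f : Plane → E} {S ρ : ℝ}
    (hS : ∀ y, ‖f y‖ ≤ S) (hρ : ∀ x, ρ < ‖x‖ → f x = 0) :
    ∫ y, ‖f y‖ ≤ S * volume.real (Metric.closedBall (0 : Plane) ρ) := by
  have hm : MeasurableSet (Metric.closedBall (0 : Plane) ρ) :=
    Metric.isClosed_closedBall.measurableSet
  calc ∫ y, ‖f y‖ ≤ ∫ y, (Metric.closedBall (0 : Plane) ρ).indicator (fun _ => S) y := by
        refine integral_mono_of_nonneg (ae_of_all _ fun y => norm_nonneg _)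
          ((integrable_indicator_iff hm).2
            (integrableOn_const (isCompact_closedBall _ _).measure_lt_top.ne))
          (ae_of_all _ fun y => ?_)
        by_cases hy : y ∈ Metric.closedBall (0 : Plane) ρ
        · simpa only [indicator_of_mem hy] using hS y
        · simp only [indicator_of_notMem hy, hρ y (by simpa using hy), norm_zero, le_refl]
    _ = _ := by
        rw [integral_indicator hm, setIntegral_const, smul_eq_mul, mul_comm]

/-- The bound for the velocity generated by a bounded vorticity supported in a ball of
radius `ρ`. -/
noncomputable def velocityConst (ρ : ℝ) : ℝ :=
  singularMass + volume.real (Metric.closedBall (0 : Plane) ρ)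

theorem velocityConst_nonneg (ρ : ℝ) : 0 ≤ velocityConst ρ :=
  add_nonneg singularMass_nonneg measureReal_nonneg

theorem IsHeatMixture.norm_convVelocity_le_of_support (h : IsHeatMixture R γ μ) {f : Plane → ℝ}
    (hf : Integrable f) {S ρ : ℝ} (hS : ∀ y, |f y| ≤ S) (hρ : ∀ x, ρ < ‖x‖ → f x = 0) (x : Plane) :
    ‖convVelocity μ f x‖ ≤ S * velocityConst ρ := by
  refine (h.norm_convVelocity_le hf hS x).trans ?_
  rw [velocityConst, mul_add]
  have := integral_norm_le_of_support (f := f) hS hρ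
  simp only [Real.norm_eq_abs] at this
  linarith

variable {g : Plane → ℝ} {w : ℝ → Plane → ℝ}

theorem fderiv_eq_zero_of_support {f : Plane → ℝ} {ρ : ℝ} (hρ : ∀ x, ρ < ‖x‖ → f x = 0)
    {x : Plane} (hx : ρ < ‖x‖) : fderiv ℝ f x = 0 := by
  have h1 : f =ᶠ[𝓝 x] fun _ => 0 := by
    filter_upwards [(isOpen_lt continuous_const continuous_norm).mem_nhds hx] with y hy
    exact hρ y hy
  rw [h1.fderiv_eq, fderiv_const_apply]

/-! ### Symmetry and positivity of solutions -/

namespace IsSmoothSolution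

theorem exists_fderiv_bound (hw : IsSmoothSolution R γ g w) {T ρ : ℝ}
    (hρ : ∀ t ∈ Icc 0 T, ∀ x, ρ < ‖x‖ → w t x = 0) :
    ∃ M : ℝ, 0 ≤ M ∧ ∀ t ∈ Icc 0 T, ∀ x, ‖fderiv ℝ (w t) x‖ ≤ M := by
  have hK : IsCompact (Icc 0 T ×ˢ Metric.closedBall (0 : Plane) ρ) :=
    isCompact_Icc.prod (isCompact_closedBall _ _)
  obtain ⟨M, hM⟩ := hK.exists_bound_of_continuousOn
    (hw.continuousOn_fderiv.mono fun p hp => ⟨hp.1.1, mem_univ _⟩)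
  refine ⟨max M 0, le_max_right _ _, fun t ht x => ?_⟩
  by_cases hx : ‖x‖ ≤ ρ
  · exact (hM (t, x) ⟨ht, by simpa using hx⟩).trans (le_max_left _ _)
  · rw [fderiv_eq_zero_of_support (hρ t ht) (not_le.1 hx), norm_zero]
    exact le_max_right _ _

/-- Solutions keep the odd symmetry of their initial data. The symmetric part
`v(t, x) = w(t, x) + w(t, σx)` generates the difference of the velocities at `x` and `σx`, of size
at most `C sup |v|`. Hence `v² e^{-2(C+1)t}` has no positive maximum. -/
theorem odd (hw : IsSmoothSolution R γ g w) (h : IsHeatMixture R γ μ)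
    (hg : HasCompactSupport g) {i : Fin 2} (hgi : ∀ x, g (coordReflection i x) = -g x)
    {T : ℝ} (hT : 0 ≤ T) (y : Plane) : w T (coordReflection i y) = -w T y := by
  obtain ⟨ρ, hρ0, hρ⟩ := hw.exists_support_bound h hg T
  obtain ⟨M, hM0, hM⟩ := hw.exists_fderiv_bound hρ
  set σ := coordReflection i with hσ
  let v : ℝ → Plane → ℝ := fun t x => w t x + w t (σ x)
  have hv0 : ∀ t ∈ Icc 0 T, ∀ x, ρ < ‖x‖ → v t x = 0 := by
    intro t ht x hx
    simp only [v]
    rw [hρ t ht x hx, hρ t ht _ (by rwa [LinearIsometryEquiv.norm_map]), add_zero]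
  set C : ℝ := M * velocityConst ρ with hC
  have hC0 : 0 ≤ C := mul_nonneg hM0 (velocityConst_nonneg _)
  let A : Set (ℝ × Plane) := Icc 0 T ×ˢ Metric.closedBall (0 : Plane) (ρ + 1)
  have hA : IsCompact A := isCompact_Icc.prod (isCompact_closedBall _ _)
  have hsub : A ⊆ Ici 0 ×ˢ univ := fun p hp => ⟨hp.1.1, mem_univ _⟩
  let f : ℝ × Plane → ℝ := fun p => v p.1 p.2 ^ 2 * Real.exp (-(2 * (C + 1)) * p.1)
  have hvc : ContinuousOn (fun p : ℝ × Plane => v p.1 p.2) A := by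
    refine (hw.continuousOn.mono hsub).add ?_
    exact hw.continuousOn.comp (f := fun p : ℝ × Plane => (p.1, σ p.2))
      (Continuous.continuousOn (by fun_prop)) fun p hp => ⟨hp.1.1, mem_univ _⟩
  have hf : ContinuousOn f A := (hvc.pow 2).mul (Continuous.continuousOn (by fun_prop))
  have hle := maximum_principle hA hf (c := 0) ?_
  · have hvT : v T y = 0 := by
      by_cases hy : ‖y‖ ≤ ρ
      · have h1 := hle (T, y) ⟨⟨hT, le_rfl⟩, by simpa using hy.trans (by linarith)⟩
        simp only [f] at h1
        have h2 : v T y ^ 2 ≤ 0 := nonpos_of_mul_nonpos_left h1 (Real.exp_pos _)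
        exact pow_eq_zero_iff two_ne_zero |>.1 (le_antisymm h2 (sq_nonneg _))
      · exact hv0 T ⟨hT, le_rfl⟩ y (not_le.1 hy)
    simp only [v] at hvT
    linarith
  · rintro ⟨s, x⟩ ⟨hs, hx⟩ hmax hpos
    have hs' : s ∈ Icc 0 T := hs
    have hvs : v s x ≠ 0 := by
      intro h0
      simp [f, h0] at hpos
    have hxρ : ‖x‖ ≤ ρ := by
      by_contra! hc
      exact hvs (hv0 s hs' x hc)
    have hs0 : 0 < s := by
      rcases hs'.1.eq_or_lt with h0 | h0
      · exfalso
        apply hvs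
        subst h0
        simp only [v]
        rw [hw.initial, hw.initial, hgi, add_neg_cancel]
      · exact h0
    have hSmax : ∀ z, |v s z| ≤ |v s x| := by
      intro z
      by_cases hz : ‖z‖ ≤ ρ
      · have h1 : f (s, z) ≤ f (s, x) := hmax ⟨hs, by simpa using hz.trans (by linarith)⟩
        simp only [f] at h1
        exact sq_le_sq.1 (le_of_mul_le_mul_right h1 (Real.exp_pos _))
      · rw [hv0 s hs' z (not_le.1 hz), abs_zero]
        exact abs_nonneg _
    have hwi := hw.integrable s hs'.1
    have hwi' : Integrable fun z => w s (σ z) :=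
      (σ.measurePreserving.integrable_comp_emb σ.toHomeomorph.measurableEmbedding).2 hwi
    have hvel : convVelocity μ (v s) x = velocity R γ (w s) x - σ (velocity R γ (w s) (σ x)) := by
      obtain ⟨B, hB⟩ := hw.bounded s
      have hB' := (hB s ⟨hs'.1, le_rfl⟩).2
      rw [hw.velocity_eq h hs'.1, hw.velocity_eq h hs'.1, sub_eq_add_neg, hσ,
        ← convVelocity_comp_coordReflection, convVelocity, convVelocity, convVelocity,
        ← integral_add (h.integrable_smul_biotSavart hwi hB' x)
          (h.integrable_smul_biotSavart hwi' (fun y => hB' _) x)]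
      simp only [v, add_smul, hσ]
    have hvelb : ‖convVelocity μ (v s) x‖ ≤ |v s x| * velocityConst ρ :=
      h.norm_convVelocity_le_of_support (hwi.add hwi') hSmax (hv0 s hs') x
    set b := velocity R γ (w s) x with hb
    set dv : ℝ := fderiv ℝ (w s) (σ x) (velocity R γ (w s) (σ x) - σ b) with hdv
    have hdvb : |dv| ≤ C * |v s x| := by
      have h1 : ‖velocity R γ (w s) (σ x) - σ b‖ = ‖convVelocity μ (v s) x‖ := by
        rw [hvel, ← LinearIsometryEquiv.norm_map σ (velocity R γ (w s) (σ x) - σ b), map_sub, hσ,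
          coordReflection_coordReflection, norm_sub_rev]
      calc |dv| ≤ ‖fderiv ℝ (w s) (σ x)‖ * ‖velocity R γ (w s) (σ x) - σ b‖ :=
            ContinuousLinearMap.le_opNorm (fderiv ℝ (w s) (σ x)) _
        _ ≤ M * (|v s x| * velocityConst ρ) := by
            rw [h1]
            exact mul_le_mul (hM s hs' _) hvelb (norm_nonneg _) hM0
        _ = C * |v s x| := by rw [hC]; ring
    -- along the velocity at `x` the first term of `v` is constant, and only `dv` remains
    refine ⟨(1, b), ?_,
      Real.exp (-(2 * (C + 1)) * s) * (2 * v s x * dv + 2 * (C + 1) * v s x ^ 2), ?_, ?_⟩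
    · have hcont : Tendsto (fun t : ℝ => ‖x - t • b‖) (𝓝[>] 0) (𝓝 ‖x - (0 : ℝ) • b‖) :=
        (Continuous.tendsto (by fun_prop) 0).mono_left nhdsWithin_le_nhds
      filter_upwards [Ioo_mem_nhdsGT hs0, hcont.eventually_lt_const
        (show ‖x - (0 : ℝ) • b‖ < ρ + 1 by simpa using hxρ.trans_lt (by linarith))] with τ hτ hτ2
      refine ⟨⟨?_, ?_⟩, ?_⟩
      · simp; linarith [hτ.2]
      · simp; linarith [hτ.1, hs'.2]
      · simpa using hτ2.le
    · refine mul_pos (Real.exp_pos _) ?_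
      have h1 : |v s x * dv| ≤ C * v s x ^ 2 := by
        rw [abs_mul, ← sq_abs (v s x)]
        nlinarith [abs_nonneg (v s x)]
      have h2 := (abs_le.1 h1).1
      have h3 : 0 < v s x ^ 2 := by positivity
      nlinarith
    · have h1 := hw.hasDerivAt_backward hs0 x b
      have h2 := hw.hasDerivAt_backward hs0 (σ x) (σ b)
      rw [hb, sub_self, map_zero, ← hb] at h1
      rw [← hdv] at h2
      have h3 := ((h1.add h2).pow 2).mul
        ((((hasDerivAt_id (0 : ℝ)).const_sub s).const_mul (-(2 * (C + 1)))).exp)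
      refine (h3.congr_deriv ?_).congr_of_eventuallyEq (Eventually.of_forall fun τ => ?_)
      · simp [v]; ring
      · simp [f, v]

/-- Solutions with odd data stay nonnegative on the first quadrant: a negative minimum would lie off
the axes, where `w` vanishes, so the maximum principle applies to `-w - ε t`. -/
theorem nonneg_of_quadrant (hw : IsSmoothSolution R γ g w) (h : IsHeatMixture R γ μ)
    (hg : HasCompactSupport g) (hgi : ∀ i x, g (coordReflection i x) = -g x)
    (hg0 : ∀ x : Plane, 0 ≤ x 0 → 0 ≤ x 1 → 0 ≤ g x) {T : ℝ} (hT : 0 ≤ T) {y : Plane}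
    (hy0 : 0 ≤ y 0) (hy1 : 0 ≤ y 1) : 0 ≤ w T y := by
  obtain ⟨ρ, hρ0, hρ⟩ := hw.exists_support_bound h hg T
  have haxis : ∀ t, 0 ≤ t → ∀ x : Plane, ∀ i, x i = 0 → w t x = 0 := by
    intro t ht x i hi
    have h1 := hw.odd h hg (hgi i) ht x
    have h2 : coordReflection i x = x := by
      ext j
      rw [coordReflection_apply]
      split_ifs with hj
      · rw [hj, hi, neg_zero]
      · rfl
    rw [h2] at h1
    linarith
  by_cases hyρ : ρ < ‖y‖
  · rw [hρ T ⟨hT, le_rfl⟩ y hyρ]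
  let A : Set (ℝ × Plane) := Icc 0 T ×ˢ
    (Metric.closedBall (0 : Plane) (ρ + 1) ∩ {x : Plane | 0 ≤ x 0 ∧ 0 ≤ x 1})
  have hA : IsCompact A := by
    refine isCompact_Icc.prod ((isCompact_closedBall _ _).inter_right ?_)
    exact (isClosed_le continuous_const (continuous_coord 0)).inter
      (isClosed_le continuous_const (continuous_coord 1))
  have hsub : A ⊆ Ici 0 ×ˢ univ := fun p hp => ⟨hp.1.1, mem_univ _⟩
  have key : ∀ ε > 0, -w T y - ε * T ≤ 0 := by
    intro ε hε
    refine maximum_principle hA (f := fun p => -w p.1 p.2 - ε * p.1)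
      ((hw.continuousOn.mono hsub).neg.sub (by fun_prop)) ?_ (T, y)
      ⟨⟨hT, le_rfl⟩, ⟨by simpa using (not_lt.1 hyρ).trans (by linarith), hy0, hy1⟩⟩
    rintro ⟨s, x⟩ ⟨hs, hx, hx0, hx1⟩ - hpos
    have hs' : s ∈ Icc 0 T := hs
    have hwneg : w s x < 0 := by
      have : 0 ≤ ε * s := mul_nonneg hε.le hs'.1
      simp only at hpos
      linarith
    have hs0 : 0 < s := by
      rcases hs'.1.eq_or_lt with h0 | h0
      · exfalso
        subst h0
        rw [hw.initial] at hwneg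
        exact absurd (hg0 x hx0 hx1) (not_le.2 hwneg)
      · exact h0
    have hxρ : ‖x‖ ≤ ρ := by
      by_contra! hc
      rw [hρ s hs' x hc] at hwneg
      exact lt_irrefl _ hwneg
    have hpos' : ∀ i, x i ≠ 0 := fun i hi => by
      rw [haxis s hs'.1 x i hi] at hwneg
      exact lt_irrefl _ hwneg
    have hx0' : 0 < x 0 := lt_of_le_of_ne hx0 (hpos' 0).symm
    have hx1' : 0 < x 1 := lt_of_le_of_ne hx1 (hpos' 1).symm
    set b := velocity R γ (w s) x with hb
    refine ⟨(1, b), ?_, ε, hε, ?_⟩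
    · have hcont : Tendsto (fun t : ℝ => x - t • b) (𝓝[>] 0) (𝓝 x) := by
        have : Tendsto (fun t : ℝ => x - t • b) (𝓝 0) (𝓝 (x - (0 : ℝ) • b)) :=
          Continuous.tendsto (by fun_prop) 0
        simpa using this.mono_left nhdsWithin_le_nhds
      have hopen : {z : Plane | ‖z‖ < ρ + 1 ∧ 0 < z 0 ∧ 0 < z 1} ∈ 𝓝 x := by
        refine IsOpen.mem_nhds ?_ ⟨by linarith, hx0', hx1'⟩
        exact (isOpen_lt continuous_norm continuous_const).inter
          ((isOpen_lt continuous_const (continuous_coord 0)).inter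
            (isOpen_lt continuous_const (continuous_coord 1)))
      filter_upwards [Ioo_mem_nhdsGT hs0, hcont hopen] with τ hτ hτ2
      refine ⟨⟨?_, ?_⟩, ⟨?_, ?_⟩⟩
      · simp; linarith [hτ.2]
      · simp; linarith [hτ.1, hs'.2]
      · simpa using hτ2.1.le
      · exact ⟨hτ2.2.1.le, hτ2.2.2.le⟩
    · have h1 := ((hw.hasDerivAt_backward hs0 x b).neg).sub
          (((hasDerivAt_id (0 : ℝ)).const_sub s).const_mul ε)
      refine (h1.congr_deriv (by simp [hb])).congr_of_eventuallyEq
        (Eventually.of_forall fun τ => ?_)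
      simp
  refine le_of_forall_pos_le_add fun δ hδ => ?_
  have h1 := key (δ / (T + 1)) (div_pos hδ (by linarith))
  have h2 : δ / (T + 1) * T ≤ δ := by
    rw [div_mul_eq_mul_div, div_le_iff₀ (by linarith)]
    nlinarith
  linarith

/-- The velocity is tangential to the coordinate axes. -/
theorem velocity_axis (hw : IsSmoothSolution R γ g w) (h : IsHeatMixture R γ μ)
    (hg : HasCompactSupport g) (hgi : ∀ i x, g (coordReflection i x) = -g x) {t : ℝ} (ht : 0 ≤ t)
    {x : Plane} {i : Fin 2} (hx : x i = 0) : velocity R γ (w t) x i = 0 := by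
  have h1 := convVelocity_comp_coordReflection (μ := μ) (w t) i x
  have h2 : coordReflection i x = x := by
    ext j
    rw [coordReflection_apply]
    split_ifs with hj
    · rw [hj, hx, neg_zero]
    · rfl
  have h3 : ∀ y, w t (coordReflection i y) = -w t y := hw.odd h hg (hgi i) ht
  simp only [h3, h2] at h1
  have h4 : convVelocity μ (fun y => -w t y) x = -convVelocity μ (w t) x := by
    simp only [convVelocity, neg_smul, integral_neg]
  rw [h4, neg_inj] at h1
  have h5 := congrArg (fun z : Plane => z i) h1
  simp only [coordReflection_apply, if_true] at h5
  rw [hw.velocity_eq h ht]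
  linarith

end IsSmoothSolution

end

section

variable {R : Regularization} {γ : ℝ} {μ : Measure ℝ}

/-! ### Grönwall estimates and linear differential equations -/

section Gronwall

variable {E : Type*} [NormedAddCommGroup E] [NormedSpace ℝ E]

theorem norm_le_exp_forward {f f' : ℝ → E} {L a b : ℝ}
    (hf : ∀ t ∈ Icc a b, HasDerivWithinAt f (f' t) (Icc a b) t)
    (hb : ∀ t ∈ Icc a b, ‖f' t‖ ≤ L * ‖f t‖) {t : ℝ} (ht : t ∈ Icc a b) :
    ‖f t‖ ≤ ‖f a‖ * Real.exp (L * (t - a)) := by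
  have h := norm_le_gronwallBound_of_norm_deriv_right_le (f := f) (f' := f') (δ := ‖f a‖) (K := L)
    (ε := 0) (a := a) (b := b) (fun t ht => (hf t ht).continuousWithinAt)
    (fun t ht => (hf t (Ico_subset_Icc_self ht)).mono_of_mem_nhdsWithin
      (Icc_mem_nhdsGE_of_mem ht)) le_rfl
    (fun t ht => by simpa using hb t (Ico_subset_Icc_self ht)) t ht
  rwa [gronwallBound_ε0] at h

/-- Grönwall's inequality, forward and backward in time. -/
theorem norm_le_exp_abs {f f' : ℝ → E} {L T : ℝ}
    (hf : ∀ t ∈ Icc 0 T, HasDerivWithinAt f (f' t) (Icc 0 T) t)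
    (hb : ∀ t ∈ Icc 0 T, ‖f' t‖ ≤ L * ‖f t‖) {s t : ℝ} (hs : s ∈ Icc 0 T) (ht : t ∈ Icc 0 T) :
    ‖f t‖ ≤ ‖f s‖ * Real.exp (L * |t - s|) := by
  rcases le_total s t with hst | hst
  · have hsub : Icc s t ⊆ Icc 0 T := Icc_subset_Icc hs.1 ht.2
    have h := norm_le_exp_forward (fun τ hτ => (hf τ (hsub hτ)).mono hsub)
      (fun τ hτ => hb τ (hsub hτ)) (right_mem_Icc.2 hst)
    rwa [abs_of_nonneg (sub_nonneg.2 hst)]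
  · have hsub : ∀ τ ∈ Icc (-s) (-t), -τ ∈ Icc 0 T := fun τ hτ =>
      ⟨by linarith [hτ.2, ht.1], by linarith [hτ.1, hs.2]⟩
    have h := norm_le_exp_forward (f := fun τ => f (-τ)) (f' := fun τ => -f' (-τ)) (L := L)
      (a := -s) (b := -t) (fun τ hτ => ?_) (fun τ hτ => by
        rw [norm_neg]; exact hb _ (hsub τ hτ)) (right_mem_Icc.2 (by linarith))
    · rw [abs_of_nonpos (sub_nonpos.2 hst)]
      simp only [neg_neg] at h
      convert h using 3
      ring
    · have := (hf (-τ) (hsub τ hτ)).scomp τ ((hasDerivAt_neg τ).hasDerivWithinAt) hsub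
      simpa using! this

/-- A linear equation with continuous bounded coefficients is solvable on the whole interval:
Picard–Lindelöf applies to the field truncated at a radius which the solution never reaches. -/
theorem exists_linear_ode [CompleteSpace E] {a : ℝ → E →L[ℝ] E} {T L : ℝ} (hT : 0 ≤ T)
    (hL : 0 ≤ L) (ha : ContinuousOn a (Icc 0 T)) (hb : ∀ t ∈ Icc 0 T, ‖a t‖ ≤ L) (z₀ : E) :
    ∃ z : ℝ → E, z 0 = z₀ ∧ ∀ t ∈ Icc 0 T, HasDerivWithinAt z (a t (z t)) (Icc 0 T) t := by
  -- the a priori bound of Grönwall's inequality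
  set r : ℝ := ‖z₀‖ * Real.exp (L * T) + 1 with hr
  have hr0 : 0 < r := by positivity
  let c : E → ℝ := fun z => max 0 (min 1 (2 - ‖z‖ / r))
  have hc0 : ∀ z, 0 ≤ c z := fun z => le_max_left _ _
  have hc1 : ∀ z, c z ≤ 1 := fun z => max_le zero_le_one (min_le_left _ _)
  have hcr : ∀ z, c z * ‖z‖ ≤ 2 * r := by
    intro z
    rcases le_total ‖z‖ (2 * r) with hz | hz
    · nlinarith [hc0 z, hc1 z, norm_nonneg z]
    · have : 2 - ‖z‖ / r ≤ 0 := by rw [sub_nonpos, le_div_iff₀ hr0]; exact hz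
      have : c z = 0 := max_eq_left ((min_le_right _ _).trans this)
      rw [this, zero_mul]
      positivity
  have hcl : ∀ x y, |c x - c y| ≤ ‖x - y‖ / r := by
    intro x y
    have h1 : |c x - c y| ≤ |(2 - ‖x‖ / r) - (2 - ‖y‖ / r)| := by
      simp only [c]
      rw [max_comm 0, max_comm 0, min_comm 1, min_comm 1]
      exact (abs_max_sub_max_le_abs _ _ _).trans (abs_inf_sub_inf_le_abs _ _ _)
    refine h1.trans ?_
    have h2 : (2 - ‖x‖ / r) - (2 - ‖y‖ / r) = (‖y‖ - ‖x‖) / r := by ring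
    rw [h2, abs_div, abs_of_pos hr0, norm_sub_rev]
    gcongr
    exact abs_norm_sub_norm_le _ _
  set A : ℝ := L * (2 * r) * T with hA
  have hA0 : 0 ≤ A := by positivity
  set K : ℝ := L * (1 + (‖z₀‖ + A) / r) with hK
  have hK0 : 0 ≤ K := by positivity
  have hfb : ∀ t ∈ Icc 0 T, ∀ z, ‖a t (c z • z)‖ ≤ L * (c z * ‖z‖) := by
    intro t ht z
    refine ((a t).le_opNorm _).trans ?_
    rw [norm_smul, Real.norm_of_nonneg (hc0 z)]
    exact mul_le_mul_of_nonneg_right (hb t ht) (mul_nonneg (hc0 z) (norm_nonneg _))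
  have hPL : IsPicardLindelof (fun t z => a t (c z • z)) (⟨0, left_mem_Icc.2 hT⟩ : Icc 0 T) z₀
      ⟨A, hA0⟩ 0 ⟨L * (2 * r), by positivity⟩ ⟨K, hK0⟩ := by
    constructor
    · intro t ht
      refine LipschitzOnWith.of_dist_le_mul fun x hx y hy => ?_
      rw [dist_eq_norm, dist_eq_norm, ← map_sub]
      have hy' : ‖y‖ ≤ ‖z₀‖ + A := by
        have h1 : ‖y - z₀‖ ≤ A := by
          rw [← dist_eq_norm]
          exact Metric.mem_closedBall.1 hy
        have h2 := norm_add_le (y - z₀) z₀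
        rw [sub_add_cancel] at h2
        linarith
      have h3 : c x • x - c y • y = c x • (x - y) + (c x - c y) • y := by
        rw [smul_sub, sub_smul]; abel
      have h4 : ‖c x • x - c y • y‖ ≤ (1 + (‖z₀‖ + A) / r) * ‖x - y‖ := by
        rw [h3]
        refine (norm_add_le _ _).trans ?_
        rw [norm_smul, norm_smul, Real.norm_of_nonneg (hc0 x), Real.norm_eq_abs]
        calc c x * ‖x - y‖ + |c x - c y| * ‖y‖ ≤ 1 * ‖x - y‖ + ‖x - y‖ / r * (‖z₀‖ + A) := by
              gcongr
              · exact hc1 x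
              · exact hcl x y
          _ = _ := by ring
      refine ((a t).le_opNorm _).trans ?_
      show _ ≤ K * ‖x - y‖
      rw [hK, mul_assoc]
      exact mul_le_mul (hb t ht) h4 (norm_nonneg _) hL
    · intro x _
      exact ha.clm_apply continuousOn_const
    · intro t ht x _
      exact (hfb t ht x).trans (mul_le_mul_of_nonneg_left (hcr x) hL)
    · show L * (2 * r) * max (T - 0) (0 - 0) ≤ A - 0
      rw [sub_zero, sub_zero, sub_zero, max_eq_left hT]
  obtain ⟨z, hz0, hz⟩ := hPL.exists_eq_forall_mem_Icc_hasDerivWithinAt₀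
  refine ⟨z, hz0, fun t ht => ?_⟩
  have h1 := norm_le_exp_forward hz (L := L) (fun t ht => (hfb t ht _).trans (by
    gcongr
    exact mul_le_of_le_one_left (norm_nonneg _) (hc1 _))) ht
  have h2 : ‖z t‖ ≤ r := by
    have h3 : z 0 = z₀ := hz0
    rw [h3] at h1
    refine h1.trans ?_
    rw [hr, sub_zero]
    have := Real.exp_le_exp.2 (mul_le_mul_of_nonneg_left ht.2 hL)
    nlinarith [norm_nonneg z₀]
  have h3 : c (z t) = 1 := by
    have : ‖z t‖ / r ≤ 1 := (div_le_one hr0).2 h2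
    simp only [c]
    rw [min_eq_left (by linarith), max_eq_right zero_le_one]
  simpa only [h3, one_smul] using hz t ht

end Gronwall

/-! ### Regularity of the velocity field -/

/-- A velocity field `u` on `[0, T]` which is continuous, bounded by `U`, and has a continuous,
trace-free gradient `A` bounded by `L`. -/
structure IsRegularField (u : ℝ → Plane → Plane) (A : ℝ → Plane → Plane →L[ℝ] Plane)
    (T L U : ℝ) : Prop where
  bound_nonneg : 0 ≤ U
  grad_bound_nonneg : 0 ≤ L
  continuousOn : ContinuousOn (fun p : ℝ × Plane => u p.1 p.2) (Icc 0 T ×ˢ univ)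
  continuousOn_grad : ContinuousOn (fun p : ℝ × Plane => A p.1 p.2) (Icc 0 T ×ˢ univ)
  hasFDerivAt : ∀ t ∈ Icc 0 T, ∀ x, HasFDerivAt (u t) (A t x) x
  planeTrace_eq_zero : ∀ t ∈ Icc 0 T, ∀ x, planeTrace (A t x) = 0
  norm_le : ∀ t ∈ Icc 0 T, ∀ x, ‖u t x‖ ≤ U
  norm_grad_le : ∀ t ∈ Icc 0 T, ∀ x, ‖A t x‖ ≤ L

variable {g : Plane → ℝ} {w : ℝ → Plane → ℝ}

theorem IsSmoothSolution.exists_isRegularField (hw : IsSmoothSolution R γ g w)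
    (h : IsHeatMixture R γ μ) (hg : HasCompactSupport g) (T : ℝ) :
    ∃ L U : ℝ,
      IsRegularField (fun t => velocity R γ (w t)) (fun t => velocityGrad μ (w t)) T L U := by
  obtain ⟨U, hU0, hU⟩ := hw.exists_velocity_bound h T
  obtain ⟨ρ, hρ0, hρ⟩ := hw.exists_support_bound h hg T
  obtain ⟨M, hM0, hM⟩ := hw.exists_fderiv_bound hρ
  have hsub : Icc 0 T ×ˢ (univ : Set Plane) ⊆ Ici 0 ×ˢ univ := fun p hp => ⟨hp.1.1, mem_univ _⟩
  have hK : IsCompact (Metric.closedBall (0 : Plane) ρ) := isCompact_closedBall _ _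
  have hnot : ∀ x, x ∉ Metric.closedBall (0 : Plane) ρ → ρ < ‖x‖ := fun x hx => by simpa using hx
  have hs : ∀ t ∈ Icc 0 T, HasCompactSupport (w t) := fun t ht =>
    HasCompactSupport.intro hK fun x hx => hρ t ht x (hnot x hx)
  have hvel : ∀ t ∈ Icc 0 T, velocity R γ (w t) = convVelocity μ (w t) := fun t ht =>
    funext fun x => hw.velocity_eq h ht.1 x
  refine ⟨M * velocityConst ρ, U, hU0, mul_nonneg hM0 (velocityConst_nonneg _), ?_, ?_, ?_, ?_, hU,
    ?_⟩
  · have h1 := continuousOn_convolution_right_with_param (L := smulFlip) (g := w) (s := Icc 0 T) hK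
      (fun t x ht hx => hρ t ht x (hnot x hx)) h.locallyIntegrable_biotSavart
      (hw.continuousOn.mono hsub)
    refine h1.congr fun p hp => ?_
    simp only [hvel p.1 hp.1, convVelocity_eq_convolution]
  · exact continuousOn_convolution_right_with_param (L := smulFlip.precompR Plane)
      (g := fun t => fderiv ℝ (w t)) (s := Icc 0 T) hK
      (fun t x ht hx => fderiv_eq_zero_of_support (hρ t ht) (hnot x hx))
      h.locallyIntegrable_biotSavart (hw.continuousOn_fderiv.mono hsub)
  · intro t ht x
    simp only [hvel t ht]
    exact h.hasFDerivAt_convVelocity (hw.contDiff ht.1) (hs t ht) x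
  · intro t ht x
    exact h.planeTrace_velocityGrad (hw.contDiff ht.1) (hs t ht) x
  · intro t ht x
    refine (h.norm_velocityGrad_le (hw.contDiff ht.1) (hs t ht) (hM t ht) x).trans ?_
    have := integral_norm_le_of_support (hM t ht) fun x hx =>
      fderiv_eq_zero_of_support (hρ t ht) hx
    rw [velocityConst, mul_add]
    linarith

end

section

/-! ### Determinants in the plane -/

/-- The determinant of an endomorphism of the plane. -/
noncomputable def planeDet (A : Plane →L[ℝ] Plane) : ℝ :=
  A (EuclideanSpace.single 0 1) 0 * A (EuclideanSpace.single 1 1) 1 -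
    A (EuclideanSpace.single 1 1) 0 * A (EuclideanSpace.single 0 1) 1

theorem apply_coord (A : Plane →L[ℝ] Plane) (v : Plane) (i : Fin 2) :
    A v i = v 0 * A (EuclideanSpace.single 0 1) i + v 1 * A (EuclideanSpace.single 1 1) i := by
  conv_lhs => rw [plane_eq_sum v, map_add, map_smul, map_smul]
  simp

theorem det_eq_planeDet (A : Plane →L[ℝ] Plane) : A.det = planeDet A := by
  rw [ContinuousLinearMap.det, ← LinearMap.det_toMatrix (EuclideanSpace.basisFun (Fin 2) ℝ).toBasis,
    Matrix.det_fin_two]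
  simp [LinearMap.toMatrix_apply, planeDet]

/-- In the plane a matrix of determinant one and its inverse have the same norm; here from
`⟨(Av)^⊥, A v^⊥⟩ = det A |v|²`. -/
theorem norm_le_norm_mul_norm_apply {A : Plane →L[ℝ] Plane} (hA : planeDet A = 1) (v : Plane) :
    ‖v‖ ≤ ‖A‖ * ‖A v‖ := by
  have h1 : ⟪perp (A v), A (perp v)⟫ = ‖v‖ ^ 2 := by
    rw [norm_sq_eq, PiLp.inner_apply, Fin.sum_univ_two]
    simp only [perp_zero_coord, perp_one_coord, RCLike.inner_apply, conj_trivial]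
    rw [apply_coord A (perp v) 0, apply_coord A (perp v) 1, apply_coord A v 0, apply_coord A v 1,
      perp_zero_coord, perp_one_coord]
    rw [planeDet] at hA
    linear_combination (v 0 ^ 2 + v 1 ^ 2) * hA
  have h2 : ‖v‖ ^ 2 ≤ ‖A v‖ * (‖A‖ * ‖v‖) := by
    rw [← h1]
    refine (real_inner_le_norm _ _).trans ?_
    rw [norm_perp]
    gcongr
    exact (A.le_opNorm _).trans_eq (by rw [norm_perp])
  rcases (norm_nonneg v).eq_or_lt with h0 | h0
  · rw [← h0]; positivity
  · nlinarith

theorem one_le_norm_of_planeDet {A : Plane →L[ℝ] Plane} (hA : planeDet A = 1) : 1 ≤ ‖A‖ := by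
  have h1 := norm_le_norm_mul_norm_apply hA (EuclideanSpace.single 0 1)
  have h2 := A.le_opNorm (EuclideanSpace.single 0 1)
  simp only [PiLp.norm_single, norm_one, mul_one] at h1 h2
  nlinarith [norm_nonneg A]

/-- Liouville's formula for a trace-free equation. -/
theorem planeDet_eq_one {a Z : ℝ → Plane →L[ℝ] Plane} {T : ℝ}
    (ha : ∀ t ∈ Icc 0 T, planeTrace (a t) = 0) (hZ0 : Z 0 = ContinuousLinearMap.id ℝ Plane)
    (hZ : ∀ t ∈ Icc 0 T, HasDerivWithinAt Z ((a t).comp (Z t)) (Icc 0 T) t) {t : ℝ}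
    (ht : t ∈ Icc 0 T) : planeDet (Z t) = 1 := by
  have hc : ∀ t ∈ Icc 0 T, ∀ (v : Plane) (i : Fin 2),
      HasDerivWithinAt (fun s => Z s v i) (a t (Z t v) i) (Icc 0 T) t := by
    intro t ht v i
    have h1 := (ContinuousLinearMap.apply ℝ Plane v).hasFDerivAt.comp_hasDerivWithinAt t (hZ t ht)
    exact (EuclideanSpace.proj (𝕜 := ℝ) i).hasFDerivAt.comp_hasDerivWithinAt t h1
  have hd : ∀ t ∈ Icc 0 T, HasDerivWithinAt (fun s => planeDet (Z s) - 1) 0 (Icc 0 T) t := by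
    intro t ht
    have h1 := (((hc t ht (EuclideanSpace.single 0 1) 0).mul
      (hc t ht (EuclideanSpace.single 1 1) 1)).sub
      ((hc t ht (EuclideanSpace.single 1 1) 0).mul
        (hc t ht (EuclideanSpace.single 0 1) 1))).sub_const 1
    refine h1.congr_deriv ?_
    have h2 := ha t ht
    rw [planeTrace] at h2
    simp only [apply_coord (a t) (Z t _)]
    linear_combination (Z t (EuclideanSpace.single 0 1) 0 * Z t (EuclideanSpace.single 1 1) 1 -
      Z t (EuclideanSpace.single 1 1) 0 * Z t (EuclideanSpace.single 0 1) 1) * h2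
  have h2 := norm_le_exp_forward hd (L := 0) (fun t _ => by simp) ht
  have h3 : planeDet (Z 0) = 1 := by
    rw [hZ0]; simp [planeDet]
  rw [h3, sub_self, norm_zero, zero_mul, norm_le_zero_iff] at h2
  linarith

/-! ### Flows of regular fields -/

/-- `φ` is the flow on `[0, T]` of the time-dependent field `u`. -/
structure IsFlow (u : ℝ → Plane → Plane) (φ : ℝ → Plane → Plane) (T : ℝ) : Prop where
  initial : ∀ x, φ 0 x = x
  ode : ∀ t ∈ Icc 0 T, ∀ x, HasDerivWithinAt (fun s => φ s x) (u t (φ t x)) (Icc 0 T) t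

variable {u : ℝ → Plane → Plane} {A : ℝ → Plane → Plane →L[ℝ] Plane} {T L U : ℝ}
  {φ : ℝ → Plane → Plane}

theorem IsRegularField.norm_sub_le (hu : IsRegularField u A T L U) {t : ℝ} (ht : t ∈ Icc 0 T)
    (x y : Plane) : ‖u t x - u t y‖ ≤ L * ‖x - y‖ :=
  convex_univ.norm_image_sub_le_of_norm_hasFDerivWithin_le
    (fun z _ => (hu.hasFDerivAt t ht z).hasFDerivWithinAt) (fun z _ => hu.norm_grad_le t ht z)
    (mem_univ y) (mem_univ x)

namespace IsFlow

theorem continuousOn (hφ : IsFlow u φ T) (x : Plane) : ContinuousOn (fun s => φ s x) (Icc 0 T) :=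
  fun t ht => (hφ.ode t ht x).continuousWithinAt

theorem norm_sub_le (hφ : IsFlow u φ T) (hu : IsRegularField u A T L U) {s t : ℝ}
    (hs : s ∈ Icc 0 T) (ht : t ∈ Icc 0 T) (x y : Plane) :
    ‖φ t x - φ t y‖ ≤ ‖φ s x - φ s y‖ * Real.exp (L * |t - s|) :=
  norm_le_exp_abs (f := fun t => φ t x - φ t y) (fun t ht => (hφ.ode t ht x).sub (hφ.ode t ht y))
    (fun _ ht => hu.norm_sub_le ht _ _) hs ht

theorem injective (hφ : IsFlow u φ T) (hu : IsRegularField u A T L U) {t : ℝ} (ht : t ∈ Icc 0 T) :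
    Function.Injective (φ t) := by
  intro x y hxy
  have h1 := hφ.norm_sub_le hu ht (left_mem_Icc.2 (ht.1.trans ht.2)) x y
  rw [hxy, sub_self, norm_zero, zero_mul, hφ.initial, hφ.initial] at h1
  exact sub_eq_zero.1 (norm_le_zero_iff.1 h1)

/-- A point `y` is reached from the value at time `0` of the solution which passes through `y` at
time `t`. -/
theorem surjective (hφ : IsFlow u φ T) (hu : IsRegularField u A T L U) {t : ℝ}
    (ht : t ∈ Icc 0 T) : Function.Surjective (φ t) := by
  intro y
  have hsub : Icc 0 t ⊆ Icc 0 T := Icc_subset_Icc_right ht.2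
  have hPL : IsPicardLindelof u (⟨t, right_mem_Icc.2 ht.1⟩ : Icc 0 t) y
      ⟨U * t, mul_nonneg hu.bound_nonneg ht.1⟩ 0 ⟨U, hu.bound_nonneg⟩
      ⟨L, hu.grad_bound_nonneg⟩ := by
    constructor
    · intro s hs
      refine LipschitzOnWith.of_dist_le_mul fun x _ z _ => ?_
      rw [dist_eq_norm, dist_eq_norm]
      exact hu.norm_sub_le (hsub hs) x z
    · intro x _
      exact hu.continuousOn.comp (f := fun s : ℝ => (s, x)) (by fun_prop)
        fun s hs => ⟨hsub hs, mem_univ _⟩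
    · exact fun s hs x _ => hu.norm_le s (hsub hs) x
    · show U * max (t - t) (t - 0) ≤ U * t - 0
      rw [sub_self, sub_zero, sub_zero, max_eq_right ht.1]
  obtain ⟨α, hα0, hα⟩ := hPL.exists_eq_forall_mem_Icc_hasDerivWithinAt₀
  refine ⟨α 0, ?_⟩
  have h1 := norm_le_exp_forward (f := fun s => φ s (α 0) - α s) (L := L) (a := 0) (b := t)
    (fun s hs => ((hφ.ode s (hsub hs) (α 0)).mono hsub).sub (hα s hs))
    (fun s hs => hu.norm_sub_le (hsub hs) _ _) (right_mem_Icc.2 ht.1)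
  simp only [hφ.initial, sub_self, norm_zero, zero_mul] at h1
  have h2 : α t = y := hα0
  rw [← h2]
  exact sub_eq_zero.1 (norm_le_zero_iff.1 h1)

/-- The flow is differentiable, with a derivative `Z` of determinant one: `Z` is the solution of the
linearized equation, and Grönwall's inequality bounds `φ(x + h) - φ(x) - Z h` by a small multiple of
`|h|`. -/
theorem exists_hasFDerivAt (hφ : IsFlow u φ T) (hu : IsRegularField u A T L U) (hT : 0 ≤ T)
    (x : Plane) : ∃ Z : ℝ → Plane →L[ℝ] Plane, (∀ t ∈ Icc 0 T, HasFDerivAt (φ t) (Z t) x) ∧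
      ∀ t ∈ Icc 0 T, planeDet (Z t) = 1 := by
  have hL := hu.grad_bound_nonneg
  have hac : ContinuousOn (fun t => A t (φ t x)) (Icc 0 T) :=
    hu.continuousOn_grad.comp (f := fun t => (t, φ t x))
      (continuousOn_id.prodMk (hφ.continuousOn x))
      fun t ht => ⟨ht, mem_univ _⟩
  obtain ⟨Z, hZ0, hZ⟩ := exists_linear_ode
    (a := fun t => ContinuousLinearMap.compL ℝ Plane Plane Plane (A t (φ t x))) hT hL
    ((ContinuousLinearMap.compL ℝ Plane Plane Plane).continuous.comp_continuousOn hac)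
    (fun t ht => ((ContinuousLinearMap.compL ℝ Plane Plane Plane).le_opNorm _).trans <|
      (mul_le_of_le_one_left (norm_nonneg _) (ContinuousLinearMap.norm_compL_le _ _ _ _)).trans
        (hu.norm_grad_le t ht _))
    (ContinuousLinearMap.id ℝ Plane)
  have hZ' : ∀ t ∈ Icc 0 T, HasDerivWithinAt Z ((A t (φ t x)).comp (Z t)) (Icc 0 T) t := hZ
  refine ⟨Z, fun t ht => ?_, fun t ht =>
    planeDet_eq_one (fun t ht => hu.planeTrace_eq_zero t ht _) hZ0 hZ' ht⟩
  rw [hasFDerivAt_iff_isLittleO_nhds_zero, Asymptotics.isLittleO_iff]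
  intro c hc
  obtain ⟨B, hB⟩ := isCompact_Icc.exists_bound_of_continuousOn (hφ.continuousOn x)
  set E : ℝ := Real.exp (L * T) with hE
  have hE0 : 0 < E := Real.exp_pos _
  set F : ℝ := Real.exp ((L + 1) * T) with hF
  have hF0 : 0 < F := Real.exp_pos _
  set ε : ℝ := c / (E * F) with hε
  have hε0 : 0 < ε := by positivity
  have hK : IsCompact (Icc 0 T ×ˢ Metric.closedBall (0 : Plane) (B + 1)) :=
    isCompact_Icc.prod (isCompact_closedBall _ _)
  have huc := hK.uniformContinuousOn_of_continuous
    (hu.continuousOn_grad.mono fun p hp => ⟨hp.1, mem_univ _⟩)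
  rw [Metric.uniformContinuousOn_iff_le] at huc
  obtain ⟨δ, hδ0, hδ⟩ := huc ε hε0
  have hδ' : 0 < min δ 1 := lt_min hδ0 one_pos
  have hgrad : ∀ s ∈ Icc 0 T, ∀ y ∈ Metric.closedBall (φ s x) (min δ 1),
      ‖A s y - A s (φ s x)‖ ≤ ε := by
    intro s hs y hy
    rw [mem_closedBall_iff_norm] at hy
    have h1 := hB s hs
    have h2 : ‖y‖ ≤ B + 1 := by
      have := norm_add_le (y - φ s x) (φ s x)
      rw [sub_add_cancel] at this
      linarith [min_le_right δ 1]
    have h3 := hδ (s, y) ⟨hs, by simpa using h2⟩ (s, φ s x) ⟨hs, by simp; linarith⟩ (by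
      rw [Prod.dist_eq, dist_self, dist_eq_norm]
      exact max_le hδ0.le (hy.trans (min_le_left _ _)))
    rwa [dist_eq_norm] at h3
  have hnhds : {h : Plane | ‖h‖ * E < min δ 1} ∈ 𝓝 (0 : Plane) :=
    (isOpen_lt (by fun_prop) continuous_const).mem_nhds (by simpa using hδ')
  filter_upwards [hnhds] with h hh
  have hh : ‖h‖ * E < min δ 1 := hh
  have hdist : ∀ s ∈ Icc 0 T, ‖φ s (x + h) - φ s x‖ ≤ ‖h‖ * E := by
    intro s hs
    have h1 := hφ.norm_sub_le hu (left_mem_Icc.2 hT) hs (x + h) x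
    rw [hφ.initial, hφ.initial, add_sub_cancel_left, sub_zero, abs_of_nonneg hs.1] at h1
    refine h1.trans ?_
    rw [hE]
    gcongr
    exact hs.2
  have hder : ∀ s ∈ Icc 0 T, HasDerivWithinAt (fun s => φ s (x + h) - φ s x - Z s h)
      (u s (φ s (x + h)) - u s (φ s x) - A s (φ s x) (Z s h)) (Icc 0 T) s := fun s hs =>
    ((hφ.ode s hs (x + h)).sub (hφ.ode s hs x)).sub
      ((ContinuousLinearMap.apply ℝ Plane h).hasFDerivAt.comp_hasDerivWithinAt s (hZ' s hs))
  -- `L + 1` in place of `L` keeps the rate in Grönwall's bound different from zero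
  have hbd : ∀ s ∈ Icc 0 T, ‖u s (φ s (x + h)) - u s (φ s x) - A s (φ s x) (Z s h)‖ ≤
      (L + 1) * ‖φ s (x + h) - φ s x - Z s h‖ + ε * (‖h‖ * E) := by
    intro s hs
    have h1 : u s (φ s (x + h)) - u s (φ s x) - A s (φ s x) (Z s h) =
        (u s (φ s (x + h)) - u s (φ s x) - A s (φ s x) (φ s (x + h) - φ s x)) +
        A s (φ s x) (φ s (x + h) - φ s x - Z s h) := by
      rw [map_sub (A s (φ s x)) (φ s (x + h) - φ s x)]; abel
    have h2 : ‖u s (φ s (x + h)) - u s (φ s x) - A s (φ s x) (φ s (x + h) - φ s x)‖ ≤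
        ε * ‖φ s (x + h) - φ s x‖ :=
      (convex_closedBall (φ s x) (min δ 1)).norm_image_sub_le_of_norm_hasFDerivWithin_le'
        (fun z _ => (hu.hasFDerivAt s hs z).hasFDerivWithinAt) (hgrad s hs)
        (Metric.mem_closedBall_self hδ'.le)
        (mem_closedBall_iff_norm.2 ((hdist s hs).trans hh.le))
    have h3 : ‖A s (φ s x) (φ s (x + h) - φ s x - Z s h)‖ ≤
        L * ‖φ s (x + h) - φ s x - Z s h‖ :=
      (ContinuousLinearMap.le_opNorm _ _).trans
        (mul_le_mul_of_nonneg_right (hu.norm_grad_le s hs _) (norm_nonneg _))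
    have h4 := mul_le_mul_of_nonneg_left (hdist s hs) hε0.le
    have h5 := norm_nonneg (φ s (x + h) - φ s x - Z s h)
    rw [h1]
    refine (norm_add_le _ _).trans ?_
    linarith
  have hgr := norm_le_gronwallBound_of_norm_deriv_right_le (δ := 0) (K := L + 1)
    (ε := ε * (‖h‖ * E)) (a := 0) (b := T) (fun s hs => (hder s hs).continuousWithinAt)
    (fun s hs => (hder s (Ico_subset_Icc_self hs)).mono_of_mem_nhdsWithin
      (Icc_mem_nhdsGE_of_mem hs)) (by simp [hφ.initial, hZ0])
    (fun s hs => hbd s (Ico_subset_Icc_self hs)) t ht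
  refine hgr.trans ?_
  rw [gronwallBound_of_K_ne_0 (by positivity)]
  have h1 : Real.exp ((L + 1) * (t - 0)) - 1 ≤ F := by
    have : Real.exp ((L + 1) * (t - 0)) ≤ F := by
      rw [hF, sub_zero]
      gcongr
      exact ht.2
    linarith
  have h2 : ε * (‖h‖ * E) / (L + 1) ≤ ε * (‖h‖ * E) := div_le_self (by positivity) (by linarith)
  calc 0 * Real.exp ((L + 1) * (t - 0)) + ε * (‖h‖ * E) / (L + 1) *
        (Real.exp ((L + 1) * (t - 0)) - 1) ≤ 0 + ε * (‖h‖ * E) * F := by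
        rw [zero_mul]
        gcongr
        rw [sub_nonneg]
        exact Real.one_le_exp (mul_nonneg (by linarith) (by linarith [ht.1]))
    _ = c * ‖h‖ := by
        rw [hε]
        field_simp
        ring

end IsFlow

end

section

variable {u : ℝ → Plane → Plane} {A : ℝ → Plane → Plane →L[ℝ] Plane} {T L U : ℝ}
  {φ : ℝ → Plane → Plane}

namespace IsFlow

/-! ### The deformation norm of a flow -/

theorem differentiable (hφ : IsFlow u φ T) (hu : IsRegularField u A T L U) {t : ℝ}
    (ht : t ∈ Icc 0 T) : Differentiable ℝ (φ t) := fun x => by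
  obtain ⟨Z, hZ, -⟩ := hφ.exists_hasFDerivAt hu (ht.1.trans ht.2) x
  exact (hZ t ht).differentiableAt

theorem planeDet_fderiv (hφ : IsFlow u φ T) (hu : IsRegularField u A T L U) {t : ℝ}
    (ht : t ∈ Icc 0 T) (x : Plane) : planeDet (fderiv ℝ (φ t) x) = 1 := by
  obtain ⟨Z, hZ, hdet⟩ := hφ.exists_hasFDerivAt hu (ht.1.trans ht.2) x
  rw [(hZ t ht).fderiv]
  exact hdet t ht

theorem norm_fderiv_le_of_lipschitz (hφ : IsFlow u φ T) (hu : IsRegularField u A T L U) {t : ℝ}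
    (ht : t ∈ Icc 0 T) {C : ℝ} (hC : 0 ≤ C) (h : ∀ x y, ‖φ t x - φ t y‖ ≤ C * ‖x - y‖)
    (x : Plane) : ‖fderiv ℝ (φ t) x‖ ≤ C :=
  (hφ.differentiable hu ht x).hasFDerivAt.le_of_lip' hC (Eventually.of_forall fun y => h y x)

theorem bddAbove_norm_fderiv (hφ : IsFlow u φ T) (hu : IsRegularField u A T L U) {t : ℝ}
    (ht : t ∈ Icc 0 T) : BddAbove (range fun x => ‖fderiv ℝ (φ t) x‖) := by
  refine ⟨Real.exp (L * |t - 0|), ?_⟩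
  rintro _ ⟨x, rfl⟩
  refine hφ.norm_fderiv_le_of_lipschitz hu ht (Real.exp_pos _).le (fun x y => ?_) x
  have := hφ.norm_sub_le hu (left_mem_Icc.2 (ht.1.trans ht.2)) ht x y
  rwa [hφ.initial, hφ.initial, mul_comm] at this

theorem norm_fderiv_le (hφ : IsFlow u φ T) (hu : IsRegularField u A T L U) {t : ℝ}
    (ht : t ∈ Icc 0 T) (x : Plane) : ‖fderiv ℝ (φ t) x‖ ≤ deformationNorm (φ t) :=
  le_ciSup (hφ.bddAbove_norm_fderiv hu ht) x

theorem one_le_deformationNorm (hφ : IsFlow u φ T) (hu : IsRegularField u A T L U) {t : ℝ}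
    (ht : t ∈ Icc 0 T) : 1 ≤ deformationNorm (φ t) :=
  (one_le_norm_of_planeDet (hφ.planeDet_fderiv hu ht 0)).trans (hφ.norm_fderiv_le hu ht 0)

theorem norm_sub_le_deformationNorm (hφ : IsFlow u φ T) (hu : IsRegularField u A T L U) {t : ℝ}
    (ht : t ∈ Icc 0 T) (x y : Plane) :
    ‖φ t x - φ t y‖ ≤ deformationNorm (φ t) * ‖x - y‖ :=
  convex_univ.norm_image_sub_le_of_norm_fderiv_le (𝕜 := ℝ)
    (fun z _ => hφ.differentiable hu ht z) (fun z _ => hφ.norm_fderiv_le hu ht z)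
    (mem_univ y) (mem_univ x)

theorem deformationNorm_le (hφ : IsFlow u φ T) (hu : IsRegularField u A T L U) {s t : ℝ}
    (hs : s ∈ Icc 0 T) (ht : t ∈ Icc 0 T) :
    deformationNorm (φ t) ≤ deformationNorm (φ s) * Real.exp (L * |t - s|) := by
  have h0 : 0 ≤ deformationNorm (φ s) := zero_le_one.trans (hφ.one_le_deformationNorm hu hs)
  refine ciSup_le fun x => hφ.norm_fderiv_le_of_lipschitz hu ht (by positivity) (fun x y => ?_) x
  refine (hφ.norm_sub_le hu hs ht x y).trans ?_
  rw [mul_right_comm]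
  gcongr
  exact hφ.norm_sub_le_deformationNorm hu hs x y

theorem continuousOn_deformationNorm (hφ : IsFlow u φ T) (hu : IsRegularField u A T L U) :
    ContinuousOn (fun t => deformationNorm (φ t)) (Icc 0 T) := by
  intro s hs
  have h1 : Tendsto (fun t => deformationNorm (φ s) * Real.exp (L * |t - s|)) (𝓝[Icc 0 T] s)
      (𝓝 (deformationNorm (φ s))) := by
    have : Continuous fun t => deformationNorm (φ s) * Real.exp (L * |t - s|) := by fun_prop
    simpa using (this.tendsto s).mono_left (nhdsWithin_le_nhds (s := Icc 0 T))
  have h2 : Tendsto (fun t => deformationNorm (φ s) * Real.exp (-(L * |t - s|))) (𝓝[Icc 0 T] s)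
      (𝓝 (deformationNorm (φ s))) := by
    have : Continuous fun t => deformationNorm (φ s) * Real.exp (-(L * |t - s|)) := by fun_prop
    simpa using (this.tendsto s).mono_left (nhdsWithin_le_nhds (s := Icc 0 T))
  refine tendsto_of_tendsto_of_tendsto_of_le_of_le' h2 h1 ?_ ?_
  · filter_upwards [self_mem_nhdsWithin] with t ht
    have := hφ.deformationNorm_le hu ht hs
    rw [Real.exp_neg, ← div_eq_mul_inv, div_le_iff₀ (Real.exp_pos _), abs_sub_comm]
    exact this
  · filter_upwards [self_mem_nhdsWithin] with t ht
    exact hφ.deformationNorm_le hu hs ht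

/-- The inverse of an area preserving planar flow has the same Lipschitz constant as the flow. -/
theorem norm_sub_le_mul_norm_image_sub (hφ : IsFlow u φ T) (hu : IsRegularField u A T L U) {t : ℝ}
    (ht : t ∈ Icc 0 T) (x y : Plane) :
    ‖x - y‖ ≤ deformationNorm (φ t) * ‖φ t x - φ t y‖ := by
  have hT : 0 ≤ T := ht.1.trans ht.2
  have hinj := hφ.injective hu ht
  let e : Plane ≃ Plane := Equiv.ofBijective (φ t) ⟨hinj, hφ.surjective hu ht⟩
  have he : ∀ z, φ t (e.symm z) = z := fun z => e.apply_symm_apply z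
  have hlip : ∀ z z', ‖e.symm z - e.symm z'‖ ≤ Real.exp (L * T) * ‖z - z'‖ := by
    intro z z'
    have h1 := hφ.norm_sub_le hu ht (left_mem_Icc.2 hT) (e.symm z) (e.symm z')
    rw [hφ.initial, hφ.initial, he, he, zero_sub, abs_neg, abs_of_nonneg ht.1, mul_comm] at h1
    refine h1.trans ?_
    gcongr
    · exact hu.grad_bound_nonneg
    · exact ht.2
  have hcont : Continuous e.symm :=
    (LipschitzWith.of_dist_le_mul (K := ⟨Real.exp (L * T), (Real.exp_pos _).le⟩) fun z z' => by
      rw [dist_eq_norm, dist_eq_norm]; exact hlip z z').continuous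
  have hder : ∀ z, ∃ B : Plane →L[ℝ] Plane, HasFDerivAt e.symm B z ∧
      ‖B‖ ≤ deformationNorm (φ t) := by
    intro z
    set Z := fderiv ℝ (φ t) (e.symm z) with hZ
    have hdet : planeDet Z = 1 := hφ.planeDet_fderiv hu ht _
    have hdet' : Z.det ≠ 0 := by rw [det_eq_planeDet, hdet]; exact one_ne_zero
    let f' := Z.toContinuousLinearEquivOfDetNeZero hdet'
    have hf' : ∀ v, Z (f'.symm v) = v := fun v => f'.apply_symm_apply v
    refine ⟨(f'.symm : Plane →L[ℝ] Plane), ?_, ?_⟩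
    · refine HasFDerivAt.of_local_left_inverse (f := φ t) (f' := f') hcont.continuousAt ?_
        (Eventually.of_forall he)
      exact (hφ.differentiable hu ht (e.symm z)).hasFDerivAt
    · refine ContinuousLinearMap.opNorm_le_bound _
        (zero_le_one.trans (hφ.one_le_deformationNorm hu ht)) fun v => ?_
      have h1 := norm_le_norm_mul_norm_apply hdet (f'.symm v)
      rw [hf'] at h1
      refine h1.trans ?_
      gcongr
      exact hφ.norm_fderiv_le hu ht _
  choose B hB hBn using hder
  have h1 := convex_univ.norm_image_sub_le_of_norm_hasFDerivWithin_le
    (fun z _ => (hB z).hasFDerivWithinAt) (fun z _ => hBn z) (mem_univ (φ t y)) (mem_univ (φ t x))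
  have h2 : ∀ z, e.symm (φ t z) = z := fun z => e.symm_apply_apply z
  rwa [h2, h2] at h1

/-! ### Flows which preserve the coordinate axes -/

/-- The `i`-th velocity component vanishes on the axis `x i = 0`, so it is at most `L |x i|`. -/
theorem abs_coord_le (hφ : IsFlow u φ T) (hu : IsRegularField u A T L U)
    (haxis : ∀ t ∈ Icc 0 T, ∀ x : Plane, ∀ i, x i = 0 → u t x i = 0) {s t : ℝ} (hs : s ∈ Icc 0 T)
    (ht : t ∈ Icc 0 T) (x : Plane) (i : Fin 2) :
    |φ t x i| ≤ |φ s x i| * Real.exp (L * |t - s|) := by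
  have hd : ∀ t ∈ Icc 0 T, HasDerivWithinAt (fun s => φ s x i) (u t (φ t x) i) (Icc 0 T) t :=
    fun t ht => (EuclideanSpace.proj (𝕜 := ℝ) i).hasFDerivAt.comp_hasDerivWithinAt t (hφ.ode t ht x)
  refine norm_le_exp_abs hd (fun t ht => ?_) hs ht
  set z := φ t x
  set z' : Plane := z - z i • EuclideanSpace.single i 1 with hz'
  have h1 : u t z' i = 0 := haxis t ht z' i (by simp [hz'])
  have h2 := hu.norm_sub_le ht z z'
  have h3 : ‖z - z'‖ = |z i| := by
    rw [hz', sub_sub_cancel, norm_smul, PiLp.norm_single, norm_one, mul_one, Real.norm_eq_abs]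
  have h4 := abs_coord_le_norm (u t z - u t z') i
  rw [PiLp.sub_apply, h1, sub_zero] at h4
  rw [h3] at h2
  exact h4.trans h2

theorem coord_eq_zero_iff (hφ : IsFlow u φ T) (hu : IsRegularField u A T L U)
    (haxis : ∀ t ∈ Icc 0 T, ∀ x : Plane, ∀ i, x i = 0 → u t x i = 0) {t : ℝ}
    (ht : t ∈ Icc 0 T) (x : Plane) (i : Fin 2) : φ t x i = 0 ↔ x i = 0 := by
  have h0 : (0 : ℝ) ∈ Icc 0 T := left_mem_Icc.2 (ht.1.trans ht.2)
  constructor <;> intro h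
  · have h1 := hφ.abs_coord_le hu haxis ht h0 x i
    rw [h, abs_zero, zero_mul, hφ.initial] at h1
    exact abs_nonpos_iff.1 h1
  · have h1 := hφ.abs_coord_le hu haxis h0 ht x i
    rw [hφ.initial, h, abs_zero, zero_mul] at h1
    exact abs_nonpos_iff.1 h1

theorem coord_pos (hφ : IsFlow u φ T) (hu : IsRegularField u A T L U)
    (haxis : ∀ t ∈ Icc 0 T, ∀ x : Plane, ∀ i, x i = 0 → u t x i = 0) {t : ℝ}
    (ht : t ∈ Icc 0 T) {x : Plane} {i : Fin 2} (hx : 0 < x i) : 0 < φ t x i := by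
  by_contra! hc
  have hsub : Icc 0 t ⊆ Icc 0 T := Icc_subset_Icc_right ht.2
  have hcont : ContinuousOn (fun s => φ s x i) (Icc 0 t) :=
    (continuous_coord i).comp_continuousOn ((hφ.continuousOn x).mono hsub)
  obtain ⟨s, hs, hs0⟩ := intermediate_value_Icc' ht.1 hcont
    (show (0 : ℝ) ∈ Icc (φ t x i) (φ 0 x i) from ⟨hc, by rw [hφ.initial]; exact hx.le⟩)
  exact hx.ne' ((hφ.coord_eq_zero_iff hu haxis (hsub hs) x i).1 hs0)

/-- The distance to an invariant axis shrinks at most by the Lipschitz constant of the inverse flow: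
the foot of the perpendicular from `φ t x` is the image of a point of the axis. -/
theorem coord_le (hφ : IsFlow u φ T) (hu : IsRegularField u A T L U)
    (haxis : ∀ t ∈ Icc 0 T, ∀ x : Plane, ∀ i, x i = 0 → u t x i = 0) {t : ℝ}
    (ht : t ∈ Icc 0 T) {x : Plane} {i : Fin 2} (hx : 0 < x i) :
    x i ≤ deformationNorm (φ t) * φ t x i := by
  have hpos := hφ.coord_pos hu haxis ht hx
  set z := φ t x with hz
  obtain ⟨y, hy⟩ := hφ.surjective hu ht (z - z i • EuclideanSpace.single i 1)
  have hyi : y i = 0 := (hφ.coord_eq_zero_iff hu haxis ht y i).1 (by rw [hy]; simp)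
  have h1 := hφ.norm_sub_le_mul_norm_image_sub hu ht x y
  rw [hy, ← hz, sub_sub_cancel, norm_smul, PiLp.norm_single, norm_one, mul_one,
    Real.norm_of_nonneg hpos.le] at h1
  have h2 := abs_coord_le_norm (x - y) i
  rw [PiLp.sub_apply, hyi, sub_zero, abs_of_pos hx] at h2
  exact h2.trans h1

theorem norm_le (hφ : IsFlow u φ T) (hu : IsRegularField u A T L U)
    (haxis : ∀ t ∈ Icc 0 T, ∀ x : Plane, ∀ i, x i = 0 → u t x i = 0) {t : ℝ}
    (ht : t ∈ Icc 0 T) (x : Plane) : ‖φ t x‖ ≤ deformationNorm (φ t) * ‖x‖ := by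
  have h0 : φ t 0 = 0 := by
    ext i
    exact (hφ.coord_eq_zero_iff hu haxis ht 0 i).2 rfl
  simpa [h0] using hφ.norm_sub_le_deformationNorm hu ht x 0

end IsFlow

/-! ### Characteristics of a smooth solution -/

variable {R : Regularization} {γ : ℝ} {μ : Measure ℝ} {g : Plane → ℝ} {w : ℝ → Plane → ℝ}

theorem IsCharacteristicFlow.isFlow (hφ : IsCharacteristicFlow R γ w φ) (T : ℝ) :
    IsFlow (fun t => velocity R γ (w t)) φ T :=
  ⟨hφ.initial, fun t ht x => (hφ.ode t ht.1 x).mono Icc_subset_Ici_self⟩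

/-- The vorticity is constant along characteristics. -/
theorem IsSmoothSolution.apply_flow (hw : IsSmoothSolution R γ g w)
    (hφ : IsCharacteristicFlow R γ w φ) {t : ℝ} (ht : 0 ≤ t) (x : Plane) :
    w t (φ t x) = g x := by
  have hd : ∀ s ∈ Icc 0 t, HasDerivWithinAt (fun s => w s (φ s x) - g x) 0 (Icc 0 t) s := by
    intro s hs
    have h1 := (hw.hasFDerivWithinAt hs.1 (φ s x)).comp_hasDerivWithinAt (f := fun s => (s, φ s x))
      (s := Ici 0) s ((hasDerivWithinAt_id s (Ici 0)).prodMk (hφ.ode s hs.1 x))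
      fun τ hτ => ⟨hτ, mem_univ _⟩
    refine ((h1.sub_const (g x)).mono Icc_subset_Ici_self).congr_deriv ?_
    simp
  have h1 := norm_le_exp_forward hd (L := 0) (fun t _ => by simp) (right_mem_Icc.2 ht)
  rw [hφ.initial, hw.initial, sub_self, norm_zero, zero_mul, norm_le_zero_iff] at h1
  linarith

end

section

variable {R : Regularization} {γ : ℝ} {μ : Measure ℝ} {g : Plane → ℝ} {w : ℝ → Plane → ℝ}
  {φ : ℝ → Plane → Plane}

/-! ### The velocity on the axis -/

/-- The open first quadrant. -/
def quadrant : Set Plane := {x : Plane | 0 < x 0 ∧ 0 < x 1}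

theorem isOpen_quadrant : IsOpen quadrant :=
  (isOpen_lt continuous_const (continuous_coord 0)).inter
    (isOpen_lt continuous_const (continuous_coord 1))

theorem norm_sub_sq (x y : Plane) (hx : x 1 = 0) :
    ‖x - y‖ ^ 2 = (x 0 - y 0) ^ 2 + y 1 ^ 2 := by
  rw [norm_sq_eq, PiLp.sub_apply, PiLp.sub_apply, hx]; ring

theorem norm_sub_coordReflection_sq (x y : Plane) (hx : x 1 = 0) :
    ‖x - coordReflection 0 y‖ ^ 2 = (x 0 + y 0) ^ 2 + y 1 ^ 2 := by
  rw [norm_sub_sq x _ hx, coordReflection_apply, coordReflection_apply]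
  simp

/-- The integrand of the first velocity component at a point `x` of the first axis, after folding
the plane along the second axis. -/
noncomputable def foldedIntegrand (μ : Measure ℝ) (f : Plane → ℝ) (x y : Plane) : ℝ :=
  f y * y 1 * (radialKernel μ (‖x - y‖ ^ 2) - radialKernel μ (‖x - coordReflection 0 y‖ ^ 2))

theorem norm_axis_point {a : ℝ} (ha : 0 ≤ a) : ‖(!₂[a, 0] : Plane)‖ = a := by
  rw [EuclideanSpace.norm_eq, Fin.sum_univ_two]
  simp [Real.sqrt_sq_eq_abs, abs_of_nonneg ha]

theorem norm_pos_of_mem_quadrant {x : Plane} (hx : x ∈ quadrant) : 0 < ‖x‖ :=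
  hx.1.trans_le ((le_abs_self _).trans (abs_coord_le_norm x 0))

theorem IsHeatMixture.convVelocity_axis (h : IsHeatMixture R γ μ) {f : Plane → ℝ}
    (hf : Integrable f) {M : ℝ} (hM : ∀ y, |f y| ≤ M)
    (hodd : ∀ y, f (coordReflection 0 y) = -f y) {x : Plane} (hx : x 1 = 0) :
    Integrable (foldedIntegrand μ f x) ∧
      convVelocity μ f x 0 = 1 / 2 * ∫ y, foldedIntegrand μ f x y := by
  let F : Plane → ℝ := fun y => (f y • biotSavart μ (x - y)) 0
  have hF : ∀ y, F y = f y * y 1 * radialKernel μ (‖x - y‖ ^ 2) := by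
    intro y
    simp only [F, biotSavart, PiLp.smul_apply, perp_zero_coord, PiLp.sub_apply, hx, smul_eq_mul]
    ring
  have hvi := h.integrable_smul_biotSavart hf hM x
  have hFi : Integrable F := (EuclideanSpace.proj (𝕜 := ℝ) (0 : Fin 2)).integrable_comp hvi
  have hFσ : Integrable fun y => F (coordReflection 0 y) :=
    ((coordReflection 0).measurePreserving.integrable_comp_emb
      (coordReflection 0).toHomeomorph.measurableEmbedding).2 hFi
  have hsum : ∀ y, foldedIntegrand μ f x y = F y + F (coordReflection 0 y) := by
    intro y
    rw [hF, hF, hodd, foldedIntegrand, coordReflection_apply 0 y 1]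
    simp
    ring
  have hfun : foldedIntegrand μ f x = fun y => F y + F (coordReflection 0 y) := funext hsum
  refine ⟨hfun ▸ hFi.add hFσ, ?_⟩
  have h1 : convVelocity μ f x 0 = ∫ y, F y :=
    ((EuclideanSpace.proj (𝕜 := ℝ) (0 : Fin 2)).integral_comp_comm hvi).symm
  have h2 : ∫ y, F (coordReflection 0 y) = ∫ y, F y :=
    (coordReflection 0).measurePreserving.integral_comp
      (coordReflection 0).toHomeomorph.measurableEmbedding F
  rw [hfun, integral_add hFi hFσ, h2, h1]
  ring

/-- The sign of `f y * y 1` is that of `y 0`, and the kernel decreases with the distance. -/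
theorem IsHeatMixture.foldedIntegrand_nonneg (h : IsHeatMixture R γ μ) {f : Plane → ℝ}
    (hodd : ∀ i y, f (coordReflection i y) = -f y)
    (hpos : ∀ y : Plane, 0 ≤ y 0 → 0 ≤ y 1 → 0 ≤ f y) {x : Plane} (hx0 : 0 < x 0) (hx : x 1 = 0)
    (y : Plane) : 0 ≤ foldedIntegrand μ f x y := by
  have hright : ∀ z : Plane, 0 ≤ z 0 → 0 ≤ f z * z 1 := by
    intro z hz
    rcases le_total 0 (z 1) with h1 | h1
    · exact mul_nonneg (hpos z hz h1) h1
    · have h2 := hpos (coordReflection 1 z) (by simpa [coordReflection_apply] using hz)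
        (by simpa [coordReflection_apply] using h1)
      rw [hodd] at h2
      exact mul_nonneg_of_nonpos_of_nonpos (by linarith) h1
  -- off the axis the kernels are evaluated at nonzero points, away from their junk value
  rcases eq_or_ne (y 1) 0 with hy | hy
  · simp [foldedIntegrand, hy]
  have hy2 : 0 < y 1 ^ 2 := by positivity
  rw [foldedIntegrand, norm_sub_sq x y hx, norm_sub_coordReflection_sq x y hx]
  rcases le_total 0 (y 0) with h0 | h0
  · refine mul_nonneg (hright y h0) (sub_nonneg.2 (h.radialKernel_antitone (by positivity) ?_))
    nlinarith
  · have h1 := hright (coordReflection 0 y) (by simpa [coordReflection_apply] using h0)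
    rw [hodd, coordReflection_apply 0 y 1] at h1
    simp only [one_ne_zero, if_false, neg_mul] at h1
    refine mul_nonneg_of_nonpos_of_nonpos (by linarith)
      (sub_nonpos.2 (h.radialKernel_antitone (by positivity) ?_))
    nlinarith

/-- The weighted integral with its singularity smoothed at scale `a`. -/
noncomputable def smoothedIntegral (γ : ℝ) (g : Plane → ℝ) (a : ℝ) : ℝ :=
  ∫ x in quadrant, g x * (x 0 * x 1 / (a + ‖x‖) ^ 4) * Real.log (Real.exp 1 + 1 / ‖x‖) ^ (-γ) *
    Real.exp (-‖x‖ ^ 4)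

theorem log_exp_one_add_pos (x : Plane) : 0 < Real.log (Real.exp 1 + 1 / ‖x‖) := by
  refine Real.log_pos ?_
  have h1 : 0 ≤ 1 / ‖x‖ := by positivity
  have h2 : (1 : ℝ) < Real.exp 1 := Real.one_lt_exp_iff.2 one_pos
  linarith

theorem smoothed_nonneg_and_le {g : Plane → ℝ}
    (hg0 : ∀ x : Plane, 0 ≤ x 0 → 0 ≤ x 1 → 0 ≤ g x) {a : ℝ}
    (ha : 0 ≤ a) {x : Plane} (hx : x ∈ quadrant) :
    0 ≤ g x * (x 0 * x 1 / (a + ‖x‖) ^ 4) * Real.log (Real.exp 1 + 1 / ‖x‖) ^ (-γ) *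
      Real.exp (-‖x‖ ^ 4) ∧
    g x * (x 0 * x 1 / (a + ‖x‖) ^ 4) * Real.log (Real.exp 1 + 1 / ‖x‖) ^ (-γ) *
      Real.exp (-‖x‖ ^ 4) ≤
    g x * (x 0 * x 1 / ‖x‖ ^ 4) * Real.log (Real.exp 1 + 1 / ‖x‖) ^ (-γ) * Real.exp (-‖x‖ ^ 4) := by
  have hn : 0 < ‖x‖ := norm_pos_of_mem_quadrant hx
  obtain ⟨h0, h1⟩ := hx
  have hgx := hg0 x h0.le h1.le
  have hl := Real.rpow_nonneg (log_exp_one_add_pos x).le (-γ)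
  refine ⟨by positivity, ?_⟩
  gcongr
  linarith

theorem integrableOn_smoothed (hgc : Continuous g)
    (hg0 : ∀ x : Plane, 0 ≤ x 0 → 0 ≤ x 1 → 0 ≤ g x) (hG : 0 < weightedIntegral γ g) {a : ℝ}
    (ha : 0 ≤ a) :
    IntegrableOn (fun x : Plane => g x * (x 0 * x 1 / (a + ‖x‖) ^ 4) *
      Real.log (Real.exp 1 + 1 / ‖x‖) ^ (-γ) * Real.exp (-‖x‖ ^ 4)) quadrant := by
  have h1 : IntegrableOn (fun x : Plane => g x * (x 0 * x 1 / ‖x‖ ^ 4) *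
      Real.log (Real.exp 1 + 1 / ‖x‖) ^ (-γ) * Real.exp (-‖x‖ ^ 4)) quadrant := by
    by_contra hc
    exact hG.ne' (integral_undef hc)
  refine Integrable.mono' h1 ?_ ?_
  · have := hgc.measurable
    have h0 := (continuous_coord 0).measurable
    have h1 := (continuous_coord 1).measurable
    exact Measurable.aestronglyMeasurable (by fun_prop)
  · filter_upwards [ae_restrict_mem isOpen_quadrant.measurableSet] with x hx
    have := smoothed_nonneg_and_le (γ := γ) hg0 ha hx
    rw [Real.norm_of_nonneg this.1]
    exact this.2

theorem tendsto_smoothedIntegral (hgc : Continuous g)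
    (hg0 : ∀ x : Plane, 0 ≤ x 0 → 0 ≤ x 1 → 0 ≤ g x) (hG : 0 < weightedIntegral γ g) :
    Tendsto (smoothedIntegral γ g) (𝓝[>] 0) (𝓝 (weightedIntegral γ g)) := by
  have h1 : weightedIntegral γ g = smoothedIntegral γ g 0 := by
    simp only [weightedIntegral, smoothedIntegral, zero_add, quadrant]
  rw [h1]
  refine tendsto_integral_filter_of_dominated_convergence _ ?_ ?_
    (integrableOn_smoothed hgc hg0 hG le_rfl) ?_
  · filter_upwards [self_mem_nhdsWithin] with a ha
    exact (integrableOn_smoothed hgc hg0 hG (le_of_lt ha)).aestronglyMeasurable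
  · filter_upwards [self_mem_nhdsWithin] with a ha
    filter_upwards [ae_restrict_mem isOpen_quadrant.measurableSet] with x hx
    have := smoothed_nonneg_and_le (γ := γ) hg0 (le_of_lt ha) hx
    rw [Real.norm_of_nonneg this.1, zero_add]
    exact this.2
  · filter_upwards [ae_restrict_mem isOpen_quadrant.measurableSet] with x hx
    have hn : 0 < ‖x‖ := norm_pos_of_mem_quadrant hx
    have : ContinuousAt (fun a : ℝ => g x * (x 0 * x 1 / (a + ‖x‖) ^ 4) *
      Real.log (Real.exp 1 + 1 / ‖x‖) ^ (-γ) * Real.exp (-‖x‖ ^ 4)) 0 := by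
      have h2 : ContinuousAt (fun a : ℝ => x 0 * x 1 / (a + ‖x‖) ^ 4) 0 :=
        ContinuousAt.div (by fun_prop) (by fun_prop) (by positivity)
      fun_prop
    exact this.tendsto.mono_left nhdsWithin_le_nhds

/-- The six powers of the distortion lost in the pointwise bound are absorbed by `exp (D ^ 4)`. -/
theorem pow_six_le (D : ℝ) (hD : 1 ≤ D) : D ^ 6 ≤ 2 * Real.exp (D ^ 4) := by
  have h1 := Real.quadratic_le_exp_of_nonneg (x := D ^ 4) (by positivity)
  have h2 : D ^ 6 ≤ (D ^ 4) ^ 2 := by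
    rw [← pow_mul]
    exact pow_le_pow_right₀ hD (by norm_num)
  have h3 : 0 ≤ D ^ 4 := by positivity
  linarith

/-- The pointwise lower bound for the folded kernel, at the images of `(a, 0)` and of a point of
the quadrant under a map with distortion `D`. -/
theorem IsHeatMixture.radialKernel_sub_ge (h : IsHeatMixture R γ μ) (hγ : 0 < γ) {x y z : Plane}
    {a D : ℝ} (ha : 0 < a) (hD : 1 ≤ D) (hz : z ∈ quadrant) (hx0 : 0 < x 0) (hx1 : x 1 = 0)
    (hxa : x 0 ≤ D * a) (hy0 : z 0 ≤ D * y 0) (hy1 : z 1 ≤ D * y 1) (hyz : ‖y‖ ≤ D * ‖z‖) :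
    2 * (2 ^ (-γ) / (384 * Real.pi) * Real.exp (-D ^ 4) * x 0) * (z 0 * z 1 / (a + ‖z‖) ^ 4 *
      Real.log (Real.exp 1 + 1 / ‖z‖) ^ (-γ) * Real.exp (-‖z‖ ^ 4)) ≤
    y 1 * (radialKernel μ (‖x - y‖ ^ 2) - radialKernel μ (‖x - coordReflection 0 y‖ ^ 2)) := by
  have hn : 0 < ‖z‖ := norm_pos_of_mem_quadrant hz
  obtain ⟨hz0, hz1⟩ := hz
  have hD0 : 0 < D := one_pos.trans_le hD
  have hy0' : 0 < y 0 := by by_contra! hc; nlinarith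
  have hy1' : 0 < y 1 := by by_contra! hc; nlinarith
  -- a bound for the distance of `x` to `y` and to the reflection of `y`
  set ρ : ℝ := D * (a + ‖z‖) with hρ
  have hρ0 : 0 < ρ := by positivity
  have hzρ : ‖z‖ ≤ ρ := by
    rw [hρ]; nlinarith
  have hs1 : 0 < ‖x - y‖ ^ 2 := by
    rw [norm_sub_sq x y hx1]; positivity
  have hs12 : ‖x - coordReflection 0 y‖ ^ 2 - ‖x - y‖ ^ 2 = 4 * x 0 * y 0 := by
    rw [norm_sub_sq x y hx1, norm_sub_coordReflection_sq x y hx1]; ring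
  have hs2 : ‖x - coordReflection 0 y‖ ^ 2 ≤ ρ ^ 2 := by
    have hxn : ‖x‖ = x 0 := by
      have h1 : ‖x‖ ^ 2 = x 0 ^ 2 := by rw [norm_sq_eq, hx1]; ring
      exact (pow_left_inj₀ (norm_nonneg _) hx0.le two_ne_zero).1 h1
    have h1 : ‖x - coordReflection 0 y‖ ≤ ρ := by
      refine (norm_sub_le _ _).trans ?_
      rw [LinearIsometryEquiv.norm_map, hxn, hρ, mul_add]
      exact add_le_add hxa hyz
    exact pow_le_pow_left₀ (norm_nonneg _) h1 2
  have h1 := h.radialKernel_sub hs1 (by nlinarith [mul_pos hx0 hy0']) hρ0 hs2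
  rw [hs12] at h1
  have h2 := symbol_one_div_ge R hγ hn hzρ
  set l : ℝ := Real.log (Real.exp 1 + 1 / ‖z‖) ^ (-γ) with hl
  have hl0 : 0 ≤ l := Real.rpow_nonneg (log_exp_one_add_pos z).le _
  have hc0 : (0 : ℝ) < 2 ^ (-γ) := Real.rpow_pos_of_pos two_pos _
  have hz01 : z 0 * z 1 ≤ D ^ 2 * (y 0 * y 1) := by
    calc z 0 * z 1 ≤ (D * y 0) * (D * y 1) := by gcongr
      _ = _ := by ring
  have hexp : Real.exp (-D ^ 4) ≤ 2 / D ^ 6 := by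
    rw [Real.exp_neg, le_div_iff₀ (by positivity), inv_mul_le_iff₀ (Real.exp_pos _)]
    linarith [pow_six_le D hD]
  have hexp1 : Real.exp (-‖z‖ ^ 4) ≤ 1 := by
    rw [Real.exp_le_one_iff, neg_nonpos]; positivity
  calc 2 * (2 ^ (-γ) / (384 * Real.pi) * Real.exp (-D ^ 4) * x 0) * (z 0 * z 1 / (a + ‖z‖) ^ 4 *
        l * Real.exp (-‖z‖ ^ 4))
      ≤ 2 * (2 ^ (-γ) / (384 * Real.pi) * (2 / D ^ 6) * x 0) *
          (D ^ 2 * (y 0 * y 1) / (a + ‖z‖) ^ 4 * l * 1) := by gcongr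
    _ = y 1 * (4 * x 0 * y 0 / (384 * Real.pi * ρ ^ 4) * (2 ^ (-γ) * l)) := by
        rw [hρ]
        have := Real.pi_pos
        field_simp
        ring
    _ ≤ y 1 * (4 * x 0 * y 0 / (384 * Real.pi * ρ ^ 4) * R.symbol γ (1 / ρ)) := by
        have := Real.pi_pos
        gcongr
    _ ≤ _ := by gcongr

/-- The strain felt by the particle started at `(a, 0)`. The folded integral is restricted to the
quadrant, and the area preserving change of variables `y = φ(t, z)` replaces the vorticity at time
`t` by its initial value. -/
theorem IsSmoothSolution.velocity_flow_ge (hw : IsSmoothSolution R γ g w)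
    (h : IsHeatMixture R γ μ) (hγ : 0 < γ) (hg : HasCompactSupport g) (hgc : Continuous g)
    (hgi : ∀ i x, g (coordReflection i x) = -g x)
    (hg0 : ∀ x : Plane, 0 ≤ x 0 → 0 ≤ x 1 → 0 ≤ g x) (hG : 0 < weightedIntegral γ g)
    (hφ : IsCharacteristicFlow R γ w φ) {t a : ℝ} (ht : 0 ≤ t) (ha : 0 < a) :
    2 ^ (-γ) / (384 * Real.pi) * Real.exp (-deformationNorm (φ t) ^ 4) *
      (φ t !₂[a, 0]) 0 * smoothedIntegral γ g a ≤ velocity R γ (w t) (φ t !₂[a, 0]) 0 := by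
  obtain ⟨L, U, hu⟩ := hw.exists_isRegularField h hg t
  have hf := hφ.isFlow t
  have htt : t ∈ Icc 0 t := right_mem_Icc.2 ht
  have haxis : ∀ s ∈ Icc 0 t, ∀ x : Plane, ∀ i, x i = 0 → velocity R γ (w s) x i = 0 :=
    fun s hs x i hx => hw.velocity_axis h hg hgi hs.1 hx
  set D := deformationNorm (φ t) with hD
  have hD1 : 1 ≤ D := hf.one_le_deformationNorm hu htt
  set x := φ t !₂[a, 0] with hx
  have hx0 : 0 < x 0 := hf.coord_pos hu haxis htt (by simpa using ha)
  have hx1 : x 1 = 0 := (hf.coord_eq_zero_iff hu haxis htt _ 1).2 (by simp)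
  have hxa : x 0 ≤ D * a := by
    have h1 := hf.norm_le hu haxis htt !₂[a, 0]
    rw [norm_axis_point ha.le] at h1
    exact ((le_abs_self _).trans (abs_coord_le_norm x 0)).trans h1
  have hodd : ∀ i y, w t (coordReflection i y) = -w t y := fun i y => hw.odd h hg (hgi i) ht y
  have hpos : ∀ y : Plane, 0 ≤ y 0 → 0 ≤ y 1 → 0 ≤ w t y := fun y h0 h1 =>
    hw.nonneg_of_quadrant h hg hgi hg0 ht h0 h1
  obtain ⟨B, hB⟩ := hw.bounded t
  obtain ⟨hint, hvel⟩ := h.convVelocity_axis (hw.integrable t ht) (hB t htt).2 (hodd 0) hx1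
  have hnn := h.foldedIntegrand_nonneg hodd hpos hx0 hx1
  rw [hw.velocity_eq h ht, hvel]
  have hinj : InjOn (φ t) quadrant := (hf.injective hu htt).injOn
  have hder : ∀ z ∈ quadrant, HasFDerivWithinAt (φ t) (fderiv ℝ (φ t) z) quadrant z := fun z _ =>
    (hf.differentiable hu htt z).hasFDerivAt.hasFDerivWithinAt
  have hdet : ∀ z, |(fderiv ℝ (φ t) z).det| = 1 := fun z => by
    rw [det_eq_planeDet, hf.planeDet_fderiv hu htt, abs_one]
  have hQm := isOpen_quadrant.measurableSet
  have hcv := integral_image_eq_integral_abs_det_fderiv_smul volume hQm hder hinj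
    (foldedIntegrand μ (w t) x)
  have hci := (integrableOn_image_iff_integrableOn_abs_det_fderiv_smul volume hQm hder hinj
    (foldedIntegrand μ (w t) x)).1 hint.integrableOn
  simp only [hdet, one_smul] at hcv hci
  have hlow : 2 * (2 ^ (-γ) / (384 * Real.pi) * Real.exp (-D ^ 4) * x 0) * smoothedIntegral γ g a ≤
      ∫ z in quadrant, foldedIntegrand μ (w t) x (φ t z) := by
    rw [smoothedIntegral, ← integral_const_mul]
    refine setIntegral_mono_on ((integrableOn_smoothed hgc hg0 hG ha.le).const_mul _) hci hQm
      fun z hz => ?_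
    have h1 := h.radialKernel_sub_ge hγ ha hD1 hz hx0 hx1 hxa (hf.coord_le hu haxis htt hz.1)
      (hf.coord_le hu haxis htt hz.2) (hf.norm_le hu haxis htt z)
    have h2 := mul_le_mul_of_nonneg_left h1 (hg0 z hz.1.le hz.2.le)
    rw [foldedIntegrand, hw.apply_flow hφ ht]
    refine Eq.trans_le ?_ (h2.trans_eq ?_) <;> ring
  have hfull : ∫ z in quadrant, foldedIntegrand μ (w t) x (φ t z) ≤
      ∫ y, foldedIntegrand μ (w t) x y := by
    rw [← hcv]
    exact setIntegral_le_integral hint (ae_of_all _ hnn)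
  linarith

end

section

variable {R : Regularization} {γ : ℝ} {μ : Measure ℝ} {g : Plane → ℝ} {w : ℝ → Plane → ℝ}
  {φ : ℝ → Plane → Plane}

/-! ### Growth of the deformation norm -/

theorem IsSmoothSolution.continuousOn_deformationNorm (hw : IsSmoothSolution R γ g w)
    (h : IsHeatMixture R γ μ) (hg : HasCompactSupport g) (hφ : IsCharacteristicFlow R γ w φ) :
    ContinuousOn (fun t => deformationNorm (φ t)) (Ici 0) := by
  intro t ht
  obtain ⟨L, U, hu⟩ := hw.exists_isRegularField h hg (t + 1)
  refine ((hφ.isFlow (t + 1)).continuousOn_deformationNorm hu t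
    ⟨ht, by linarith⟩).mono_of_mem_nhdsWithin ?_
  rw [← Ici_inter_Iic]
  exact inter_mem_nhdsWithin _ (Iic_mem_nhds (by linarith))

/-- The first coordinate `p` of the particle started at `(a, 0)` satisfies `p' ≥ κ E p` with `κ`
proportional to the smoothed integral at scale `a`, while `p ≤ a D`; the scale `a` then tends to
zero. The continuous function `E` extends `exp (-D ^ 4)` to negative times, where the flow carries
no information. -/
theorem IsSmoothSolution.integral_le_log_deformationNorm (hw : IsSmoothSolution R γ g w)
    (h : IsHeatMixture R γ μ) (hγ : 0 < γ) (hg : HasCompactSupport g) (hgc : Continuous g)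
    (hgi : ∀ i x, g (coordReflection i x) = -g x)
    (hg0 : ∀ x : Plane, 0 ≤ x 0 → 0 ≤ x 1 → 0 ≤ g x) (hG : 0 < weightedIntegral γ g)
    (hφ : IsCharacteristicFlow R γ w φ) {E : ℝ → ℝ} (hEc : Continuous E)
    (hE : ∀ s, 0 ≤ s → E s = Real.exp (-deformationNorm (φ s) ^ 4)) {t : ℝ} (ht : 0 ≤ t) :
    2 ^ (-γ) / (384 * Real.pi) * weightedIntegral γ g * ∫ s in (0 : ℝ)..t, E s ≤
      Real.log (deformationNorm (φ t)) := by
  obtain ⟨L, U, hu⟩ := hw.exists_isRegularField h hg t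
  have hf := hφ.isFlow t
  have htt : t ∈ Icc 0 t := right_mem_Icc.2 ht
  have haxis : ∀ s ∈ Icc 0 t, ∀ x : Plane, ∀ i, x i = 0 → velocity R γ (w s) x i = 0 :=
    fun s hs x i hx => hw.velocity_axis h hg hgi hs.1 hx
  set c : ℝ := 2 ^ (-γ) / (384 * Real.pi) with hc
  have hlim : Tendsto (fun a => c * smoothedIntegral γ g a * ∫ s in (0 : ℝ)..t, E s) (𝓝[>] 0)
      (𝓝 (c * weightedIntegral γ g * ∫ s in (0 : ℝ)..t, E s)) :=
    ((tendsto_smoothedIntegral hgc hg0 hG).const_mul c).mul_const _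
  refine le_of_tendsto hlim ?_
  filter_upwards [self_mem_nhdsWithin] with a ha
  have ha : 0 < a := ha
  set κ := c * smoothedIntegral γ g a with hκ
  let p : ℝ → ℝ := fun s => φ s !₂[a, 0] 0
  have hp : ∀ s ∈ Icc 0 t, 0 < p s := fun s hs => hf.coord_pos hu haxis hs (by simpa using ha)
  have hp0 : p 0 = a := by simp [p, hφ.initial]
  have hpd : ∀ s ∈ Icc 0 t,
      HasDerivWithinAt p (velocity R γ (w s) (φ s !₂[a, 0]) 0) (Icc 0 t) s := fun s hs =>
    (EuclideanSpace.proj (𝕜 := ℝ) (0 : Fin 2)).hasFDerivAt.comp_hasDerivWithinAt s (hf.ode s hs _)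
  have hEd : ∀ s, HasDerivAt (fun s => ∫ τ in (0 : ℝ)..s, E τ) (E s) s := fun s =>
    (hEc.integral_hasStrictDerivAt 0 s).hasDerivAt
  have hqd : ∀ s ∈ Icc 0 t, HasDerivWithinAt (fun s => Real.log (p s) - κ * ∫ τ in (0 : ℝ)..s, E τ)
      (velocity R γ (w s) (φ s !₂[a, 0]) 0 / p s - κ * E s) (Icc 0 t) s := fun s hs =>
    ((hpd s hs).log (hp s hs).ne').sub ((hEd s).const_mul κ).hasDerivWithinAt
  have hmono : MonotoneOn (fun s => Real.log (p s) - κ * ∫ τ in (0 : ℝ)..s, E τ) (Icc 0 t) := by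
    refine monotoneOn_of_hasDerivWithinAt_nonneg (convex_Icc 0 t)
      (fun s hs => (hqd s hs).continuousWithinAt)
      (fun s hs => (hqd s (interior_subset hs)).mono interior_subset) fun s hs => ?_
    have hs' : s ∈ Icc 0 t := interior_subset hs
    have h1 := hw.velocity_flow_ge h hγ hg hgc hgi hg0 hG hφ hs'.1 ha
    rw [sub_nonneg, le_div_iff₀ (hp s hs'), hE s hs'.1]
    refine Eq.trans_le ?_ h1
    simp only [hκ, p]
    ring
  have h1 := hmono (left_mem_Icc.2 ht) htt ht
  simp only [hp0, intervalIntegral.integral_same, mul_zero, sub_zero] at h1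
  have h2 : p t ≤ deformationNorm (φ t) * a := by
    have h3 := hf.norm_le hu haxis htt !₂[a, 0]
    rw [norm_axis_point ha.le] at h3
    exact ((le_abs_self _).trans (abs_coord_le_norm (φ t !₂[a, 0]) 0)).trans h3
  have h3 := Real.log_le_log (hp t htt) h2
  have h4 : deformationNorm (φ t) ≠ 0 := (one_pos.trans_le (hf.one_le_deformationNorm hu htt)).ne'
  rw [Real.log_mul h4 ha.ne'] at h3
  linarith

/-- If `log D` dominates `κ F`, where `F` is the integral of `E = exp (-D ^ 4)`, then
`D ^ 4 ≥ log D ≥ κ F`, so `F' ≤ exp (-κ F)` and `exp (κ F) - κ t` is nonincreasing. -/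
theorem integral_exp_neg_le_log {D E : ℝ → ℝ} {κ : ℝ} (hκ : 0 < κ) (hEc : Continuous E)
    (hE : ∀ s, 0 ≤ s → E s = Real.exp (-D s ^ 4)) (hD : ∀ s, 0 ≤ s → 1 ≤ D s)
    (hlog : ∀ s, 0 ≤ s → κ * ∫ τ in (0 : ℝ)..s, E τ ≤ Real.log (D s)) {t : ℝ} (ht : 0 ≤ t) :
    ∫ τ in (0 : ℝ)..t, E τ ≤ 1 / κ * Real.log (1 + κ * t) := by
  set F : ℝ → ℝ := fun s => ∫ τ in (0 : ℝ)..s, E τ with hF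
  have hFd : ∀ s, HasDerivAt F (E s) s := fun s => (hEc.integral_hasStrictDerivAt 0 s).hasDerivAt
  have hEle : ∀ s, 0 ≤ s → E s ≤ Real.exp (-(κ * F s)) := by
    intro s hs
    rw [hE s hs, Real.exp_le_exp, neg_le_neg_iff]
    have hD0 : 0 < D s := one_pos.trans_le (hD s hs)
    have h1 : Real.log (D s) ≤ D s := (Real.log_le_sub_one_of_pos hD0).trans (by linarith)
    have h2 : D s ≤ D s ^ 4 := le_self_pow₀ (hD s hs) (by norm_num)
    linarith [hlog s hs]
  have hd : ∀ s, HasDerivAt (fun s => Real.exp (κ * F s) - κ * s)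
      (Real.exp (κ * F s) * (κ * E s) - κ * 1) s := fun s =>
    (((hFd s).const_mul κ).exp).sub ((hasDerivAt_id s).const_mul κ)
  have hanti : AntitoneOn (fun s => Real.exp (κ * F s) - κ * s) (Ici 0) := by
    refine antitoneOn_of_hasDerivWithinAt_nonpos (convex_Ici 0)
      (fun s _ => (hd s).continuousAt.continuousWithinAt)
      (fun s _ => (hd s).hasDerivWithinAt) fun s hs => ?_
    have hs' : (0 : ℝ) ≤ s := interior_subset (s := Ici (0 : ℝ)) hs
    have h1 := mul_le_mul_of_nonneg_left (hEle s hs') (Real.exp_pos (κ * F s)).le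
    rw [← Real.exp_add, add_neg_cancel, Real.exp_zero] at h1
    nlinarith
  have h1 := hanti (mem_Ici.2 le_rfl) (mem_Ici.2 ht) ht
  have h0 : F 0 = 0 := intervalIntegral.integral_same
  simp only [h0, mul_zero, Real.exp_zero, sub_zero] at h1
  have h2 : κ * F t ≤ Real.log (1 + κ * t) := by
    rw [Real.le_log_iff_exp_le (by positivity)]
    linarith
  rw [div_mul_eq_mul_div, one_mul, le_div_iff₀ hκ, mul_comm]
  exact h2

/-- An upper bound `M` for `D` makes the integral at least `t exp (-M ^ 4)`. -/
theorem log_rpow_le_of_integral_le {D : ℝ → ℝ} {κ t M : ℝ} (hκ : 0 < κ) (ht : 0 < t)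
    (hM : ∀ s ∈ Icc 0 t, D s ≤ M) (hD : ∀ s ∈ Icc 0 t, 1 ≤ D s)
    (hi : IntervalIntegrable (fun s => Real.exp (-D s ^ 4)) volume 0 t)
    (hle : ∫ s in (0 : ℝ)..t, Real.exp (-D s ^ 4) ≤ 1 / κ * Real.log (1 + κ * t)) :
    Real.log (κ * t / Real.log (1 + κ * t)) ^ ((1 : ℝ) / 4) ≤ M := by
  have hM0 : 0 ≤ M := (zero_le_one.trans (hD 0 (left_mem_Icc.2 ht.le))).trans
    (hM 0 (left_mem_Icc.2 ht.le))
  have hκt : 0 < κ * t := by positivity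
  have hl0 : 0 < Real.log (1 + κ * t) := Real.log_pos (by linarith)
  have hl1 : Real.log (1 + κ * t) ≤ κ * t := by
    have := Real.log_le_sub_one_of_pos (show 0 < 1 + κ * t by linarith)
    linarith
  have h1 : t * Real.exp (-M ^ 4) ≤ ∫ s in (0 : ℝ)..t, Real.exp (-D s ^ 4) := by
    have h2 : ∫ _ in (0 : ℝ)..t, Real.exp (-M ^ 4) = t * Real.exp (-M ^ 4) := by simp
    rw [← h2]
    refine intervalIntegral.integral_mono_on ht.le (by simp) hi fun s hs => ?_
    have := zero_le_one.trans (hD s hs)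
    have := hM s hs
    gcongr
  have h2 : κ * t / Real.log (1 + κ * t) ≤ Real.exp (M ^ 4) := by
    have h3 := h1.trans hle
    rw [Real.exp_neg, div_mul_eq_mul_div, one_mul, le_div_iff₀ hκ, mul_assoc, mul_comm _ κ,
      ← mul_assoc, mul_inv_le_iff₀ (Real.exp_pos _)] at h3
    rw [div_le_iff₀ hl0]
    linarith
  have h3 : Real.log (κ * t / Real.log (1 + κ * t)) ≤ M ^ 4 :=
    (Real.log_le_iff_le_exp (by positivity)).2 h2
  have h4 : 0 ≤ Real.log (κ * t / Real.log (1 + κ * t)) :=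
    Real.log_nonneg ((one_le_div hl0).2 hl1)
  calc Real.log (κ * t / Real.log (1 + κ * t)) ^ ((1 : ℝ) / 4) ≤ (M ^ 4) ^ ((1 : ℝ) / 4) :=
        Real.rpow_le_rpow h4 h3 (by norm_num)
    _ = M := by
        rw [one_div]
        exact_mod_cast Real.pow_rpow_inv_natCast hM0 (by norm_num : (4 : ℕ) ≠ 0)

theorem plane_ext (x : Plane) : x = !₂[x 0, x 1] := by
  ext i; fin_cases i <;> simp

end

end LogEuler

theorem proposition3p5 (γ : ℝ) (hγ : 0 < γ) :
    ∃ C : ℝ, 0 < C ∧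
      ∀ (R : LogEuler.Regularization) (g : LogEuler.Plane → ℝ),
        ContDiff ℝ ∞ g → HasCompactSupport g →
        (∀ a b : ℝ, g !₂[-a, b] = -g !₂[a, b]) →
        (∀ a b : ℝ, g !₂[a, -b] = -g !₂[a, b]) →
        (∀ a b : ℝ, 0 ≤ a → 0 ≤ b → 0 ≤ g !₂[a, b]) →
        0 < LogEuler.weightedIntegral γ g →
        ∀ (w : ℝ → LogEuler.Plane → ℝ) (φ : ℝ → LogEuler.Plane → LogEuler.Plane),
          LogEuler.IsSmoothSolution R γ g w →
          LogEuler.IsCharacteristicFlow R γ w φ →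
          -- `Dφ(·, t)` exists and is bounded
          (∀ t : ℝ, 0 ≤ t → Differentiable ℝ (φ t) ∧
            BddAbove (Set.range fun x => ‖fderiv ℝ (φ t) x‖)) ∧
          -- the integral bound
          (∀ t : ℝ, 0 ≤ t →
            IntervalIntegrable (fun τ => Real.exp (-LogEuler.deformationNorm (φ τ) ^ 4))
              MeasureTheory.volume 0 t ∧
            (∫ τ in (0 : ℝ)..t, Real.exp (-LogEuler.deformationNorm (φ τ) ^ 4)) ≤
              1 / (C * LogEuler.weightedIntegral γ g) *
                Real.log (1 + C * LogEuler.weightedIntegral γ g * t)) ∧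
          -- the lower bound for the maximum, which is attained
          (∀ t : ℝ, 0 < t →
            ∃ M : ℝ, IsGreatest ((fun τ => LogEuler.deformationNorm (φ τ)) '' Set.Icc 0 t) M ∧
              Real.log (C * LogEuler.weightedIntegral γ g * t /
                Real.log (1 + C * LogEuler.weightedIntegral γ g * t)) ^ ((1 : ℝ) / 4) ≤ M) := by
  have hC : (0 : ℝ) < 2 ^ (-γ) / (384 * Real.pi) :=
    div_pos (Real.rpow_pos_of_pos two_pos _) (by positivity)
  refine ⟨2 ^ (-γ) / (384 * Real.pi), hC, ?_⟩
  intro R g hgs hg hodd0 hodd1 hnn hG w φ hw hφ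
  obtain ⟨μ, h⟩ := LogEuler.exists_isHeatMixture R hγ
  have hgi : ∀ i x, g (LogEuler.coordReflection i x) = -g x := by
    intro i x
    rw [LogEuler.plane_ext (LogEuler.coordReflection i x), LogEuler.plane_ext x]
    fin_cases i
    · simpa [LogEuler.coordReflection_apply] using hodd0 (x 0) (x 1)
    · simpa [LogEuler.coordReflection_apply] using hodd1 (x 0) (x 1)
  have hg0 : ∀ x : LogEuler.Plane, 0 ≤ x 0 → 0 ≤ x 1 → 0 ≤ g x := by
    intro x h0 h1
    rw [LogEuler.plane_ext x]
    exact hnn _ _ h0 h1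
  have hreg : ∀ t, 0 ≤ t → Differentiable ℝ (φ t) ∧
      BddAbove (Set.range fun x => ‖fderiv ℝ (φ t) x‖) ∧ 1 ≤ LogEuler.deformationNorm (φ t) := by
    intro t ht
    obtain ⟨L, U, hu⟩ := hw.exists_isRegularField h hg t
    have hf := hφ.isFlow t
    have htt : t ∈ Set.Icc 0 t := Set.right_mem_Icc.2 ht
    exact ⟨hf.differentiable hu htt, hf.bddAbove_norm_fderiv hu htt,
      hf.one_le_deformationNorm hu htt⟩
  have hDc := hw.continuousOn_deformationNorm h hg hφ
  set κ : ℝ := 2 ^ (-γ) / (384 * Real.pi) * LogEuler.weightedIntegral γ g with hκ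
  have hκ0 : 0 < κ := mul_pos hC hG
  let E : ℝ → ℝ := fun s => Real.exp (-LogEuler.deformationNorm (φ (max s 0)) ^ 4)
  have hEc : Continuous E := by
    have h1 : Continuous fun s : ℝ => LogEuler.deformationNorm (φ (max s 0)) :=
      hDc.comp_continuous (by fun_prop) fun s => le_max_right s 0
    fun_prop
  have hE : ∀ s, 0 ≤ s → E s = Real.exp (-LogEuler.deformationNorm (φ s) ^ 4) := by
    intro s hs
    simp only [E, max_eq_left hs]
  have hint : ∀ t : ℝ, 0 ≤ t →
      IntervalIntegrable (fun τ => Real.exp (-LogEuler.deformationNorm (φ τ) ^ 4))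
        MeasureTheory.volume 0 t ∧
      (∫ τ in (0 : ℝ)..t, Real.exp (-LogEuler.deformationNorm (φ τ) ^ 4)) ≤
        1 / κ * Real.log (1 + κ * t) := by
    intro t ht
    have heq : Set.EqOn E (fun τ => Real.exp (-LogEuler.deformationNorm (φ τ) ^ 4))
        (Set.uIcc 0 t) := by
      intro s hs
      rw [Set.uIcc_of_le ht] at hs
      exact hE s hs.1
    refine ⟨(hEc.intervalIntegrable 0 t).congr (heq.mono Set.uIoc_subset_uIcc), ?_⟩
    rw [← intervalIntegral.integral_congr heq]
    exact LogEuler.integral_exp_neg_le_log hκ0 hEc hE (fun s hs => (hreg s hs).2.2)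
      (fun s hs =>
        hw.integral_le_log_deformationNorm h hγ hg hgs.continuous hgi hg0 hG hφ hEc hE hs)
      ht
  refine ⟨fun t ht => ⟨(hreg t ht).1, (hreg t ht).2.1⟩, hint, fun t ht => ?_⟩
  obtain ⟨s, hs, hmax⟩ := isCompact_Icc.exists_isMaxOn (Set.nonempty_Icc.2 ht.le)
    (hDc.mono fun s hs => hs.1)
  refine ⟨LogEuler.deformationNorm (φ s), ⟨⟨s, hs, rfl⟩, ?_⟩, ?_⟩
  · rintro _ ⟨τ, hτ, rfl⟩
    exact hmax hτ
  · exact LogEuler.log_rpow_le_of_integral_le (D := fun τ => LogEuler.deformationNorm (φ τ)) hκ0 ht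
      (fun τ hτ => hmax hτ) (fun τ hτ => (hreg τ hτ.1).2.2) (hint t ht.le).1 (hint t ht.le).2
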